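/- Let $n\geq 1$ be an integer and let $\ell>-1$, $\mu\ge 0$, $\nu^2\geq 0$ be real numbers with $\delta:=(\mu-1)^2-4\nu^2\geq 0$. Put $\phi_\ell(t):=\frac{t^{\ell+1}}{\ell+1}$ and $$k:=(\ell+1)n+\tfrac{\mu-1}{2}-\tfrac{\sqrt\delta}{2},\qquad \theta(n,\ell,\mu,p):=\ell+1+\Big(\tfrac{n+1}{2}(\ell+1)+\tfrac{\mu-3\ell}{2}\Big)p-\Big(\tfrac{n-1}{2}(\ell+1)+\tfrac{\ell+\mu}{2}\Big)p^2 .$$ Let $p_{\mathrm{Fuj}}(k):=1+\frac2k$ for $k>0$ and $p_{\mathrm{Fuj}}(k):=\infty$ for $k\le 0$. For real $d$ let $p_{\mathrm{Str}}(d,\ell)$ be the largest root $q$ of $$\Big(\tfrac{d-1}{2}+\tfrac{\ell}{2(\ell+1)}\Big)q^2-\Big(\tfrac{d+1}{2}-\tfrac{3\ell}{2(\ell+1)}\Big)q-1=0$$ if the coefficient of $q^2$ is positive, and $p_{\mathrm{Str}}(d,\ell):=\infty$ otherwise. Consider, for $\varepsilon>0$ and $p>1$, the Cauchy problem $$\partial_t^2u-t^{2\ell}\Delta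 u+\mu t^{-1}\partial_tu+\nu^2t^{-2}u=|u|^p\quad (t>1,\ x\in\mathbb R^n),\qquad u(1,\cdot)=\varepsilon u_0,\quad \partial_tu(1,\cdot)=\varepsilon u_1. \qquad (*)$$ Weak solutions. Let $B_r$ be the closed ball of radius $r$ around the origin of $\mathbb R^n$, let $R>0$, and let $u_0,u_1\in L^1_{\mathrm{loc}}(\mathbb R^n)$ have supports in $B_R$. For $1<T\le\infty$, a weak solution of $(*)$ on $[1,T)$ is a function $$u\in C\big([1,T),W^{1,1}_{\mathrm{loc}}(\mathbb R^n)\big)\cap C^1\big([1,T),L^1_{\mathrm{loc}}(\mathbb R^n)\big)\cap L^p_{\mathrm{loc}}\big((1,T)\times\mathbb R^n\big)$$ such that $u(1,\cdot)=\varepsilon u_0$ almost everywhere, $\mathrm{supp}\,u(t,\cdot)\subset B_{R+\phi_\ell(t)-\phi_\ell(1)}$ for all $t\in(1,T)$, and, for all $t\in(1,T)$ and all $\phi\in C_0^\infty([1,T)\times\mathbb R^n)$, the function $|u|^p\phi$ is integrable on $(1,t)\times\mathbb R^n$ and $$\int_{\mathbb R^n}\partial_tu(t,x)\phi(t,x)\,dx+\int_1^t\!\int_{\mathbb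 R^n}\big(-\partial_tu\,\phi_s+s^{2\ell}\nabla u\cdot\nabla\phi\big)\,dx\,ds+\int_1^t\!\int_{\mathbb R^n}\big(\mu s^{-1}\partial_tu\,\phi+\nu^2s^{-2}u\,\phi\big)\,dx\,ds$$ $$=\varepsilon\int_{\mathbb R^n}u_1(x)\phi(1,x)\,dx+\int_1^t\!\int_{\mathbb R^n}|u|^p\phi\,dx\,ds .$$ Theorem. Let $$1<p<\max\Big\{p_{\mathrm{Str}}\big(n+\tfrac{\mu}{\ell+1},\ell\big),\,p_{\mathrm{Fuj}}(k)\Big\},$$ and let $u_0,u_1\in L^1_{\mathrm{loc}}(\mathbb R^n)$ be functions with supports in $B_R$, each of them nonnegative and not almost everywhere zero, such that $u_1+\frac{\mu-1-\sqrt\delta}{2}u_0\ge 0$ almost everywhere. Then there are constants $\varepsilon_0>0$ and $C>0$, depending only on $u_0,u_1,n,p,\ell,\mu,\nu^2,R$, such that for every $\varepsilon\in(0,\varepsilon_0]$, every $1<T\le\infty$ and every weak solution $u$ of $(*)$ on $[1,T)$ one has $T<\infty$ (so no weak solution is global: every weak solution blows up in finite time), and the following bounds for the lifespan hold: $$T\le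 C\varepsilon^{-\frac{p(p-1)}{\theta(n,\ell,\mu,p)}}\quad\text{if } p<p_{\mathrm{Str}}\big(n+\tfrac{\mu}{\ell+1},\ell\big),\qquad T\le C\varepsilon^{-\left(\frac{2}{p-1}-k\right)^{-1}}\quad\text{if } p<p_{\mathrm{Fuj}}(k).$$ -/

import Mathlib

open MeasureTheory Filter Topology Set
open scoped ContDiff ENNReal

namespace EPDT

/-- The leading coefficient of the quadratic polynomial `A q² - B q - 1` that defines the
Strauss-type exponent in (possibly fractional) dimension `d`. -/
noncomputable def strA (d ℓ : ℝ) : ℝ := (d - 1) / 2 + ℓ / (2 * (ℓ + 1))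

/-- The coefficient `B` of the quadratic polynomial `A q² - B q - 1`. -/
noncomputable def strB (d ℓ : ℝ) : ℝ := (d + 1) / 2 - 3 * ℓ / (2 * (ℓ + 1))

/-- The largest root of `A q² - B q - 1` for `A > 0` (see `isGreatest_strRoot`). -/
noncomputable def strRoot (d ℓ : ℝ) : ℝ :=
  (strB d ℓ + √(strB d ℓ ^ 2 + 4 * strA d ℓ)) / (2 * strA d ℓ)

theorem isGreatest_strRoot (d ℓ : ℝ) (hA : 0 < strA d ℓ) :
    IsGreatest {q : ℝ | strA d ℓ * q ^ 2 - strB d ℓ * q - 1 = 0} (strRoot d ℓ) := by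
  have hS : 0 ≤ strB d ℓ ^ 2 + 4 * strA d ℓ := by positivity
  constructor
  · have hs := Real.sq_sqrt hS
    change strA d ℓ * strRoot d ℓ ^ 2 - strB d ℓ * strRoot d ℓ - 1 = 0
    have h : 2 * strA d ℓ * strRoot d ℓ - strB d ℓ = √(strB d ℓ ^ 2 + 4 * strA d ℓ) := by
      rw [strRoot, mul_div_cancel₀ _ (by positivity)]; ring
    rw [← h] at hs
    have h4 : 4 * strA d ℓ * (strA d ℓ * strRoot d ℓ ^ 2 - strB d ℓ * strRoot d ℓ - 1) = 0 := by
      linear_combination hs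
    exact (mul_eq_zero.mp h4).resolve_left (by positivity)
  · intro q hq
    change strA d ℓ * q ^ 2 - strB d ℓ * q - 1 = 0 at hq
    have h : (2 * strA d ℓ * q - strB d ℓ) ^ 2 = strB d ℓ ^ 2 + 4 * strA d ℓ := by
      linear_combination 4 * strA d ℓ * hq
    have h2 : 2 * strA d ℓ * q - strB d ℓ ≤ √(strB d ℓ ^ 2 + 4 * strA d ℓ) := by
      rw [← h]; exact Real.le_sqrt_of_sq_le le_rfl
    rw [strRoot, le_div_iff₀ (by positivity)]
    linarith

/-- The Strauss-type exponent: the largest root of `A q² - B q - 1 = 0`. If the leading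
coefficient is not positive, there is no upper bound and the exponent is `∞`. -/
noncomputable def pStr (d ℓ : ℝ) : EReal :=
  open Classical in if 0 < strA d ℓ then ((strRoot d ℓ : ℝ) : EReal) else ⊤

/-- The Fujita exponent `1 + 2 / k`, which is `∞` for `k ≤ 0`. -/
noncomputable def pFuj (k : ℝ) : EReal :=
  open Classical in if 0 < k then ((1 + 2 / k : ℝ) : EReal) else ⊤

/-- The discriminant `δ = (μ - 1)² - 4 ν²`. -/
def delta (μ ν : ℝ) : ℝ := (μ - 1) ^ 2 - 4 * ν ^ 2

/-- The argument `(ℓ + 1) n + (μ - 1) / 2 - √δ / 2` of the Fujita exponent. -/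
noncomputable def fujDim (n : ℕ) (ℓ μ ν : ℝ) : ℝ :=
  (ℓ + 1) * n + (μ - 1) / 2 - √(delta μ ν) / 2

/-- The quantity `θ(n, ℓ, μ, p)`. -/
noncomputable def theta (n : ℕ) (ℓ μ p : ℝ) : ℝ :=
  ℓ + 1 + (((n : ℝ) + 1) / 2 * (ℓ + 1) + (μ - 3 * ℓ) / 2) * p
    - (((n : ℝ) - 1) / 2 * (ℓ + 1) + (ℓ + μ) / 2) * p ^ 2

/-- `φ_ℓ(t) = t^(ℓ+1) / (ℓ+1)`, the primitive of the speed of propagation `t^ℓ`. -/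
noncomputable def phiEll (ℓ t : ℝ) : ℝ := t ^ (ℓ + 1) / (ℓ + 1)

/-- The time interval `[1, T)`, with `T = ∞` allowed. -/
def timeInterval (T : EReal) : Set ℝ := {t : ℝ | 1 ≤ t ∧ (t : EReal) < T}

section

variable {n : ℕ} {F : Type*} [NormedAddCommGroup F]

/-- `f ∈ C(I, L¹_loc(ℝⁿ; F))`: every `f t` is locally integrable and `t ↦ f t` is continuous for
each of the seminorms `‖·‖_{L¹(K)}` with `K` compact. -/
def ContinuousL1loc (I : Set ℝ) (f : ℝ → EuclideanSpace ℝ (Fin n) → F) : Prop :=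
  (∀ t ∈ I, LocallyIntegrable (f t) volume) ∧
  ∀ K : Set (EuclideanSpace ℝ (Fin n)), IsCompact K → ∀ t ∈ I,
    Tendsto (fun s => ∫⁻ x in K, ‖f s x - f t x‖ₑ) (𝓝[I] t) (𝓝 0)

/-- `f' t` is the derivative at `t`, in `L¹_loc(ℝⁿ)`, of the curve `f`, for every `t ∈ I`
(one-sided at an end point of `I`). -/
def HasDerivL1loc (I : Set ℝ) (f f' : ℝ → EuclideanSpace ℝ (Fin n) → ℝ) : Prop :=
  ∀ K : Set (EuclideanSpace ℝ (Fin n)), IsCompact K → ∀ t ∈ I,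
    Tendsto (fun s => ∫⁻ x in K, ‖(f s x - f t x) / (s - t) - f' t x‖ₑ) (𝓝[I \ {t}] t) (𝓝 0)

/-- `g` is the weak (distributional) gradient of `f` on `ℝⁿ`. -/
def IsWeakGradient (f : EuclideanSpace ℝ (Fin n) → ℝ)
    (g : EuclideanSpace ℝ (Fin n) → EuclideanSpace ℝ (Fin n)) : Prop :=
  ∀ η : EuclideanSpace ℝ (Fin n) → ℝ, ContDiff ℝ ∞ η → HasCompactSupport η → ∀ i : Fin n,
    ∫ x, f x * fderiv ℝ η x (EuclideanSpace.single i 1) = - ∫ x, g x i * η x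

/-- `f ∈ L^p_loc((1, T) × ℝⁿ)`. -/
def MemLploc (p : ℝ) (T : EReal) (f : ℝ → EuclideanSpace ℝ (Fin n) → ℝ) : Prop :=
  ∀ K : Set (ℝ × EuclideanSpace ℝ (Fin n)), IsCompact K →
    K ⊆ {z | 1 < z.1 ∧ (z.1 : EReal) < T} →
    MemLp (fun z : ℝ × EuclideanSpace ℝ (Fin n) => f z.1 z.2) (ENNReal.ofReal p)
      (volume.restrict K)

/-- `φ ∈ C₀^∞([1, T) × ℝⁿ)`, as the restriction of a smooth function on `ℝ × ℝⁿ` whose support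
is compact and lies in `{t < T}`. The support may meet `{t = 1}`. -/
structure IsTestFunction (T : EReal) (φ : ℝ × EuclideanSpace ℝ (Fin n) → ℝ) : Prop where
  contDiff : ContDiff ℝ ∞ φ
  hasCompactSupport : HasCompactSupport φ
  tsupport_subset : tsupport φ ⊆ {z | (z.1 : EReal) < T}

/-- The integral identity that defines weak solutions, at time `t` and for the test function `φ`;
`ut` is the time derivative of `u` and `Du` its spatial gradient. The first conjunct says that
the integral of the nonlinear term converges; the other integrals converge for the functions
in the solution class. -/
def IntegralIdentity (ℓ μ ν p ε : ℝ) (u₁ : EuclideanSpace ℝ (Fin n) → ℝ)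
    (u ut : ℝ → EuclideanSpace ℝ (Fin n) → ℝ)
    (Du : ℝ → EuclideanSpace ℝ (Fin n) → EuclideanSpace ℝ (Fin n))
    (t : ℝ) (φ : ℝ × EuclideanSpace ℝ (Fin n) → ℝ) : Prop :=
  IntegrableOn (fun z : ℝ × EuclideanSpace ℝ (Fin n) => |u z.1 z.2| ^ p * φ z)
    (Ioc 1 t ×ˢ univ) volume ∧
  (∫ x, ut t x * φ (t, x))
    + (∫ s in (1 : ℝ)..t, ∫ x, (- (ut s x * deriv (fun r => φ (r, x)) s)
        + s ^ (2 * ℓ) * inner ℝ (Du s x) (gradient (fun y => φ (s, y)) x)))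
    + (∫ s in (1 : ℝ)..t, ∫ x, (μ * s⁻¹ * ut s x * φ (s, x)
        + ν ^ 2 * (s ^ 2)⁻¹ * u s x * φ (s, x)))
  = ε * (∫ x, u₁ x * φ (1, x))
    + ∫ s in (1 : ℝ)..t, ∫ x, |u s x| ^ p * φ (s, x)

/-- `u` is a weak solution on `[1, T)`, `T ≤ ∞`, of
`u_tt - t^(2ℓ) Δu + μ t⁻¹ u_t + ν² t⁻² u = |u|^p`, `u(1) = ε u₀`, `u_t(1) = ε u₁`. -/
def IsWeakSolution (ℓ μ ν p R ε : ℝ) (u₀ u₁ : EuclideanSpace ℝ (Fin n) → ℝ) (T : EReal)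
    (u : ℝ → EuclideanSpace ℝ (Fin n) → ℝ) : Prop :=
  ∃ (ut : ℝ → EuclideanSpace ℝ (Fin n) → ℝ)
    (Du : ℝ → EuclideanSpace ℝ (Fin n) → EuclideanSpace ℝ (Fin n)),
    -- `u ∈ C([1, T), W^{1,1}_loc)` with gradient `Du`
    ContinuousL1loc (timeInterval T) u ∧
    ContinuousL1loc (timeInterval T) Du ∧
    (∀ t ∈ timeInterval T, IsWeakGradient (u t) (Du t)) ∧
    -- `u ∈ C¹([1, T), L¹_loc)` with derivative `ut`
    ContinuousL1loc (timeInterval T) ut ∧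
    HasDerivL1loc (timeInterval T) u ut ∧
    -- `u ∈ L^p_loc((1, T) × ℝⁿ)`
    MemLploc p T u ∧
    -- initial value
    (∀ᵐ x, u 1 x = ε * u₀ x) ∧
    -- support condition
    (∀ t : ℝ, 1 < t → (t : EReal) < T →
      ∀ᵐ x, R + phiEll ℓ t - phiEll ℓ 1 < ‖x‖ → u t x = 0) ∧
    -- integral identity
    (∀ t : ℝ, 1 < t → (t : EReal) < T →
      ∀ φ : ℝ × EuclideanSpace ℝ (Fin n) → ℝ, IsTestFunction T φ →
        IntegralIdentity ℓ μ ν p ε u₁ u ut Du t φ)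

end

end EPDT

/-! Let `r₁ ≤ r₂` be `(μ - 1 ∓ √δ) / 2`, so that `r₁ + r₂ = μ - 1` and `r₁ r₂ = ν²`. If `ΔΦ = c Φ`
and `W(t) = t ^ r₁ ∫ u(t) Φ`, multiplying the equation by `t ^ (r₂ + 1)` makes its time part an
exact derivative. With `a = 1 + r₂ - r₁ = 1 + √δ ≥ 1` this gives `t ^ a W' = ε ∫ (u₁ + r₁ u₀) Φ + c
∫₁ᵗ s ^ (a + 2ℓ) W ds + ∫₁ᵗ s ^ (r₂ + 1) ∫ |u| ^ p Φ dx ds`, which is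
`IsWeakSolution.weighted_identity`. For `Φ > 0` the data term is nonnegative by hypothesis.

Take `Φ = 1`, `c = 0`. Then `W` is nondecreasing, and Hölder's inequality on the support, a ball of
radius `O(s ^ (ℓ + 1))`, gives `t ^ a W' ≥ C ∫ s ^ (a - m) W ^ p` with `m = k (p - 1)`. On `[t/4,
t]` every power of `s` is comparable with the same power of `t`, so there `W'' ≥ C t ^ (-m) W ^ p`
in integrated form. By `blowup_criterion` a lower bound `W ≥ K s ^ β` then forces `K ^ (p - 1) t ^ κ
≤ C` with `κ = β (p - 1) + 2 - m`. A single application suffices, without iteration.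

Fujita case: monotonicity gives `W ≥ ε ∫ u₀`, so `β = 0` and `κ = 2 - k (p - 1)`.

Strauss case: take a positive radial `Φ` with `ΔΦ = L² Φ`, bounded by a multiple of `(1 + Lr) ^
(-(n-1)/2) e ^ (Lr)`. Comparison with the growing solution of `w'' + (a/t) w' = L² t ^ (2ℓ) w`
yields `W ≥ C ε e ^ (L φ_ℓ(t)) t ^ (-(ℓ+a)/2)` (`exists_exponential_lower_bound`). In Hölder's
inequality against `Φ` the exponentials cancel, leaving a power bound `∫ |u| ^ p ≥ C ε ^ p s ^ e`
(`exists_nonlinear_lower_bound`). Two integrations in the identity for `Φ = 1` give `β = e + 2 + r₁`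
and `K = C ε ^ p`, and then `κ = θ`. -/

namespace EPDT

/-! ### Pairing `L¹_loc` curves with test functions -/

section Pairing

variable {n : ℕ}

local notation "𝔼" => EuclideanSpace ℝ (Fin n)

/-- The constant depends on `ψ` alone, so `L¹` convergence on `tsupport ψ` passes to pairings with
`ψ`. This is how regularity of `u` in `L¹_loc` becomes continuity and differentiability of scalar
functions of time. -/
theorem lintegral_enorm_mul_le {ψ : 𝔼 → ℝ} (hψ : Continuous ψ)
    (hc : HasCompactSupport ψ) :
    ∃ M : ℝ≥0∞, M ≠ ⊤ ∧ ∀ g : 𝔼 → ℝ,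
      ∫⁻ x, ‖g x * ψ x‖ₑ ≤ M * ∫⁻ x in tsupport ψ, ‖g x‖ₑ := by
  obtain ⟨M, hM⟩ := hψ.bounded_above_of_compact_support hc
  refine ⟨ENNReal.ofReal M, ENNReal.ofReal_ne_top, fun g => ?_⟩
  rw [← lintegral_const_mul' _ _ ENNReal.ofReal_ne_top,
    ← lintegral_indicator (isClosed_tsupport ψ).measurableSet]
  refine lintegral_mono fun x => ?_
  by_cases hx : x ∈ tsupport ψ
  · rw [indicator_of_mem hx, enorm_mul, mul_comm]
    gcongr
    rw [← ofReal_norm]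
    exact ENNReal.ofReal_le_ofReal (hM x)
  · simp [image_eq_zero_of_notMem_tsupport hx]

theorem integrable_mul_of_hasCompactSupport {f ψ : 𝔼 → ℝ} (hf : LocallyIntegrable f volume)
    (hψ : Continuous ψ) (hc : HasCompactSupport ψ) : Integrable fun x => f x * ψ x := by
  simpa [mul_comm] using hf.integrable_smul_left_of_hasCompactSupport hψ hc

theorem ContinuousL1loc.continuousOn_integral_mul {I : Set ℝ} {f : ℝ → 𝔼 → ℝ}
    (hf : ContinuousL1loc I f) {ψ : 𝔼 → ℝ} (hψ : Continuous ψ) (hc : HasCompactSupport ψ) :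
    ContinuousOn (fun s => ∫ x, f s x * ψ x) I := by
  intro t ht
  obtain ⟨M, hM, hle⟩ := lintegral_enorm_mul_le hψ hc
  rw [ContinuousWithinAt, tendsto_iff_edist_tendsto_0]
  have h0 := ENNReal.Tendsto.const_mul (hf.2 _ hc t ht) (Or.inr hM)
  rw [mul_zero] at h0
  refine tendsto_of_tendsto_of_tendsto_of_le_of_le' tendsto_const_nhds h0
    (Eventually.of_forall fun _ => zero_le) ?_
  filter_upwards [self_mem_nhdsWithin] with s hs
  rw [edist_eq_enorm_sub, ← integral_sub (integrable_mul_of_hasCompactSupport (hf.1 s hs) hψ hc)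
    (integrable_mul_of_hasCompactSupport (hf.1 t ht) hψ hc)]
  refine (enorm_integral_le_lintegral_enorm _).trans ?_
  simpa only [sub_mul] using hle fun x => f s x - f t x

theorem HasDerivL1loc.hasDerivWithinAt_integral_mul {I : Set ℝ} {f f' : ℝ → 𝔼 → ℝ}
    (hd : HasDerivL1loc I f f') (hf : ∀ t ∈ I, LocallyIntegrable (f t) volume)
    (hf' : ∀ t ∈ I, LocallyIntegrable (f' t) volume)
    {ψ : 𝔼 → ℝ} (hψ : Continuous ψ) (hc : HasCompactSupport ψ) {t : ℝ} (ht : t ∈ I) :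
    HasDerivWithinAt (fun s => ∫ x, f s x * ψ x) (∫ x, f' t x * ψ x) I t := by
  obtain ⟨M, hM, hle⟩ := lintegral_enorm_mul_le hψ hc
  rw [hasDerivWithinAt_iff_tendsto_slope, tendsto_iff_edist_tendsto_0]
  have h0 := ENNReal.Tendsto.const_mul (hd _ hc t ht) (Or.inr hM)
  rw [mul_zero] at h0
  refine tendsto_of_tendsto_of_tendsto_of_le_of_le' tendsto_const_nhds h0
    (Eventually.of_forall fun _ => zero_le) ?_
  filter_upwards [self_mem_nhdsWithin] with s hs
  have hi := fun r (hr : r ∈ I) => integrable_mul_of_hasCompactSupport (hf r hr) hψ hc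
  have hi' := integrable_mul_of_hasCompactSupport (hf' t ht) hψ hc
  have h1 : slope (fun s => ∫ x, f s x * ψ x) t s - ∫ x, f' t x * ψ x
      = ∫ x, ((f s x - f t x) / (s - t) - f' t x) * ψ x := by
    have h2 : Integrable fun x => (f s x * ψ x - f t x * ψ x) / (s - t) :=
      ((hi s hs.1).sub (hi t ht)).div_const _
    rw [slope_def_field, ← integral_sub (hi s hs.1) (hi t ht), ← integral_div,
      ← integral_sub h2 hi']
    congr 1 with x
    ring
  rw [edist_eq_enorm_sub, h1]
  exact (enorm_integral_le_lintegral_enorm _).trans (hle _)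

/-- The Laplacian in coordinates. -/
noncomputable def lap (ψ : 𝔼 → ℝ) (x : 𝔼) : ℝ :=
  ∑ i : Fin n, fderiv ℝ (fun y => fderiv ℝ ψ y (EuclideanSpace.single i 1)) x
    (EuclideanSpace.single i 1)

theorem contDiff_fderiv_apply {ψ : 𝔼 → ℝ} (hψ : ContDiff ℝ ∞ ψ) (v : 𝔼) :
    ContDiff ℝ ∞ fun y => fderiv ℝ ψ y v :=
  (hψ.fderiv_right (m := ∞) (by simp)).clm_apply contDiff_const

theorem hasCompactSupport_fderiv_apply {ψ : 𝔼 → ℝ} (hc : HasCompactSupport ψ) (v : 𝔼) :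
    HasCompactSupport fun y => fderiv ℝ ψ y v :=
  hc.fderiv_apply ℝ v

theorem continuous_lap {ψ : 𝔼 → ℝ} (hψ : ContDiff ℝ ∞ ψ) : Continuous (lap ψ) :=
  continuous_finsetSum _ fun i _ =>
    (contDiff_fderiv_apply (contDiff_fderiv_apply hψ (EuclideanSpace.single i 1))
      (EuclideanSpace.single i 1)).continuous

theorem hasCompactSupport_lap {ψ : 𝔼 → ℝ} (hc : HasCompactSupport ψ) :
    HasCompactSupport (lap ψ) := by
  refine hc.mono' fun x hx => ?_
  by_contra hx'
  refine hx (Finset.sum_eq_zero fun i _ => ?_)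
  have h0 : (fun y => fderiv ℝ ψ y (EuclideanSpace.single i 1)) =ᶠ[𝓝 x] fun _ => 0 := by
    filter_upwards [(isClosed_tsupport ψ).isOpen_compl.mem_nhds hx'] with y hy
    rw [image_eq_zero_of_notMem_tsupport fun h => hy (tsupport_fderiv_subset ℝ h)]
    rfl
  rw [h0.fderiv_eq]
  simp

theorem inner_gradient_eq_sum {ψ : 𝔼 → ℝ} (v x : 𝔼) :
    inner ℝ v (gradient ψ x) = ∑ i, v i * fderiv ℝ ψ x (EuclideanSpace.single i 1) := by
  rw [real_inner_comm, ← InnerProductSpace.toDual_apply_apply (𝕜 := ℝ), toDual_gradient]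
  conv_lhs => rw [← (EuclideanSpace.basisFun (Fin n) ℝ).sum_repr v]
  simp [map_sum]

theorem LocallyIntegrable.euclidean_apply {g : 𝔼 → 𝔼} (hg : LocallyIntegrable g volume)
    (i : Fin n) : LocallyIntegrable (fun x => g x i) volume := by
  intro x
  obtain ⟨U, hU, h⟩ := hg x
  exact ⟨U, hU, (EuclideanSpace.proj (𝕜 := ℝ) i : 𝔼 →L[ℝ] ℝ).integrable_comp h⟩

/-- The partial derivatives of `ψ` are again smooth with compact support, so they may be used as
test functions for the weak gradient; both derivatives then fall on `ψ`. -/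
theorem IsWeakGradient.integral_inner_gradient {f : 𝔼 → ℝ} {g : 𝔼 → 𝔼}
    (h : IsWeakGradient f g) (hf : LocallyIntegrable f volume) (hg : LocallyIntegrable g volume)
    {ψ : 𝔼 → ℝ} (hψ : ContDiff ℝ ∞ ψ) (hc : HasCompactSupport ψ) :
    Integrable (fun x => inner ℝ (g x) (gradient ψ x)) ∧
      ∫ x, inner ℝ (g x) (gradient ψ x) = - ∫ x, f x * lap ψ x := by
  have hi : ∀ i : Fin n, Integrable
      fun x => g x i * fderiv ℝ ψ x (EuclideanSpace.single i 1) := fun i =>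
    integrable_mul_of_hasCompactSupport (LocallyIntegrable.euclidean_apply hg i)
      (contDiff_fderiv_apply hψ _).continuous (hasCompactSupport_fderiv_apply hc _)
  simp only [inner_gradient_eq_sum]
  refine ⟨integrable_finsetSum _ fun i _ => hi i, ?_⟩
  rw [integral_finsetSum _ fun i _ => hi i]
  simp only [lap, Finset.mul_sum]
  rw [integral_finsetSum, ← Finset.sum_neg_distrib]
  · refine Finset.sum_congr rfl fun i _ => ?_
    rw [h _ (contDiff_fderiv_apply hψ _) (hasCompactSupport_fderiv_apply hc _) i, neg_neg]
  · intro i _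
    exact integrable_mul_of_hasCompactSupport hf
      (contDiff_fderiv_apply (contDiff_fderiv_apply hψ _) _).continuous
      (hasCompactSupport_fderiv_apply (hasCompactSupport_fderiv_apply hc _) _)

end Pairing

/-- A smooth compactly supported function on the line that agrees with `s ^ b` near `[1, t]` and
is supported in `{s < T}`. -/
theorem exists_smooth_cutoff_rpow (b : ℝ) {t : ℝ} {T : EReal} (ht : 1 < t) (htT : (t : EReal) < T) :
    ∃ G : ℝ → ℝ, ContDiff ℝ ∞ G ∧ HasCompactSupport G ∧
      (tsupport G ⊆ {s | (s : EReal) < T}) ∧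
      ∀ s ∈ Icc 1 t, G =ᶠ[𝓝 s] fun r => r ^ b := by
  obtain ⟨t', htt', ht'T⟩ := EReal.lt_iff_exists_real_btwn.1 htT
  have htt' : t < t' := by exact_mod_cast htt'
  -- The bump is `1` near `[1, t]` and supported in `[1 - 2d, t + 2d]`: the bound `1/4` keeps this
  -- away from the singularity of `s ^ b` at `0`, the other bound keeps it below `t'`.
  set d : ℝ := min (1 / 4) ((t' - t) / 4) with hd
  have hd0 : 0 < d := lt_min (by norm_num) (by linarith)
  have hd1 : d ≤ 1 / 4 := min_le_left _ _
  have hd2 : d ≤ (t' - t) / 4 := min_le_right _ _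
  let B : ContDiffBump ((1 + t) / 2) :=
    { rIn := (t - 1) / 2 + d, rOut := (t - 1) / 2 + 2 * d, rIn_pos := by linarith,
      rIn_lt_rOut := by linarith }
  have hts : tsupport B ⊆ Icc (1 / 2) t' := by
    rw [B.tsupport_eq, Real.closedBall_eq_Icc]
    apply Icc_subset_Icc <;> simp only [B] <;> linarith
  have hsub : tsupport (fun s => B s * s ^ b) ⊆ tsupport B := tsupport_mul_subset_left
  refine ⟨fun s => B s * s ^ b, ?_, ?_, ?_, ?_⟩
  · rw [contDiff_iff_contDiffAt]
    intro s
    by_cases hs : s ∈ tsupport B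
    · have : (0 : ℝ) < s := by linarith [(hts hs).1]
      exact B.contDiff.contDiffAt.mul (Real.contDiffAt_rpow_const_of_ne this.ne')
    · refine (contDiffAt_const (c := (0 : ℝ))).congr_of_eventuallyEq ?_
      filter_upwards [(isClosed_tsupport B).isOpen_compl.mem_nhds hs] with r hr
      simp [image_eq_zero_of_notMem_tsupport hr]
  · exact HasCompactSupport.mul_right B.hasCompactSupport
  · intro s hs
    exact lt_of_le_of_lt (by exact_mod_cast (hts (hsub hs)).2) ht'T
  · intro s hs
    have : Metric.ball ((1 + t) / 2) ((t - 1) / 2 + d) ∈ 𝓝 s := by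
      apply Metric.isOpen_ball.mem_nhds
      rw [Real.ball_eq_Ioo]
      constructor <;> linarith [hs.1, hs.2]
    filter_upwards [this] with r hr
    rw [B.one_of_mem_closedBall (Metric.ball_subset_closedBall hr), one_mul]

/-! ### The energy identity for separated test functions -/

section Energy

variable {n : ℕ}

local notation "𝔼" => EuclideanSpace ℝ (Fin n)

theorem Icc_subset_timeInterval {t : ℝ} {T : EReal} (htT : (t : EReal) < T) :
    Icc 1 t ⊆ timeInterval T := fun _ hs =>
  ⟨hs.1, lt_of_le_of_lt (by exact_mod_cast hs.2) htT⟩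

theorem continuousOn_rpow_Icc (b t : ℝ) : ContinuousOn (fun s : ℝ => s ^ b) (Icc 1 t) :=
  fun s hs => (Real.continuousAt_rpow_const s b
    (Or.inl (by linarith [hs.1] : (0 : ℝ) < s).ne')).continuousWithinAt

theorem isTestFunction_mul {T : EReal} {G : ℝ → ℝ} {ψ : 𝔼 → ℝ} (hG : ContDiff ℝ ∞ G)
    (hGc : HasCompactSupport G) (hGT : tsupport G ⊆ {s | (s : EReal) < T})
    (hψ : ContDiff ℝ ∞ ψ) (hc : HasCompactSupport ψ) :
    IsTestFunction T fun z : ℝ × 𝔼 => G z.1 * ψ z.2 := by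
  have hsub : tsupport (fun z : ℝ × 𝔼 => G z.1 * ψ z.2) ⊆ tsupport G ×ˢ tsupport ψ := by
    refine closure_minimal (fun z hz => ?_)
      ((isClosed_tsupport G).prod (isClosed_tsupport ψ))
    have hz' : G z.1 * ψ z.2 ≠ 0 := hz
    exact ⟨subset_tsupport _ (left_ne_zero_of_mul hz'),
      subset_tsupport _ (right_ne_zero_of_mul hz')⟩
  exact ⟨(hG.comp contDiff_fst).mul (hψ.comp contDiff_snd),
    HasCompactSupport.of_support_subset_isCompact (hGc.isCompact.prod hc.isCompact)
      ((subset_tsupport _).trans hsub), fun z hz => hGT (hsub hz).1⟩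

theorem gradient_const_mul (c : ℝ) {ψ : 𝔼 → ℝ} (hψ : ContDiff ℝ ∞ ψ) (x : 𝔼) :
    gradient (fun y => c * ψ y) x = c • gradient ψ x := by
  have hd : DifferentiableAt ℝ ψ x := (hψ.differentiable (by simp)) x
  simp only [gradient, fderiv_const_mul hd, map_smul]

/-- Testing the equation with `s ^ (r₂ + 1) ψ(x)`, where `r₁ + r₂ = μ - 1` and `r₁ r₂ = ν²`. -/
theorem energy_identity {ℓ μ ν p ε r₁ r₂ : ℝ} {u₀ u₁ : 𝔼 → ℝ} {T : EReal}
    {u ut : ℝ → 𝔼 → ℝ} {Du : ℝ → 𝔼 → 𝔼}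
    (hu : ContinuousL1loc (timeInterval T) u) (hDu : ContinuousL1loc (timeInterval T) Du)
    (hgrad : ∀ t ∈ timeInterval T, IsWeakGradient (u t) (Du t))
    (hut : ContinuousL1loc (timeInterval T) ut) (hd : HasDerivL1loc (timeInterval T) u ut)
    (h0 : ∀ᵐ x, u 1 x = ε * u₀ x) (hsum : r₁ + r₂ = μ - 1) (hprod : r₁ * r₂ = ν ^ 2)
    {t : ℝ} (ht : 1 < t) (htT : (t : EReal) < T)
    (hid : ∀ φ : ℝ × 𝔼 → ℝ, IsTestFunction T φ → IntegralIdentity ℓ μ ν p ε u₁ u ut Du t φ)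
    {ψ : 𝔼 → ℝ} (hψ : ContDiff ℝ ∞ ψ) (hc : HasCompactSupport ψ) :
    (∀ᵐ s ∂volume.restrict (Ioc 1 t), Integrable fun x => |u s x| ^ p * ψ x) ∧
    IntervalIntegrable (fun s => s ^ (r₂ + 1) * ∫ x, |u s x| ^ p * ψ x) volume 1 t ∧
    t ^ (r₂ + 1) * (∫ x, ut t x * ψ x) + r₁ * t ^ r₂ * (∫ x, u t x * ψ x) =
      ε * (∫ x, u₁ x * ψ x) + r₁ * (ε * ∫ x, u₀ x * ψ x)
      + (∫ s in (1 : ℝ)..t, s ^ (r₂ + 1) * (s ^ (2 * ℓ) * ∫ x, u s x * lap ψ x))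
      + ∫ s in (1 : ℝ)..t, s ^ (r₂ + 1) * ∫ x, |u s x| ^ p * ψ x := by
  obtain ⟨G, hG, hGc, hGT, hGeq⟩ := exists_smooth_cutoff_rpow (r₂ + 1) ht htT
  obtain ⟨hint, heq⟩ := hid _ (isTestFunction_mul hG hGc hGT hψ hc)
  have hI := Icc_subset_timeInterval htT
  have h1I : (1 : ℝ) ∈ Icc 1 t := ⟨le_rfl, ht.le⟩
  have htI : t ∈ Icc 1 t := ⟨ht.le, le_rfl⟩
  have hGv : ∀ s ∈ Icc 1 t, G s = s ^ (r₂ + 1) := fun s hs => (hGeq s hs).eq_of_nhds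
  have hpos : ∀ s ∈ Icc 1 t, (0 : ℝ) < s := fun s hs => by linarith [hs.1]
  have hGd : ∀ s ∈ Icc 1 t, deriv G s = (r₂ + 1) * s ^ r₂ := fun s hs => by
    rw [(hGeq s hs).deriv_eq, (Real.hasDerivAt_rpow_const (Or.inl (hpos s hs).ne')).deriv]
    simp
  have huIcc : uIcc 1 t = Icc 1 t := uIcc_of_le ht.le
  have hV1c : ContinuousOn (fun s => ∫ x, ut s x * ψ x) (Icc 1 t) :=
    (hut.continuousOn_integral_mul hψ.continuous hc).mono hI
  have hVc : ContinuousOn (fun s => ∫ x, u s x * ψ x) (Icc 1 t) :=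
    (hu.continuousOn_integral_mul hψ.continuous hc).mono hI
  have hLc : ContinuousOn (fun s => ∫ x, u s x * lap ψ x) (Icc 1 t) :=
    (hu.continuousOn_integral_mul (continuous_lap hψ) (hasCompactSupport_lap hc)).mono hI
  have hVd : ∀ s ∈ Icc 1 t,
      HasDerivWithinAt (fun s => ∫ x, u s x * ψ x) (∫ x, ut s x * ψ x) (Icc 1 t) s :=
    fun s hs => (hd.hasDerivWithinAt_integral_mul hu.1 hut.1 hψ.continuous hc (hI hs)).mono hI
  -- the nonlinear term
  have hint' : Integrable (fun z : ℝ × 𝔼 => |u z.1 z.2| ^ p * (G z.1 * ψ z.2))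
      ((volume.restrict (Ioc 1 t)).prod volume) := by
    have := hint
    rwa [IntegrableOn, Measure.volume_eq_prod, ← Measure.prod_restrict,
      Measure.restrict_univ] at this
  have hN : ∀ s ∈ Icc 1 t, ∫ x, |u s x| ^ p * (G s * ψ x)
      = s ^ (r₂ + 1) * ∫ x, |u s x| ^ p * ψ x := fun s hs => by
    rw [← integral_const_mul, hGv s hs]
    congr 1 with x
    ring
  -- Fubini makes almost every time slice integrable, and the factor `G s = s ^ (r₂ + 1)` can be
  -- divided out because it is positive.
  have hae : ∀ᵐ s ∂volume.restrict (Ioc 1 t), Integrable fun x => |u s x| ^ p * ψ x := by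
    filter_upwards [hint'.prod_right_ae, ae_restrict_mem measurableSet_Ioc] with s hs hs'
    have hs'' := Ioc_subset_Icc_self hs'
    have hne : G s ≠ 0 := by
      rw [hGv s hs'']
      exact (Real.rpow_pos_of_pos (hpos s hs'') _).ne'
    refine (hs.const_mul (G s)⁻¹).congr (Eventually.of_forall fun x => ?_)
    simp only
    field_simp
  have hNi : IntervalIntegrable (fun s => s ^ (r₂ + 1) * ∫ x, |u s x| ^ p * ψ x) volume 1 t := by
    rw [intervalIntegrable_iff_integrableOn_Ioc_of_le ht.le]
    refine hint'.integral_prod_left.congr ?_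
    filter_upwards [ae_restrict_mem measurableSet_Ioc] with s hs
    exact hN s (Ioc_subset_Icc_self hs)
  refine ⟨hae, hNi, ?_⟩
  -- the linear terms
  have e1 : ∀ s ∈ uIcc 1 t, (∫ x, (-(ut s x * deriv (fun r => G r * ψ x) s)
        + s ^ (2 * ℓ) * inner ℝ (Du s x) (gradient (fun y => G s * ψ y) x)))
      = -((r₂ + 1) * s ^ r₂ * ∫ x, ut s x * ψ x)
        - s ^ (r₂ + 1) * (s ^ (2 * ℓ) * ∫ x, u s x * lap ψ x) := fun s hs => by
    rw [huIcc] at hs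
    obtain ⟨hgi, hge⟩ := (hgrad s (hI hs)).integral_inner_gradient (hu.1 s (hI hs))
      (hDu.1 s (hI hs)) hψ hc
    have hGds : DifferentiableAt ℝ G s := (hG.differentiable (by simp)) s
    have e : ∀ x, (-(ut s x * deriv (fun r => G r * ψ x) s)
        + s ^ (2 * ℓ) * inner ℝ (Du s x) (gradient (fun y => G s * ψ y) x))
        = -((r₂ + 1) * s ^ r₂) * (ut s x * ψ x)
          + s ^ (2 * ℓ) * s ^ (r₂ + 1) * inner ℝ (Du s x) (gradient ψ x) := fun x => by
      rw [deriv_mul_const hGds, hGd s hs, gradient_const_mul _ hψ, inner_smul_right, hGv s hs]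
      ring
    simp only [e]
    rw [integral_add ((integrable_mul_of_hasCompactSupport (hut.1 s (hI hs)) hψ.continuous
      hc).const_mul _) (hgi.const_mul _), integral_const_mul, integral_const_mul, hge]
    ring
  have e2 : ∀ s ∈ uIcc 1 t, (∫ x, (μ * s⁻¹ * ut s x * (G s * ψ x)
        + ν ^ 2 * (s ^ 2)⁻¹ * u s x * (G s * ψ x)))
      = μ * s ^ r₂ * (∫ x, ut s x * ψ x) + r₁ * (r₂ * s ^ (r₂ - 1)) * ∫ x, u s x * ψ x :=
    fun s hs => by
    rw [huIcc] at hs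
    have hs0 := hpos s hs
    have hr1 : s ^ (r₂ + 1) = s ^ (r₂ - 1) * s ^ 2 := by
      rw [← Real.rpow_add_natCast hs0.ne']; congr 1; push_cast; ring
    have hr0 : s ^ r₂ = s ^ (r₂ - 1) * s := by
      rw [← Real.rpow_add_one hs0.ne']; congr 1; ring
    have e : ∀ x, (μ * s⁻¹ * ut s x * (G s * ψ x) + ν ^ 2 * (s ^ 2)⁻¹ * u s x * (G s * ψ x))
        = μ * s ^ r₂ * (ut s x * ψ x) + r₁ * (r₂ * s ^ (r₂ - 1)) * (u s x * ψ x) := fun x => by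
      rw [hGv s hs, hr1, hr0, ← hprod]
      field_simp
    simp only [e]
    rw [integral_add ((integrable_mul_of_hasCompactSupport (hut.1 s (hI hs)) hψ.continuous
      hc).const_mul _) ((integrable_mul_of_hasCompactSupport (hu.1 s (hI hs)) hψ.continuous
      hc).const_mul _), integral_const_mul, integral_const_mul]
  have e3 : ∀ s ∈ uIcc 1 t, ∫ x, |u s x| ^ p * (G s * ψ x)
      = s ^ (r₂ + 1) * ∫ x, |u s x| ^ p * ψ x := fun s hs => hN s (huIcc ▸ hs)
  have e4 : ∀ s ∈ Icc 1 t, ∀ f : 𝔼 → ℝ, ∫ x, f x * (G s * ψ x)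
      = s ^ (r₂ + 1) * ∫ x, f x * ψ x := fun s hs f => by
    rw [← integral_const_mul, hGv s hs]
    congr 1 with x
    ring
  have hcont := continuousOn_rpow_Icc (t := t)
  have hA : IntervalIntegrable (fun s => -((r₂ + 1) * s ^ r₂ * ∫ x, ut s x * ψ x)) volume 1 t :=
    (((continuousOn_const.mul (hcont r₂)).mul hV1c).neg).intervalIntegrable_of_Icc ht.le
  have hB : IntervalIntegrable
      (fun s => s ^ (r₂ + 1) * (s ^ (2 * ℓ) * ∫ x, u s x * lap ψ x)) volume 1 t :=
    ((hcont (r₂ + 1)).mul ((hcont (2 * ℓ)).mul hLc)).intervalIntegrable_of_Icc ht.le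
  have hC : IntervalIntegrable (fun s => μ * s ^ r₂ * (∫ x, ut s x * ψ x)
      + r₁ * (r₂ * s ^ (r₂ - 1)) * ∫ x, u s x * ψ x) volume 1 t :=
    (((continuousOn_const.mul (hcont r₂)).mul hV1c).add ((continuousOn_const.mul
      (continuousOn_const.mul (hcont (r₂ - 1)))).mul hVc)).intervalIntegrable_of_Icc ht.le
  -- the exact derivative
  have hF : ∫ s in (1 : ℝ)..t, (r₁ * (r₂ * s ^ (r₂ - 1)) * (∫ x, u s x * ψ x)
      + r₁ * s ^ r₂ * ∫ x, ut s x * ψ x)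
      = r₁ * t ^ r₂ * (∫ x, u t x * ψ x) - r₁ * (1 : ℝ) ^ r₂ * ∫ x, u 1 x * ψ x := by
    refine intervalIntegral.integral_eq_sub_of_hasDerivAt_of_le ht.le
      ((continuousOn_const.mul (hcont r₂)).mul hVc) (fun s hs => ?_) ?_
    · have hs' := Ioo_subset_Icc_self hs
      have hv := (hVd s hs').hasDerivAt (Icc_mem_nhds hs.1 hs.2)
      exact ((Real.hasDerivAt_rpow_const (p := r₂)
        (Or.inl (hpos s hs').ne')).const_mul r₁).mul hv
    · exact (((continuousOn_const.mul (continuousOn_const.mul (hcont (r₂ - 1)))).mul hVc).add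
        ((continuousOn_const.mul (hcont r₂)).mul hV1c)).intervalIntegrable_of_Icc ht.le
  have hV1 : ∫ x, u 1 x * ψ x = ε * ∫ x, u₀ x * ψ x := by
    rw [← integral_const_mul]
    refine integral_congr_ae ?_
    filter_upwards [h0] with x hx
    rw [hx, mul_assoc]
  rw [intervalIntegral.integral_congr e1, intervalIntegral.integral_congr e2,
    intervalIntegral.integral_congr e3, e4 t htI, e4 1 h1I,
    intervalIntegral.integral_sub hA hB] at heq
  -- As `μ - (r₂ + 1) = r₁`, the terms in `ut` add up to `r₁ s ^ r₂ ∫ ut ψ`; together with the mass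
  -- term they form the derivative of `r₁ s ^ r₂ ∫ u ψ`.
  have hcomb : (∫ s in (1 : ℝ)..t, -((r₂ + 1) * s ^ r₂ * ∫ x, ut s x * ψ x))
      + (∫ s in (1 : ℝ)..t, (μ * s ^ r₂ * (∫ x, ut s x * ψ x)
      + r₁ * (r₂ * s ^ (r₂ - 1)) * ∫ x, u s x * ψ x))
      = r₁ * t ^ r₂ * (∫ x, u t x * ψ x) - r₁ * (1 : ℝ) ^ r₂ * ∫ x, u 1 x * ψ x := by
    rw [← hF, ← intervalIntegral.integral_add hA hC]
    refine intervalIntegral.integral_congr fun s _ => ?_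
    have hμ : μ = r₁ + r₂ + 1 := by linarith
    simp only [hμ]
    ring
  rw [hV1] at hcomb
  simp only [Real.one_rpow, one_mul, mul_one] at heq hcomb
  linarith

end Energy

/-! ### Entire power series and the radial profile -/

section PowerSeries

/-- The coefficient sequence `c` defines an entire power series. -/
def IsEntireSeq (c : ℕ → ℝ) : Prop := ∀ r : ℝ, 0 ≤ r → Summable fun j => |c j| * r ^ j

/-- The sum of the power series with coefficients `c`. -/
noncomputable def powSum (c : ℕ → ℝ) (z : ℝ) : ℝ := ∑' j, c j * z ^ j

/-- The coefficients of the derivative of a power series. -/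
def derivSeq (c : ℕ → ℝ) (j : ℕ) : ℝ := (j + 1) * c (j + 1)

theorem IsEntireSeq.summable {c : ℕ → ℝ} (hc : IsEntireSeq c) (z : ℝ) :
    Summable fun j => c j * z ^ j := by
  refine Summable.of_norm ?_
  simpa [abs_mul, abs_pow] using hc |z| (abs_nonneg z)

/-- The factor `j + 1 ≤ 2 ^ (j + 1)` is absorbed by enlarging the radius from `r` to `2 (r + 1)`. -/
theorem IsEntireSeq.derivSeq {c : ℕ → ℝ} (hc : IsEntireSeq c) : IsEntireSeq (derivSeq c) := by
  intro r hr
  refine Summable.of_nonneg_of_le (fun j => by positivity) (fun j => ?_)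
    ((summable_nat_add_iff 1).2 (hc (2 * (r + 1)) (by positivity)))
  have h1 : ((j : ℝ) + 1) ≤ 2 ^ (j + 1) := by exact_mod_cast (Nat.lt_two_pow_self (n := j + 1)).le
  have h2 : r ^ j ≤ (r + 1) ^ (j + 1) :=
    (pow_le_pow_left₀ hr (by linarith) j).trans
      (pow_le_pow_right₀ (by linarith) (Nat.le_succ j))
  rw [EPDT.derivSeq, abs_mul, abs_of_nonneg (by positivity : (0 : ℝ) ≤ j + 1), mul_pow]
  calc ((j : ℝ) + 1) * |c (j + 1)| * r ^ j ≤ 2 ^ (j + 1) * |c (j + 1)| * (r + 1) ^ (j + 1) := by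
        gcongr
    _ = _ := by ring

theorem IsEntireSeq.hasDerivAt {c : ℕ → ℝ} (hc : IsEntireSeq c) (z : ℝ) :
    HasDerivAt (powSum c) (powSum (EPDT.derivSeq c) z) z := by
  set r : ℝ := |z| + 1
  have hr : 0 ≤ r := by positivity
  have hs : Summable fun j : ℕ => |c j| * (j * r ^ (j - 1)) := by
    rw [← summable_nat_add_iff 1]
    refine (hc.derivSeq r hr).congr fun j => ?_
    rw [EPDT.derivSeq, abs_mul, abs_of_nonneg (by positivity : (0 : ℝ) ≤ j + 1)]
    push_cast
    ring
  have hz : z ∈ Metric.ball (0 : ℝ) r := by simp [r]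
  have h := hasDerivAt_tsum_of_isPreconnected (g := fun j y => c j * y ^ j)
    (g' := fun j y => c j * (j * y ^ (j - 1))) hs Metric.isOpen_ball
    (convex_ball (0 : ℝ) r).isPreconnected (fun j y _ => (hasDerivAt_pow j y).const_mul _)
    (fun j y hy => ?_) hz (hc.summable z) hz
  · refine h.congr_deriv ?_
    have hs' : Summable fun j : ℕ => c j * (j * z ^ (j - 1)) := by
      refine Summable.of_norm_bounded hs fun j => ?_
      simp only [norm_mul, norm_pow, Real.norm_eq_abs, Nat.abs_cast]
      gcongr
      simp [r]
    rw [hs'.tsum_eq_zero_add]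
    simp only [powSum, EPDT.derivSeq, CharP.cast_eq_zero, zero_mul, mul_zero, zero_add]
    refine tsum_congr fun j => ?_
    push_cast
    ring
  · simp only [norm_mul, norm_pow, Real.norm_eq_abs, Nat.abs_cast]
    have : |y| ≤ r := by simpa using (mem_ball_zero_iff.1 hy).le
    gcongr

theorem IsEntireSeq.deriv_powSum {c : ℕ → ℝ} (hc : IsEntireSeq c) :
    deriv (powSum c) = powSum (EPDT.derivSeq c) := funext fun z => (hc.hasDerivAt z).deriv

theorem IsEntireSeq.contDiff {c : ℕ → ℝ} (hc : IsEntireSeq c) : ContDiff ℝ ∞ (powSum c) := by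
  rw [contDiff_infty]
  intro k
  induction k generalizing c with
  | zero => exact contDiff_zero.2 (continuous_iff_continuousAt.2 fun z =>
      (hc.hasDerivAt z).continuousAt)
  | succ k ih =>
    rw [show ((k + 1 : ℕ) : WithTop ℕ∞) = (k : WithTop ℕ∞) + 1 by push_cast; rfl,
      contDiff_succ_iff_deriv]
    refine ⟨fun z => (hc.hasDerivAt z).differentiableAt, by simp, ?_⟩
    rw [hc.deriv_powSum]
    exact ih hc.derivSeq

/-- The Taylor coefficients in `z = |x|²` of the radial solution of `ΔΦ = Φ` on `ℝⁿ`. -/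
noncomputable def radialCoeff (n : ℕ) : ℕ → ℝ
  | 0 => 1
  | j + 1 => radialCoeff n j / (2 * (j + 1) * (n + 2 * j))

theorem radialCoeff_mem {n : ℕ} (hn : 1 ≤ n) (j : ℕ) :
    0 ≤ radialCoeff n j ∧ radialCoeff n j ≤ 1 / (j.factorial : ℝ) := by
  have hn' : (1 : ℝ) ≤ n := by exact_mod_cast hn
  induction j with
  | zero => simp [radialCoeff]
  | succ j ih =>
    refine ⟨div_nonneg ih.1 (by positivity), ?_⟩
    rw [radialCoeff, Nat.factorial_succ, div_le_div_iff₀ (by positivity) (by positivity)]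
    have h := ih.2
    rw [le_div_iff₀ (by positivity)] at h
    have h2 : (1 : ℝ) ≤ 2 * (n + 2 * j) := by linarith [(Nat.cast_nonneg j : (0 : ℝ) ≤ j)]
    push_cast
    calc radialCoeff n j * (((j : ℝ) + 1) * j.factorial)
        = (radialCoeff n j * j.factorial) * (j + 1) := by ring
      _ ≤ 1 * (j + 1) := by gcongr
      _ ≤ (2 * (n + 2 * j)) * (j + 1) := by gcongr
      _ = _ := by ring

theorem isEntireSeq_radialCoeff {n : ℕ} (hn : 1 ≤ n) : IsEntireSeq (radialCoeff n) := by
  intro r hr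
  refine Summable.of_nonneg_of_le (fun j => by positivity) (fun j => ?_)
    (Real.summable_pow_div_factorial r)
  rw [abs_of_nonneg (radialCoeff_mem hn j).1, div_eq_inv_mul, ← one_div]
  gcongr
  exact (radialCoeff_mem hn j).2

theorem one_le_powSum_radialCoeff {n : ℕ} (hn : 1 ≤ n) {z : ℝ} (hz : 0 ≤ z) :
    1 ≤ powSum (radialCoeff n) z := by
  have h := ((isEntireSeq_radialCoeff hn).summable z).le_tsum 0 fun j _ =>
    mul_nonneg (radialCoeff_mem hn j).1 (pow_nonneg hz j)
  simp only [radialCoeff, pow_zero, mul_one] at h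
  exact h

/-- This is `ΔΦ = Φ` for `Φ(x) = F(|x|²)`. The coefficient of `z ^ j` on the left is `(4 j (j + 1) +
2 n (j + 1)) c_{j+1} = 2 (j + 1) (n + 2 j) c_{j+1}`, which the recursion makes equal to `c_j`. -/
theorem powSum_radialCoeff_ode {n : ℕ} (hn : 1 ≤ n) (z : ℝ) :
    4 * z * powSum (derivSeq (derivSeq (radialCoeff n))) z
      + 2 * n * powSum (derivSeq (radialCoeff n)) z = powSum (radialCoeff n) z := by
  have hn' : (1 : ℝ) ≤ n := by exact_mod_cast hn
  set c := radialCoeff n with hcdef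
  have hc := isEntireSeq_radialCoeff hn
  have hs1 := hc.derivSeq.summable z
  have hs2 := hc.derivSeq.derivSeq.summable z
  have hs : Summable fun j : ℕ => (j * derivSeq c j) * z ^ j := by
    rw [← summable_nat_add_iff 1]
    refine (hs2.mul_left z).congr fun j => ?_
    simp only [EPDT.derivSeq]
    push_cast
    ring
  have e1 : z * powSum (derivSeq (derivSeq c)) z = ∑' j : ℕ, (j * derivSeq c j) * z ^ j := by
    rw [hs.tsum_eq_zero_add, powSum, ← tsum_mul_left]
    simp only [CharP.cast_eq_zero, zero_mul, zero_add]
    refine tsum_congr fun j => ?_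
    simp only [EPDT.derivSeq]
    push_cast
    ring
  rw [mul_assoc, e1, powSum, powSum, ← tsum_mul_left, ← tsum_mul_left,
    ← (hs.mul_left 4).tsum_add (hs1.mul_left _)]
  refine tsum_congr fun j => ?_
  have hne : (n : ℝ) + 2 * j ≠ 0 := by positivity
  have hne' : (j : ℝ) + 1 ≠ 0 := by positivity
  have h : c (j + 1) = c j / (2 * (j + 1) * (n + 2 * j)) := rfl
  simp only [EPDT.derivSeq, ← hcdef, h]
  field_simp
  ring

end PowerSeries

/-! ### Sharp growth of the radial profile -/

section Growth

theorem antitoneOn_Ici_of_hasDerivAt {a : ℝ} {f f' : ℝ → ℝ}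
    (hf : ∀ x, a ≤ x → HasDerivAt f (f' x) x) (h : ∀ x, a ≤ x → f' x ≤ 0) :
    AntitoneOn f (Ici a) :=
  antitoneOn_of_hasDerivWithinAt_nonpos (convex_Ici a)
    (fun x hx => (hf x hx).continuousAt.continuousWithinAt)
    (fun x hx => (hf x (interior_subset hx)).hasDerivWithinAt)
    fun x hx => h x (interior_subset hx)

/-- A nonnegative solution of `f'' + (m / r) f' = f` grows at most like `r ^ (-m/2) e ^ r`. -/
theorem radial_growth {m : ℝ} (hm : 0 ≤ m) {f g : ℝ → ℝ}
    (hf : ∀ r, 1 ≤ r → HasDerivAt f (g r) r)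
    (hg : ∀ r, 1 ≤ r → HasDerivAt g (f r - m / r * g r) r)
    (hpos : ∀ r, 1 ≤ r → 0 < f r) :
    ∃ C : ℝ, 0 < C ∧ ∀ r, 1 ≤ r → f r ≤ C * (r ^ (-m / 2) * Real.exp r) := by
  -- This size of `M` makes `q` a supersolution of the Riccati equation `q' + q² + (m/r) q = 1` on
  -- `[1, ∞)` and also puts `q 1` above the logarithmic derivative `g 1 / f 1`.
  set M : ℝ := 1 + m ^ 2 / 4 + m / 2 + |g 1 / f 1| with hM
  have hM0 : 0 < M := by positivity
  have hM1 : 1 + m ^ 2 / 4 ≤ M := by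
    rw [hM]; linarith [abs_nonneg (g 1 / f 1)]
  let q : ℝ → ℝ := fun r => 1 - m / 2 * r⁻¹ + M * (r ^ 2)⁻¹
  let S : ℝ → ℝ := fun r => r - m / 2 * Real.log r - M * r⁻¹
  have hS : ∀ r, 1 ≤ r → HasDerivAt S (q r) r := fun r hr => by
    have hr0 : r ≠ 0 := by linarith
    have := ((hasDerivAt_id r).sub ((Real.hasDerivAt_log hr0).const_mul (m / 2))).sub
      ((hasDerivAt_inv hr0).const_mul M)
    refine this.congr_deriv ?_
    simp only [q]
    ring
  have hq : ∀ r, 1 ≤ r → HasDerivAt q (m / 2 * (r ^ 2)⁻¹ - 2 * M * (r ^ 3)⁻¹) r := fun r hr => by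
    have hr0 : r ≠ 0 := by linarith
    have h2 : HasDerivAt (fun r : ℝ => (r ^ 2)⁻¹) (-(2 * r) / (r ^ 2) ^ 2) r := by
      refine ((hasDerivAt_pow 2 r).inv (pow_ne_zero 2 hr0)).congr_deriv ?_
      norm_num
    have := (((hasDerivAt_inv hr0).const_mul (m / 2)).const_sub 1).add (h2.const_mul M)
    refine this.congr_deriv ?_
    field_simp
    ring
  have hqi : ∀ r, 1 ≤ r →
      1 ≤ (m / 2 * (r ^ 2)⁻¹ - 2 * M * (r ^ 3)⁻¹) + q r ^ 2 + m / r * q r := fun r hr => by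
    have hr0 : 0 < r := by linarith
    have e : (m / 2 * (r ^ 2)⁻¹ - 2 * M * (r ^ 3)⁻¹) + q r ^ 2 + m / r * q r - 1
        = ((m / 2 + (M - m ^ 2 / 4)) * r ^ 2 + M * ((r - 1) ^ 2 + (M - 1))) / r ^ 4 := by
      simp only [q]
      field_simp
      ring
    have : 0 ≤ ((m / 2 + (M - m ^ 2 / 4)) * r ^ 2 + M * ((r - 1) ^ 2 + (M - 1))) / r ^ 4 := by
      have h1 : 0 ≤ M - m ^ 2 / 4 := by linarith
      have h2 : 0 ≤ M - 1 := by linarith [sq_nonneg m]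
      positivity
    linarith
  -- With this integrating factor, `K' = -(q' + q² + (m/r) q - 1) f exp(S + m log r) ≤ 0`, so the
  -- inequality `g ≤ q f` propagates from `r = 1`; then `f exp(-S)` decreases.
  let K : ℝ → ℝ := fun r => (g r - q r * f r) * Real.exp (S r + m * Real.log r)
  have hK : ∀ r, 1 ≤ r → K r ≤ 0 := by
    have hd : ∀ r, 1 ≤ r → HasDerivAt K
        (((f r - m / r * g r) - ((m / 2 * (r ^ 2)⁻¹ - 2 * M * (r ^ 3)⁻¹) * f r + q r * g r))
          * Real.exp (S r + m * Real.log r) + (g r - q r * f r) *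
          (Real.exp (S r + m * Real.log r) * (q r + m * r⁻¹))) r := fun r hr =>
      ((hg r hr).sub ((hq r hr).mul (hf r hr))).mul
        ((hS r hr).add ((Real.hasDerivAt_log (by linarith)).const_mul m)).exp
    have hanti := antitoneOn_Ici_of_hasDerivAt hd fun r hr => by
      have hr0 : 0 < r := by linarith
      have h1 := hqi r hr
      have h2 := hpos r hr
      set Q := m / 2 * (r ^ 2)⁻¹ - 2 * M * (r ^ 3)⁻¹
      have e : ((f r - m / r * g r) - (Q * f r + q r * g r))
          * Real.exp (S r + m * Real.log r) + (g r - q r * f r) *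
          (Real.exp (S r + m * Real.log r) * (q r + m * r⁻¹))
          = -((Q + q r ^ 2 + m / r * q r - 1) * f r * Real.exp (S r + m * Real.log r)) := by
        rw [div_eq_mul_inv]; ring
      rw [e, neg_nonpos]
      have : 0 ≤ Q + q r ^ 2 + m / r * q r - 1 := by linarith
      positivity
    intro r hr
    refine (hanti (mem_Ici.2 le_rfl) (mem_Ici.2 hr) hr).trans ?_
    have hf1 := hpos 1 le_rfl
    have h1 : g 1 ≤ |g 1 / f 1| * f 1 := by
      calc g 1 = g 1 / f 1 * f 1 := by field_simp
        _ ≤ _ := by gcongr; exact le_abs_self _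
    have hq1 : q 1 = 2 + m ^ 2 / 4 + |g 1 / f 1| := by simp only [q, hM]; norm_num; ring
    refine mul_nonpos_of_nonpos_of_nonneg ?_ (Real.exp_pos _).le
    rw [hq1]
    nlinarith [mul_nonneg (sq_nonneg m) hf1.le]
  have hmono : AntitoneOn (fun r => f r * Real.exp (-S r)) (Ici 1) := by
    refine antitoneOn_Ici_of_hasDerivAt
      (fun r hr => (hf r hr).mul (hS r hr).neg.exp) fun r hr => ?_
    have h1 : g r - q r * f r ≤ 0 := by
      by_contra hcon
      exact absurd (hK r hr) (not_le.2 (mul_pos (not_le.1 hcon) (Real.exp_pos _)))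
    have e : g r * Real.exp (-S r) + f r * (Real.exp (-S r) * -q r)
        = (g r - q r * f r) * Real.exp (-S r) := by ring
    refine e.trans_le ?_
    exact mul_nonpos_of_nonpos_of_nonneg h1 (Real.exp_pos _).le
  refine ⟨f 1 * Real.exp (-S 1), mul_pos (hpos 1 le_rfl) (Real.exp_pos _), fun r hr => ?_⟩
  have hr0 : 0 < r := by linarith
  have h1 : f r * Real.exp (-S r) ≤ f 1 * Real.exp (-S 1) :=
    hmono (mem_Ici.2 le_rfl) (mem_Ici.2 hr) hr
  have h2 : Real.exp (S r) ≤ r ^ (-m / 2) * Real.exp r := by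
    rw [Real.rpow_def_of_pos hr0, ← Real.exp_add, Real.exp_le_exp]
    have : 0 ≤ M * r⁻¹ := by positivity
    simp only [S]
    linarith
  calc f r = f r * Real.exp (-S r) * Real.exp (S r) := by
        rw [mul_assoc, ← Real.exp_add]; simp
    _ ≤ f 1 * Real.exp (-S 1) * (r ^ (-m / 2) * Real.exp r) := by
        have := (hpos 1 le_rfl).le
        gcongr

/-- Using a function of `|x|²` makes the eigenfunction smooth at the origin. The growth bound is
`radial_growth` for `f(r) = F(r²)`, which solves `f'' + ((n - 1)/r) f' = f`; compactness handles `r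
≤ 1`. -/
theorem exists_radial_profile {n : ℕ} (hn : 1 ≤ n) :
    ∃ F : ℝ → ℝ, ContDiff ℝ ∞ F ∧ (∀ z, 0 ≤ z → 1 ≤ F z) ∧
      (∀ z, 4 * z * deriv (deriv F) z + 2 * n * deriv F z = F z) ∧
      ∃ C : ℝ, 0 < C ∧ ∀ r, 0 ≤ r →
        F (r ^ 2) ≤ C * ((1 + r) ^ (-((n : ℝ) - 1) / 2) * Real.exp r) := by
  have hn' : (1 : ℝ) ≤ n := by exact_mod_cast hn
  have hc := isEntireSeq_radialCoeff hn
  set F := powSum (radialCoeff n) with hF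
  have hF1 : deriv F = powSum (derivSeq (radialCoeff n)) := hc.deriv_powSum
  have hF2 : deriv (deriv F) = powSum (derivSeq (derivSeq (radialCoeff n))) := by
    rw [hF1, hc.derivSeq.deriv_powSum]
  have hode : ∀ z, 4 * z * deriv (deriv F) z + 2 * n * deriv F z = F z := fun z => by
    rw [hF2, hF1]
    exact powSum_radialCoeff_ode hn z
  have hone : ∀ z, 0 ≤ z → 1 ≤ F z := fun z hz => one_le_powSum_radialCoeff hn hz
  refine ⟨F, hc.contDiff, hone, hode, ?_⟩
  set m : ℝ := (n : ℝ) - 1 with hm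
  have hm0 : 0 ≤ m := by linarith
  have hsq : ∀ r : ℝ, HasDerivAt (fun r : ℝ => r ^ 2) (2 * r) r := fun r => by
    simpa using hasDerivAt_pow 2 r
  have hd0 : ∀ z, HasDerivAt F (deriv F z) z := fun z => by rw [hF1]; exact hc.hasDerivAt z
  have hd1 : ∀ z, HasDerivAt (deriv F) (deriv (deriv F) z) z := fun z => by
    rw [hF2, hF1]; exact hc.derivSeq.hasDerivAt z
  obtain ⟨C, hC, hle⟩ := radial_growth (f := fun r => F (r ^ 2))
    (g := fun r => deriv F (r ^ 2) * (2 * r)) hm0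
    (fun r _ => HasDerivAt.comp (h₂ := F) r (hd0 (r ^ 2)) (hsq r))
    (fun r hr => by
      have hr0 : r ≠ 0 := by linarith
      have h1 : HasDerivAt (fun r => deriv F (r ^ 2)) (deriv (deriv F) (r ^ 2) * (2 * r)) r :=
        HasDerivAt.comp (h₂ := deriv F) r (hd1 (r ^ 2)) (hsq r)
      refine (h1.mul ((hasDerivAt_id r).const_mul 2)).congr_deriv ?_
      rw [← hode (r ^ 2), hm]
      simp only [id]
      field_simp
      ring) (fun r _ => lt_of_lt_of_le one_pos (hone _ (sq_nonneg r)))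
  obtain ⟨B, hB⟩ := (isCompact_Icc (a := (0 : ℝ)) (b := 1)).bddAbove_image
    (hc.contDiff.continuous.continuousOn (s := Icc 0 1))
  have hB' : ∀ z ∈ Icc (0 : ℝ) 1, F z ≤ B := fun z hz => hB ⟨z, hz, rfl⟩
  have hB1 : 1 ≤ B := (hone 0 le_rfl).trans (hB' 0 ⟨le_rfl, zero_le_one⟩)
  refine ⟨max B C * 2 ^ (m / 2), by positivity, fun r hr => ?_⟩
  have key : ∀ s : ℝ, 0 < s → 1 + r ≤ 2 * s →
      s ^ (-m / 2) ≤ 2 ^ (m / 2) * (1 + r) ^ (-m / 2) := fun s hs h => by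
    have h1 : (2 * s) ^ (-m / 2) ≤ (1 + r) ^ (-m / 2) :=
      Real.rpow_le_rpow_of_nonpos (by linarith) h (by linarith)
    rw [Real.mul_rpow (by norm_num) hs.le] at h1
    have h2 : (2 : ℝ) ^ (m / 2) * 2 ^ (-m / 2) = 1 := by
      rw [← Real.rpow_add (by norm_num)]; simp [neg_div]
    calc s ^ (-m / 2) = 2 ^ (m / 2) * (2 ^ (-m / 2) * s ^ (-m / 2)) := by
          rw [← mul_assoc, h2, one_mul]
      _ ≤ _ := by gcongr
  rcases le_total r 1 with h1 | h1
  · have h3 := key 1 one_pos (by linarith)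
    rw [Real.one_rpow] at h3
    calc F (r ^ 2) ≤ B * 1 * 1 := by
          rw [mul_one, mul_one]; exact hB' _ ⟨sq_nonneg r, pow_le_one₀ hr h1⟩
      _ ≤ max B C * (2 ^ (m / 2) * (1 + r) ^ (-m / 2)) * Real.exp r := by
          gcongr
          · exact le_max_left _ _
          · exact Real.one_le_exp hr
      _ = _ := by ring
  · calc F (r ^ 2) ≤ C * (r ^ (-m / 2) * Real.exp r) := hle r h1
      _ ≤ max B C * ((2 ^ (m / 2) * (1 + r) ^ (-m / 2)) * Real.exp r) := by
          gcongr
          · exact le_max_right _ _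
          · exact key r (by linarith) (by linarith)
      _ = _ := by ring

end Growth

/-! ### The eigenfunction of the Laplacian -/

section Eigenfunction

variable {n : ℕ}

local notation "𝔼" => EuclideanSpace ℝ (Fin n)

theorem fderiv_comp_norm_sq {F : ℝ → ℝ} (hF : Differentiable ℝ F) (c : ℝ) (x v : 𝔼) :
    fderiv ℝ (fun y : 𝔼 => F (c * ‖y‖ ^ 2)) x v = deriv F (c * ‖x‖ ^ 2) * (c * (2 * inner ℝ x v)) := by
  have h1 : HasFDerivAt (fun y : 𝔼 => c * ‖y‖ ^ 2) (c • (2 • innerSL ℝ x)) x :=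
    (hasStrictFDerivAt_norm_sq x).hasFDerivAt.const_mul c
  have h2 := (hF (c * ‖x‖ ^ 2)).hasDerivAt.comp_hasFDerivAt x h1
  change fderiv ℝ (F ∘ fun y : 𝔼 => c * ‖y‖ ^ 2) x v = _
  rw [h2.fderiv]
  simp

/-- Summing the second derivatives over the coordinate directions produces `c` times the left side
of the equation for `F` at `z = c |x|²`. Taking `c = L²` gives eigenvalue `L²`. -/
theorem lap_comp_norm_sq {F : ℝ → ℝ} (hF : ContDiff ℝ ∞ F) {c : ℝ}
    (hode : ∀ z, 4 * z * deriv (deriv F) z + 2 * n * deriv F z = F z) (x : 𝔼) :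
    lap (fun y : 𝔼 => F (c * ‖y‖ ^ 2)) x = c * F (c * ‖x‖ ^ 2) := by
  have hF1 : ContDiff ℝ ∞ (deriv F) := (contDiff_infty_iff_deriv.1 hF).2
  have hd0 : Differentiable ℝ F := (contDiff_infty_iff_deriv.1 hF).1
  have hd1 : Differentiable ℝ (deriv F) := (contDiff_infty_iff_deriv.1 hF1).1
  have key : ∀ i : Fin n, fderiv ℝ (fun y => fderiv ℝ (fun y : 𝔼 => F (c * ‖y‖ ^ 2)) y
      (EuclideanSpace.single i 1)) x (EuclideanSpace.single i 1)
      = c * (4 * (c * x i ^ 2) * deriv (deriv F) (c * ‖x‖ ^ 2) + 2 * deriv F (c * ‖x‖ ^ 2)) := by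
    intro i
    have e : (fun y => fderiv ℝ (fun y : 𝔼 => F (c * ‖y‖ ^ 2)) y (EuclideanSpace.single i 1))
        = fun y : 𝔼 => deriv F (c * ‖y‖ ^ 2) * (c * (2 * y i)) := by
      funext y
      rw [fderiv_comp_norm_sq hd0]
      simp [EuclideanSpace.inner_single_right]
    have hA : DifferentiableAt ℝ (fun y : 𝔼 => deriv F (c * ‖y‖ ^ 2)) x :=
      (hd1 _).comp x ((differentiableAt_id.norm_sq ℝ).const_mul c)
    have hB : HasFDerivAt (fun y : 𝔼 => c * (2 * y i))
        (c • ((2 : ℝ) • (EuclideanSpace.proj (𝕜 := ℝ) i : 𝔼 →L[ℝ] ℝ))) x :=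
      (((EuclideanSpace.proj (𝕜 := ℝ) i : 𝔼 →L[ℝ] ℝ).hasFDerivAt).const_mul 2).const_mul c
    have hAB := HasFDerivAt.fun_mul hA.hasFDerivAt hB
    rw [e, hAB.fderiv]
    simp only [add_apply, smul_apply,
      fderiv_comp_norm_sq hd1, smul_eq_mul]
    simp [EuclideanSpace.inner_single_right]
    ring
  have hn2 : ‖x‖ ^ 2 = ∑ i, x i ^ 2 := by
    rw [EuclideanSpace.norm_sq_eq]; simp
  rw [lap, Finset.sum_congr rfl fun i _ => key i, ← Finset.mul_sum, Finset.sum_add_distrib,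
    ← Finset.sum_mul, ← Finset.mul_sum, ← Finset.mul_sum, ← hn2, ← hode (c * ‖x‖ ^ 2)]
  simp only [Finset.sum_const, Finset.card_univ, Fintype.card_fin, nsmul_eq_mul]
  ring

end Eigenfunction

/-! ### Exponential lower bound for the linear inequality -/

section Comparison

theorem monotoneOn_Icc_of_hasDerivAt {a b : ℝ} {f f' : ℝ → ℝ} (hc : ContinuousOn f (Icc a b))
    (hf : ∀ x ∈ Ioo a b, HasDerivAt f (f' x) x) (h : ∀ x ∈ Ioo a b, 0 ≤ f' x) :
    MonotoneOn f (Icc a b) :=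
  monotoneOn_of_hasDerivWithinAt_nonneg (convex_Icc a b) hc
    (fun x hx => (hf x (interior_Icc (a := a) ▸ hx)).hasDerivWithinAt)
    fun x hx => h x (interior_Icc (a := a) ▸ hx)

theorem hasDerivAt_primitive {a b : ℝ} {f : ℝ → ℝ} (hf : ContinuousOn f (Icc a b)) {t : ℝ}
    (ht : t ∈ Ioo a b) : HasDerivAt (fun t => ∫ s in a..t, f s) (f t) t :=
  intervalIntegral.integral_hasDerivAt_right
    ((hf.mono (Icc_subset_Icc_right ht.2.le)).intervalIntegrable_of_Icc ht.1.le)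
    ((hf.mono Ioo_subset_Icc_self).stronglyMeasurableAtFilter isOpen_Ioo t ht)
    (hf.continuousAt (Icc_mem_nhds ht.1 ht.2))

theorem continuousOn_primitive_Icc {a b : ℝ} (hab : a ≤ b) {f : ℝ → ℝ}
    (hf : ContinuousOn f (Icc a b)) : ContinuousOn (fun t => ∫ s in a..t, f s) (Icc a b) := by
  have h := intervalIntegral.continuousOn_primitive_interval (a := a) (b := b) (μ := volume)
    (f := f) (by rw [uIcc_of_le hab]; exact hf.integrableOn_Icc)
  rwa [uIcc_of_le hab] at h

/-- The Riccati equation of `w'' + (a/t) w' = L² t ^ (2ℓ) w` has the WKB approximation `L t ^ ℓ - (ℓ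
+ a)/(2t)`, whose error is a multiple of `t⁻²` independent of `L`. The further term `-L t ^ (-ℓ-2)`
contributes `-2 L² t⁻²` through the cross term, which beats all other errors once `L` is large. This
is why the eigenvalue is taken as `L²` and not `1`. -/
theorem exists_riccati_subsolution {ℓ a : ℝ} (hℓ : -1 < ℓ) :
    ∃ L : ℝ, 0 < L ∧ ∀ t : ℝ, 1 ≤ t →
      (L * (ℓ * t ^ (ℓ - 1)) + (ℓ + a) / 2 * (t ^ 2)⁻¹ + L * ((ℓ + 2) * t ^ (-ℓ - 3)))
        + (L * t ^ ℓ - (ℓ + a) / 2 * t⁻¹ - L * t ^ (-ℓ - 2)) ^ 2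
        + a * t⁻¹ * (L * t ^ ℓ - (ℓ + a) / 2 * t⁻¹ - L * t ^ (-ℓ - 2)) ≤ L ^ 2 * t ^ (2 * ℓ) := by
  set c : ℝ := (ℓ + a) / 2 + (ℓ + a) ^ 2 / 4 - a * (ℓ + a) / 2 with hc
  refine ⟨1 + |c| + (2 * ℓ + 2), by linarith [abs_nonneg c], fun t ht => ?_⟩
  set L : ℝ := 1 + |c| + (2 * ℓ + 2) with hL
  have hL1 : 1 ≤ L := by linarith [abs_nonneg c]
  have ht0 : 0 < t := by linarith
  set x : ℝ := t ^ ℓ with hx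
  have hx0 : 0 < x := Real.rpow_pos_of_pos ht0 _
  have hxt : 1 ≤ x * t := by
    rw [hx, ← Real.rpow_add_one ht0.ne']
    exact Real.one_le_rpow ht (by linarith)
  have e1 : t ^ (ℓ - 1) = x / t := by rw [Real.rpow_sub_one ht0.ne']
  have e2 : t ^ (-ℓ - 2) = 1 / (x * t ^ 2) := by
    rw [show -ℓ - 2 = -(ℓ + (2 : ℕ)) by push_cast; ring, Real.rpow_neg ht0.le,
      Real.rpow_add_natCast ht0.ne', one_div]
  have e3 : t ^ (-ℓ - 3) = 1 / (x * t ^ 3) := by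
    rw [show -ℓ - 3 = -(ℓ + (3 : ℕ)) by push_cast; ring, Real.rpow_neg ht0.le,
      Real.rpow_add_natCast ht0.ne', one_div]
  have e4 : t ^ (2 * ℓ) = x ^ 2 := by
    rw [mul_comm, Real.rpow_mul ht0.le]; norm_num [hx]
  rw [e1, e2, e3, e4, ← sub_nonpos]
  set y : ℝ := 1 / (x * t) with hy
  have hy0 : 0 ≤ y := by positivity
  have hy1 : y ≤ 1 := by rw [hy, div_le_one (by positivity)]; exact hxt
  have e : (L * (ℓ * (x / t)) + (ℓ + a) / 2 * (t ^ 2)⁻¹ + L * ((ℓ + 2) * (1 / (x * t ^ 3))))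
        + (L * x - (ℓ + a) / 2 * t⁻¹ - L * (1 / (x * t ^ 2))) ^ 2
        + a * t⁻¹ * (L * x - (ℓ + a) / 2 * t⁻¹ - L * (1 / (x * t ^ 2))) - L ^ 2 * x ^ 2
      = (c - 2 * L ^ 2 + L * (2 * ℓ + 2) * y + L ^ 2 * y ^ 2) / t ^ 2 := by
    rw [hc, hy]
    field_simp
    ring
  rw [e]
  refine div_nonpos_of_nonpos_of_nonneg ?_ (by positivity)
  have h1 : L * (2 * ℓ + 2) * y ≤ L * (2 * ℓ + 2) :=
    mul_le_of_le_one_right (mul_nonneg (by linarith) (by linarith)) hy1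
  have h2 : L ^ 2 * y ^ 2 ≤ L ^ 2 :=
    mul_le_of_le_one_right (by positivity) (pow_le_one₀ hy0 hy1)
  have h3 : L ^ 2 = L * (1 + |c|) + L * (2 * ℓ + 2) := by rw [sq]; nth_rewrite 2 [hL]; ring
  have h4 : c ≤ L * (1 + |c|) := by nlinarith [le_abs_self c, abs_nonneg c]
  linarith

/-- A function that is positive at `1` and satisfies `t ^ a W' ≥ ∫ k W` with `k ≥ 0` stays
positive. -/
theorem pos_of_integral_le {t₁ a : ℝ} {W W' k : ℝ → ℝ} (hW1 : 0 < W 1)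
    (hWd : ∀ t ∈ Icc 1 t₁, HasDerivWithinAt W (W' t) (Icc 1 t₁) t)
    (hk : ∀ t ∈ Icc 1 t₁, 0 ≤ k t)
    (hW : ∀ t ∈ Ioc 1 t₁, ∫ s in (1 : ℝ)..t, k s * W s ≤ t ^ a * W' t) :
    ∀ t ∈ Icc 1 t₁, 0 < W t := by
  have hWc : ContinuousOn W (Icc 1 t₁) := fun t ht => (hWd t ht).continuousWithinAt
  by_contra! hcon
  have hcl : IsCompact (Icc 1 t₁ ∩ W ⁻¹' Iic 0) :=
    isCompact_Icc.of_isClosed_subset (hWc.preimage_isClosed_of_isClosed isClosed_Icc isClosed_Iic)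
      inter_subset_left
  obtain ⟨s, hs, hs'⟩ := hcon
  -- Consider the first time with `W ≤ 0`. Before it the integral is nonnegative, so `W` increases
  -- and cannot have dropped below `W 1`.
  obtain ⟨s₀, ⟨hs₀, hs₀'⟩, hmin⟩ := hcl.exists_isLeast ⟨s, hs, hs'⟩
  have hpos : ∀ t ∈ Ico 1 s₀, 0 < W t := fun t ht => by
    by_contra hneg
    exact absurd (hmin ⟨⟨ht.1, ht.2.le.trans hs₀.2⟩, not_lt.1 hneg⟩) (not_le.2 ht.2)
  have hmono : MonotoneOn W (Icc 1 s₀) := by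
    refine monotoneOn_Icc_of_hasDerivAt (f' := W') (hWc.mono (Icc_subset_Icc_right hs₀.2))
      (fun t ht => (hWd t ⟨ht.1.le, ht.2.le.trans hs₀.2⟩).hasDerivAt
        (Icc_mem_nhds ht.1 (ht.2.trans_le hs₀.2))) fun t ht => ?_
    have h1 : 0 ≤ ∫ s in (1 : ℝ)..t, k s * W s :=
      intervalIntegral.integral_nonneg ht.1.le fun s hs => mul_nonneg
        (hk s ⟨hs.1, (hs.2.trans ht.2.le).trans hs₀.2⟩) (hpos s ⟨hs.1, hs.2.trans_lt ht.2⟩).le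
    have h2 := h1.trans (hW t ⟨ht.1, ht.2.le.trans hs₀.2⟩)
    exact nonneg_of_mul_nonneg_right h2 (Real.rpow_pos_of_pos (by linarith [ht.1]) _)
  have := hmono ⟨le_rfl, hs₀.1⟩ ⟨hs₀.1, le_rfl⟩ hs₀.1
  exact absurd hs₀' (not_le.2 (hW1.trans_le this))

/-- The hypothesis integrates `(t ^ a W')' ≥ L² t ^ (a + 2ℓ) W`. The subsolution `q` of the Riccati
equation integrates to `S`, and `W` is shown to dominate a multiple of `exp S`; only `W 1 > 0` is
needed, not the sign of `W' 1`. -/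
theorem exists_exponential_lower_bound {ℓ a : ℝ} (hℓ : -1 < ℓ) (ha : 1 ≤ a) :
    ∃ L : ℝ, 0 < L ∧ ∃ c : ℝ, 0 < c ∧ ∀ (t₁ : ℝ) (W W' : ℝ → ℝ), 1 < t₁ → 0 < W 1 →
      (∀ t ∈ Icc 1 t₁, HasDerivWithinAt W (W' t) (Icc 1 t₁) t) →
      (∀ t ∈ Ioc 1 t₁, ∫ s in (1 : ℝ)..t, L ^ 2 * s ^ (a + 2 * ℓ) * W s ≤ t ^ a * W' t) →
      ∀ t ∈ Icc 1 t₁, c * W 1 * (Real.exp (L * phiEll ℓ t) * t ^ (-(ℓ + a) / 2)) ≤ W t := by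
  obtain ⟨L, hL, hric⟩ := exists_riccati_subsolution (a := a) hℓ
  have hℓ1 : 0 < ℓ + 1 := by linarith
  let S : ℝ → ℝ := fun t => L * phiEll ℓ t - (ℓ + a) / 2 * Real.log t
    + L * (t ^ (-ℓ - 1) / (ℓ + 1))
  let q : ℝ → ℝ := fun t => L * t ^ ℓ - (ℓ + a) / 2 * t⁻¹ - L * t ^ (-ℓ - 2)
  let q' : ℝ → ℝ := fun t =>
    L * (ℓ * t ^ (ℓ - 1)) + (ℓ + a) / 2 * (t ^ 2)⁻¹ + L * ((ℓ + 2) * t ^ (-ℓ - 3))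
  have hS : ∀ t, 1 ≤ t → HasDerivAt S (q t) t := fun t ht => by
    have ht0 : t ≠ 0 := by linarith
    have h1 := ((Real.hasDerivAt_rpow_const (x := t) (p := ℓ + 1) (Or.inl ht0)).div_const
      (ℓ + 1)).const_mul L
    have h2 := ((Real.hasDerivAt_rpow_const (x := t) (p := -ℓ - 1) (Or.inl ht0)).div_const
      (ℓ + 1)).const_mul L
    refine ((h1.sub ((Real.hasDerivAt_log ht0).const_mul ((ℓ + a) / 2))).add h2).congr_deriv ?_
    simp only [q]
    rw [show ℓ + 1 - 1 = ℓ by ring, show -ℓ - 1 - 1 = -ℓ - 2 by ring]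
    field_simp
    ring
  have hq : ∀ t, 1 ≤ t → HasDerivAt q (q' t) t := fun t ht => by
    have ht0 : t ≠ 0 := by linarith
    have h1 := (Real.hasDerivAt_rpow_const (x := t) (p := ℓ) (Or.inl ht0)).const_mul L
    have h2 := (Real.hasDerivAt_rpow_const (x := t) (p := -ℓ - 2) (Or.inl ht0)).const_mul L
    refine ((h1.sub ((hasDerivAt_inv ht0).const_mul ((ℓ + a) / 2))).sub h2).congr_deriv ?_
    simp only [q']
    rw [show -ℓ - 2 - 1 = -ℓ - 3 by ring]
    ring
  refine ⟨L, hL, Real.exp (-S 1), Real.exp_pos _, fun t₁ W W' ht₁ hW1 hWd hW => ?_⟩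
  have hpos0 : ∀ t ∈ Icc 1 t₁, (0 : ℝ) < t := fun t ht => by linarith [ht.1]
  have hWc : ContinuousOn W (Icc 1 t₁) := fun t ht => (hWd t ht).continuousWithinAt
  have hWpos : ∀ t ∈ Icc 1 t₁, 0 < W t := pos_of_integral_le hW1 hWd
    (fun t ht => mul_nonneg (sq_nonneg L) (Real.rpow_nonneg (hpos0 t ht).le _)) hW
  have hcont := continuousOn_rpow_Icc (t := t₁)
  let k : ℝ → ℝ := fun s => L ^ 2 * s ^ (a + 2 * ℓ) * W s
  have hkc : ContinuousOn k (Icc 1 t₁) := (continuousOn_const.mul (hcont _)).mul hWc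
  have hk0 : ∀ s ∈ Icc 1 t₁, 0 ≤ k s := fun s hs => mul_nonneg (mul_nonneg (sq_nonneg L)
    (Real.rpow_nonneg (hpos0 s hs).le _)) (hWpos s hs).le
  let E : ℝ → ℝ := fun t => ∫ s in (1 : ℝ)..t, k s
  have hEc : ContinuousOn E (Icc 1 t₁) := continuousOn_primitive_Icc ht₁.le hkc
  have hE0 : ∀ t ∈ Icc 1 t₁, 0 ≤ E t := fun t ht =>
    intervalIntegral.integral_nonneg ht.1 fun s hs => hk0 s ⟨hs.1, hs.2.trans ht.2⟩
  -- Since `W'` need not be differentiable, `W` is replaced from below by `Y`, for which `t ^ a Y' =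
  -- E` holds exactly and `E` is a primitive of `k`.
  let v : ℝ → ℝ := fun s => s ^ (-a) * E s
  have hvc : ContinuousOn v (Icc 1 t₁) := (hcont _).mul hEc
  let Y : ℝ → ℝ := fun t => W 1 + ∫ s in (1 : ℝ)..t, v s
  have hYc : ContinuousOn Y (Icc 1 t₁) :=
    continuousOn_const.add (continuousOn_primitive_Icc ht₁.le hvc)
  have hY1 : Y 1 = W 1 := by simp [Y]
  have hYd : ∀ t ∈ Ioo 1 t₁, HasDerivAt Y (v t) t := fun t ht =>
    (hasDerivAt_primitive hvc ht).const_add _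
  have hY0 : ∀ t ∈ Icc 1 t₁, 0 ≤ Y t := fun t ht =>
    add_nonneg hW1.le (intervalIntegral.integral_nonneg ht.1 fun s hs =>
      mul_nonneg (Real.rpow_nonneg (by linarith [hs.1]) _) (hE0 s ⟨hs.1, hs.2.trans ht.2⟩))
  have hYW : ∀ t ∈ Icc 1 t₁, Y t ≤ W t := fun t ht => by
    have hm : MonotoneOn (fun t => W t - Y t) (Icc 1 t₁) := by
      refine monotoneOn_Icc_of_hasDerivAt (f' := fun t => W' t - v t) (hWc.sub hYc)
        (fun t ht => ((hWd t (Ioo_subset_Icc_self ht)).hasDerivAt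
          (Icc_mem_nhds ht.1 ht.2)).sub (hYd t ht)) fun t ht => ?_
      have ht0 : 0 < t := by linarith [ht.1]
      have h1 : E t ≤ t ^ a * W' t := hW t ⟨ht.1, ht.2.le⟩
      have h2 : t ^ (-a) * E t ≤ t ^ (-a) * (t ^ a * W' t) := by gcongr
      rw [← mul_assoc, ← Real.rpow_add ht0, neg_add_cancel, Real.rpow_zero, one_mul] at h2
      exact sub_nonneg.2 h2
    have h3 := hm ⟨le_rfl, ht₁.le⟩ ht ht.1
    simp only [hY1, sub_self] at h3
    linarith
  -- Here `E - t ^ a q Y = t ^ a (Y' - q Y)`, and `D' = exp(S) t ^ a (L² t ^ (2ℓ) W - (q' + q² +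
  -- (a/t) q) Y) ≥ 0` by the subsolution property and `Y ≤ W`.
  let D : ℝ → ℝ := fun t => Real.exp (S t) * (E t - t ^ a * (q t * Y t))
  have hSc : ContinuousOn S (Icc 1 t₁) := fun t ht =>
    (hS t ht.1).continuousAt.continuousWithinAt
  have hqc : ContinuousOn q (Icc 1 t₁) := fun t ht =>
    (hq t ht.1).continuousAt.continuousWithinAt
  have hD : ∀ t ∈ Icc 1 t₁, 0 ≤ D t := fun t ht => by
    have hm : MonotoneOn D (Icc 1 t₁) := by
      refine monotoneOn_Icc_of_hasDerivAt (hSc.rexp.mul (hEc.sub ((hcont a).mul (hqc.mul hYc))))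
        (fun t ht => (hS t ht.1.le).exp.mul ((hasDerivAt_primitive hkc ht).sub
          ((Real.hasDerivAt_rpow_const (p := a) (Or.inl (by linarith [ht.1]))).mul
            ((hq t ht.1.le).mul (hYd t ht))))) fun t ht => ?_
      have ht0 : 0 < t := by linarith [ht.1]
      have htI := Ioo_subset_Icc_self ht
      have hta : 0 < t ^ a := Real.rpow_pos_of_pos ht0 a
      have hva : t ^ a * v t = E t := by
        simp only [v]
        rw [← mul_assoc, ← Real.rpow_add ht0, add_neg_cancel, Real.rpow_zero, one_mul]
      have ha1 : t ^ (a - 1) = t ^ a * t⁻¹ := by rw [Real.rpow_sub_one ht0.ne', div_eq_mul_inv]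
      have hkt : k t = t ^ a * (L ^ 2 * t ^ (2 * ℓ) * W t) := by
        simp only [k]
        rw [Real.rpow_add ht0]
        ring
      have e : Real.exp (S t) * q t * (E t - t ^ a * (q t * Y t))
          + Real.exp (S t) * (k t - (a * t ^ (a - 1) * (q t * Y t)
            + t ^ a * (q' t * Y t + q t * v t)))
          = Real.exp (S t) * t ^ a * (L ^ 2 * t ^ (2 * ℓ) * W t
            - (q' t + q t ^ 2 + a * t⁻¹ * q t) * Y t) := by
        rw [← hva, hkt, ha1]
        ring
      refine e.symm.subst (motive := fun z => 0 ≤ z) ?_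
      have h1 : (q' t + q t ^ 2 + a * t⁻¹ * q t) * Y t ≤ L ^ 2 * t ^ (2 * ℓ) * W t :=
        (mul_le_mul_of_nonneg_right (hric t ht.1.le) (hY0 t htI)).trans
          (mul_le_mul_of_nonneg_left (hYW t htI)
            (mul_nonneg (sq_nonneg L) (Real.rpow_nonneg ht0.le _)))
      have h2 := sub_nonneg.2 h1
      positivity
    refine le_trans ?_ (hm ⟨le_rfl, ht₁.le⟩ ht ht.1)
    have hE1 : E 1 = 0 := by simp [E]
    -- The correction term in `q` cancels `L` at `t = 1`, so `q 1 < 0` whatever the size of `L`, and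
    -- `D` starts nonnegative.
    have hq1 : q 1 = -((ℓ + a) / 2) := by simp [q]
    simp only [D, hE1, hq1, hY1, Real.one_rpow]
    have : 0 ≤ (ℓ + a) / 2 * W 1 := mul_nonneg (by linarith) hW1.le
    refine mul_nonneg (Real.exp_pos _).le ?_
    linarith
  have hm : MonotoneOn (fun t => Y t * Real.exp (-S t)) (Icc 1 t₁) := by
    refine monotoneOn_Icc_of_hasDerivAt (hYc.mul hSc.neg.rexp)
      (fun t ht => (hYd t ht).mul (hS t ht.1.le).neg.exp) fun t ht => ?_
    have ht0 : 0 < t := by linarith [ht.1]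
    have h1 : 0 ≤ E t - t ^ a * (q t * Y t) :=
      nonneg_of_mul_nonneg_right (hD t (Ioo_subset_Icc_self ht)) (Real.exp_pos _)
    have h2 : t ^ (-a) * (E t - t ^ a * (q t * Y t)) = v t - q t * Y t := by
      simp only [v]
      rw [mul_sub, ← mul_assoc _ (t ^ a), ← Real.rpow_add ht0, neg_add_cancel, Real.rpow_zero,
        one_mul]
    have h3 : 0 ≤ v t - q t * Y t := h2 ▸ mul_nonneg (Real.rpow_nonneg ht0.le _) h1
    have e : v t * Real.exp (-S t) + Y t * (Real.exp (-S t) * -q t)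
        = (v t - q t * Y t) * Real.exp (-S t) := by ring
    refine e.symm.subst (motive := fun z => 0 ≤ z) ?_
    positivity
  intro t ht
  have ht0 := hpos0 t ht
  have h1 : W 1 * Real.exp (-S 1) ≤ Y t * Real.exp (-S t) := by
    have h := hm ⟨le_rfl, ht₁.le⟩ ht ht.1
    simp only [hY1] at h
    exact h
  have h2 : Real.exp (L * phiEll ℓ t) * t ^ (-(ℓ + a) / 2) ≤ Real.exp (S t) := by
    rw [Real.rpow_def_of_pos ht0, ← Real.exp_add, Real.exp_le_exp]
    have : 0 ≤ L * (t ^ (-ℓ - 1) / (ℓ + 1)) := by positivity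
    simp only [S]
    linarith
  calc Real.exp (-S 1) * W 1 * (Real.exp (L * phiEll ℓ t) * t ^ (-(ℓ + a) / 2))
      ≤ Real.exp (-S 1) * W 1 * Real.exp (S t) := by gcongr
    _ = W 1 * Real.exp (-S 1) * Real.exp (S t) := by ring
    _ ≤ Y t * Real.exp (-S t) * Real.exp (S t) := by gcongr
    _ = Y t := by rw [mul_assoc, ← Real.exp_add]; simp
    _ ≤ W t := hYW t ht

end Comparison

/-! ### Blow-up criterion and lifespan of the scalar inequality -/

section Blowup

/-- A solution of `W'' ≥ A W ^ p` (in integrated form) with `W ≥ w` cannot exist on an interval of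
length `3 d` unless `A w ^ (p - 1) d²` is bounded in terms of `p`. -/
theorem blowup_criterion {p A x d w : ℝ} (hp : 1 < p) (hA : 0 < A) (hd : 0 < d) (hw : 0 < w)
    {W W' : ℝ → ℝ}
    (hWd : ∀ t ∈ Icc x (x + 3 * d), HasDerivWithinAt W (W' t) (Icc x (x + 3 * d)) t)
    (hWw : ∀ t ∈ Icc x (x + 3 * d), w ≤ W t)
    (hW : ∀ t ∈ Ioo x (x + 3 * d), A * ∫ s in x..t, W s ^ p ≤ W' t) :
    A * w ^ (p - 1) * d ^ 2 ≤ 2 + (p + 1) / (p - 1) ^ 2 := by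
  by_contra! hcon
  have hp1 : 0 < p - 1 := by linarith
  have hfrac : 0 < (p + 1) / (p - 1) ^ 2 := by positivity
  set b : ℝ := x + 3 * d with hb
  have hxb : x ≤ b := by linarith
  have hWc : ContinuousOn W (Icc x b) := fun t ht => (hWd t ht).continuousWithinAt
  have hWp : ContinuousOn (fun t => W t ^ p) (Icc x b) :=
    hWc.rpow_const fun t _ => Or.inr (by linarith)
  let J : ℝ → ℝ := fun t => A * ∫ s in x..t, W s ^ p
  have hJc : ContinuousOn J (Icc x b) :=
    continuousOn_const.mul (continuousOn_primitive_Icc hxb hWp)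
  have hJd : ∀ t ∈ Ioo x b, HasDerivAt J (A * W t ^ p) t := fun t ht =>
    (hasDerivAt_primitive hWp ht).const_mul A
  have hJx : J x = 0 := by simp [J]
  let Y : ℝ → ℝ := fun t => w + ∫ s in x..t, J s
  have hYc : ContinuousOn Y (Icc x b) :=
    continuousOn_const.add (continuousOn_primitive_Icc hxb hJc)
  have hYd : ∀ t ∈ Ioo x b, HasDerivAt Y (J t) t := fun t ht =>
    (hasDerivAt_primitive hJc ht).const_add _
  have hYx : Y x = w := by simp [Y]
  have hxI : x ∈ Icc x b := ⟨le_rfl, hxb⟩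
  have hJlow : ∀ t ∈ Icc x b, A * w ^ p * (t - x) ≤ J t := fun t ht => by
    have hm : MonotoneOn (fun t => J t - A * w ^ p * (t - x)) (Icc x b) := by
      refine monotoneOn_Icc_of_hasDerivAt (hJc.sub (by fun_prop)) (fun t ht => (hJd t ht).sub
        (((hasDerivAt_id t).sub_const x).const_mul (A * w ^ p))) fun t ht => ?_
      have := hWw t (Ioo_subset_Icc_self ht)
      have h2 : w ^ p ≤ W t ^ p := by gcongr
      simpa using mul_le_mul_of_nonneg_left h2 hA.le
    have := hm hxI ht ht.1
    simp only [hJx, sub_self, mul_zero] at this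
    linarith
  have hJ0 : ∀ t ∈ Icc x b, 0 ≤ J t := fun t ht =>
    (mul_nonneg (by positivity) (sub_nonneg.2 ht.1)).trans (hJlow t ht)
  have hYlow : ∀ t ∈ Icc x b, w + A * w ^ p * ((t - x) ^ 2 / 2) ≤ Y t := fun t ht => by
    have hm : MonotoneOn (fun t => Y t - A * w ^ p * ((t - x) ^ 2 / 2)) (Icc x b) := by
      refine monotoneOn_Icc_of_hasDerivAt (hYc.sub (by fun_prop)) (fun t ht => (hYd t ht).sub
        (((((hasDerivAt_id t).sub_const x).pow 2).div_const 2).const_mul (A * w ^ p)))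
        fun t ht => ?_
      have := hJlow t (Ioo_subset_Icc_self ht)
      simp
      linarith
    have := hm hxI ht ht.1
    simp only [hYx, sub_self] at this
    norm_num at this
    linarith
  have hYw : ∀ t ∈ Icc x b, w ≤ Y t := fun t ht =>
    le_trans (by have : 0 ≤ A * w ^ p * ((t - x) ^ 2 / 2) := by positivity
                 linarith) (hYlow t ht)
  have hYpos : ∀ t ∈ Icc x b, 0 < Y t := fun t ht => hw.trans_le (hYw t ht)
  have hYW : ∀ t ∈ Icc x b, Y t ≤ W t := fun t ht => by
    have hm : MonotoneOn (fun t => W t - Y t) (Icc x b) :=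
      monotoneOn_Icc_of_hasDerivAt (hWc.sub hYc) (fun t ht =>
        ((hWd t (Ioo_subset_Icc_self ht)).hasDerivAt (Icc_mem_nhds ht.1 ht.2)).sub (hYd t ht))
        fun t ht => sub_nonneg.2 (hW t ht)
    have := hm hxI ht ht.1
    simp only [hYx] at this
    linarith [hWw x hxI]
  -- the energy inequality
  have hen : ∀ t ∈ Icc x b, 2 * A / (p + 1) * (Y t ^ (p + 1) - w ^ (p + 1)) ≤ J t ^ 2 :=
    fun t ht => by
    have hm : MonotoneOn (fun t => J t ^ 2 - 2 * A / (p + 1) * Y t ^ (p + 1)) (Icc x b) := by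
      refine monotoneOn_Icc_of_hasDerivAt ((hJc.pow 2).sub (continuousOn_const.mul
        (hYc.rpow_const fun t _ => Or.inr (by linarith))))
        (fun t ht => ((hJd t ht).pow 2).sub (((hYd t ht).rpow_const
          (Or.inl (hYpos t (Ioo_subset_Icc_self ht)).ne')).const_mul (2 * A / (p + 1))))
        fun t ht => ?_
      have htI := Ioo_subset_Icc_self ht
      have h1 : Y t ^ p ≤ W t ^ p :=
        Real.rpow_le_rpow (hYpos t htI).le (hYW t htI) (by linarith)
      have e : ((2 : ℕ) : ℝ) * J t ^ (2 - 1) * (A * W t ^ p)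
          - 2 * A / (p + 1) * (J t * (p + 1) * Y t ^ (p + 1 - 1))
          = 2 * A * J t * (W t ^ p - Y t ^ p) := by
        rw [add_sub_cancel_right]
        field_simp
        push_cast
        ring
      rw [e]
      have h2 := sub_nonneg.2 h1
      have h3 := hJ0 t htI
      positivity
    have := hm hxI ht ht.1
    simp only [hJx, hYx] at this
    linarith
  have hw1 : w ^ p = w ^ (p - 1) * w := by
    rw [← Real.rpow_add_one hw.ne']; congr 1; ring
  -- The first third of the interval doubles `Y`: the negated bound gives `A w ^ (p - 1) d² > 2`,
  -- which is the origin of the summand `2`.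
  have hY2 : ∀ t ∈ Icc (x + d) b, 2 * w ≤ Y t := fun t ht => by
    have htI : t ∈ Icc x b := ⟨by linarith [ht.1], ht.2⟩
    refine le_trans ?_ (hYlow t htI)
    have h1 : d ^ 2 ≤ (t - x) ^ 2 := by
      have : d ≤ t - x := by linarith [ht.1]
      gcongr
    have h2 : w ≤ A * w ^ p * (d ^ 2 / 2) := by
      have h3 : A * w ^ p * (d ^ 2 / 2) = A * w ^ (p - 1) * d ^ 2 / 2 * w := by rw [hw1]; ring
      rw [h3]
      exact le_mul_of_one_le_left hw.le (by linarith)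
    have h4 : A * w ^ p * (d ^ 2 / 2) ≤ A * w ^ p * ((t - x) ^ 2 / 2) := by gcongr
    linarith
  set B : ℝ := √(A / (p + 1)) with hB
  -- Once `Y ≥ 2 w`, half of `Y ^ (p + 1)` pays for `w ^ (p + 1)` in the energy inequality, which
  -- becomes `Y' ≥ B Y ^ ((p + 1)/2)`.
  have hJY : ∀ t ∈ Icc (x + d) b, B * Y t ^ ((p + 1) / 2) ≤ J t := fun t ht => by
    have htI : t ∈ Icc x b := ⟨by linarith [ht.1], ht.2⟩
    have hY := hYpos t htI
    refine le_of_sq_le_sq ?_ (hJ0 t htI)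
    refine le_trans ?_ (hen t htI)
    have h1 : (2 * w) ^ (p + 1) ≤ Y t ^ (p + 1) :=
      Real.rpow_le_rpow (by positivity) (hY2 t ht) (by linarith)
    rw [Real.mul_rpow (by norm_num) hw.le] at h1
    have h2 : (2 : ℝ) ≤ 2 ^ (p + 1) := by
      simpa using Real.rpow_le_rpow_of_exponent_le (x := (2 : ℝ)) (by norm_num)
        (by linarith : (1 : ℝ) ≤ p + 1)
    have h3 : 2 * w ^ (p + 1) ≤ Y t ^ (p + 1) :=
      (mul_le_mul_of_nonneg_right h2 (by positivity)).trans h1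
    have h4 : (B * Y t ^ ((p + 1) / 2)) ^ 2 = A / (p + 1) * Y t ^ (p + 1) := by
      rw [mul_pow, hB, Real.sq_sqrt (by positivity), ← Real.rpow_mul_natCast hY.le]
      congr 2
      push_cast
      ring
    rw [h4, show 2 * A / (p + 1) * (Y t ^ (p + 1) - w ^ (p + 1))
      = A / (p + 1) * (2 * Y t ^ (p + 1) - 2 * w ^ (p + 1)) by ring]
    gcongr
    linarith
  have hsub : Icc (x + d) b ⊆ Icc x b := Icc_subset_Icc_left (by linarith)
  -- On the remaining length `2 d` the positive quantity `Y ^ (-(p-1)/2)` falls at rate at least `(p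
  -- - 1) B / 2`; this yields the summand `(p + 1)/(p - 1)²`.
  have hm : MonotoneOn (fun t => -(Y t ^ (-((p - 1) / 2)) + (p - 1) / 2 * B * t))
      (Icc (x + d) b) := by
    refine monotoneOn_Icc_of_hasDerivAt (f' := fun t =>
      -(J t * (-((p - 1) / 2)) * Y t ^ (-((p - 1) / 2) - 1) + (p - 1) / 2 * B * 1)) ?_
      (fun t ht => ?_) fun t ht => ?_
    · exact (((hYc.mono hsub).rpow_const fun t ht => Or.inl (hYpos t (hsub ht)).ne').add
        (by fun_prop)).neg
    · have htI : t ∈ Ioo x b := ⟨by linarith [ht.1], ht.2⟩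
      exact (((hYd t htI).rpow_const (Or.inl (hYpos t (Ioo_subset_Icc_self htI)).ne')).add
        ((hasDerivAt_id t).const_mul _)).neg
    · have htI := Ioo_subset_Icc_self ht
      have hY := hYpos t (hsub htI)
      have h1 : B * Y t ^ ((p + 1) / 2) * Y t ^ (-((p - 1) / 2) - 1)
          ≤ J t * Y t ^ (-((p - 1) / 2) - 1) := by
        gcongr
        exact hJY t htI
      rw [mul_assoc, ← Real.rpow_add hY,
        show (p + 1) / 2 + (-((p - 1) / 2) - 1) = 0 by ring, Real.rpow_zero, mul_one] at h1
      have h2 := mul_le_mul_of_nonneg_left h1 (by linarith : 0 ≤ (p - 1) / 2)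
      linarith
  have hfin := hm (a := x + d) (b := b) ⟨le_rfl, by linarith⟩ ⟨by linarith, le_rfl⟩ (by linarith)
  have hYb : 0 < Y b ^ (-((p - 1) / 2)) := Real.rpow_pos_of_pos (hYpos b ⟨hxb, le_rfl⟩) _
  have hYd' : Y (x + d) ^ (-((p - 1) / 2)) ≤ w ^ (-((p - 1) / 2)) :=
    Real.rpow_le_rpow_of_nonpos hw (hYw _ ⟨by linarith, by linarith⟩) (by linarith)
  have h5 : (p - 1) * B * d ≤ w ^ (-((p - 1) / 2)) := by
    simp only [hb] at hfin hYb
    linarith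
  have h6 : ((p - 1) * B * d) ^ 2 ≤ (w ^ (-((p - 1) / 2))) ^ 2 := by gcongr
  rw [mul_pow, mul_pow, hB, Real.sq_sqrt (by positivity), ← Real.rpow_mul_natCast hw.le,
    show -((p - 1) / 2) * ((2 : ℕ) : ℝ) = -(p - 1) by push_cast; ring] at h6
  have h7 := mul_le_mul_of_nonneg_right h6 (Real.rpow_nonneg hw.le (p - 1))
  rw [← Real.rpow_add hw, neg_add_cancel, Real.rpow_zero] at h7
  have h8 : A * w ^ (p - 1) * d ^ 2 ≤ (p + 1) / (p - 1) ^ 2 := by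
    rw [le_div_iff₀ (by positivity)]
    have h9 : (p - 1) ^ 2 * (A / (p + 1)) * d ^ 2 * w ^ (p - 1)
        = A * w ^ (p - 1) * d ^ 2 * (p - 1) ^ 2 / (p + 1) := by ring
    rw [h9, div_le_one (by linarith)] at h7
    exact h7
  linarith

/-- On `[x, N x]` the function `s ^ e` is comparable with `x ^ e`. -/
theorem rpow_comparable {N x s : ℝ} (e : ℝ) (hN : 1 ≤ N) (hx : 0 < x) (h1 : x ≤ s)
    (h2 : s ≤ N * x) : N ^ (-|e|) * x ^ e ≤ s ^ e := by
  have hs : 0 < s := hx.trans_le h1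
  have hN0 : 0 < N := by linarith
  rcases le_total 0 e with he | he
  · rw [abs_of_nonneg he]
    calc N ^ (-e) * x ^ e ≤ 1 * x ^ e := by
          gcongr
          exact Real.rpow_le_one_of_one_le_of_nonpos hN (by linarith)
      _ ≤ s ^ e := by rw [one_mul]; gcongr
  · rw [abs_of_nonpos he, neg_neg, ← Real.mul_rpow hN0.le hx.le]
    exact Real.rpow_le_rpow_of_nonpos hs h2 he

/-- With `x = d = t/4` the interval `[x, x + 3d]` is `[t/4, t]`. There the weights are comparable
with powers of `x`, and monotonicity gives `W ≥ K x ^ β`, so `blowup_criterion` applies with `A` a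
multiple of `x ^ (-m)`. The alternative `t ≤ 4 t₁` is the case where `x` does not exceed `t₁`. -/
theorem exists_lifespan_bound {p a m β c t₁ : ℝ} (hp : 1 < p) (hc : 0 < c) (ht₁ : 1 ≤ t₁) :
    ∃ B : ℝ, 0 < B ∧ ∀ (K t : ℝ) (W W' : ℝ → ℝ), 0 < K → 1 < t →
      (∀ s ∈ Icc 1 t, HasDerivWithinAt W (W' s) (Icc 1 t) s) → MonotoneOn W (Icc 1 t) →
      (∀ s ∈ Icc t₁ t, K * s ^ β ≤ W s) →
      (∀ x y, 1 ≤ x → x < y → y ≤ t → c * ∫ s in x..y, s ^ (a - m) * W s ^ p ≤ y ^ a * W' y) →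
      t ≤ 4 * t₁ ∨ K ^ (p - 1) * (t / 4) ^ (β * (p - 1) + 2 - m) ≤ B := by
  set c' : ℝ := c * 4 ^ (-|a - m|) * 4 ^ (-|(-a)|) with hc'
  have hc'0 : 0 < c' := by positivity
  refine ⟨(2 + (p + 1) / (p - 1) ^ 2) / c', by
    have : 0 < p - 1 := by linarith
    positivity, fun K t W W' hK ht hWd hmono hlow hW => ?_⟩
  rw [or_iff_not_imp_left, not_le]
  intro h4
  set x : ℝ := t / 4 with hx
  have htx : t = x + 3 * x := by linarith
  have hx1 : 1 ≤ x := by linarith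
  have hx0 : 0 < x := by linarith
  have hsub : Icc x (x + 3 * x) ⊆ Icc 1 t := fun s hs => ⟨hx1.trans hs.1, by linarith [hs.2]⟩
  have hxt : x ∈ Icc t₁ t := ⟨by linarith, by linarith⟩
  have hw : 0 < K * x ^ β := by positivity
  have hWlow : ∀ s ∈ Icc x (x + 3 * x), K * x ^ β ≤ W s := fun s hs =>
    (hlow x hxt).trans (hmono (hsub ⟨le_rfl, by linarith⟩) (hsub hs) hs.1)
  have hWc : ContinuousOn W (Icc 1 t) := fun s hs => (hWd s hs).continuousWithinAt
  have hWp : ContinuousOn (fun s => W s ^ p) (Icc 1 t) :=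
    hWc.rpow_const fun t _ => Or.inr (by linarith)
  have key := blowup_criterion (A := c' * x ^ (-m)) hp (by positivity) hx0 hw
    (fun s hs => (hWd s (hsub hs)).mono hsub) hWlow fun y hy => by
      have hy0 : 0 < y := hx0.trans hy.1
      have hsubxy : Icc x y ⊆ Icc 1 t := fun s hs => hsub ⟨hs.1, hs.2.trans hy.2.le⟩
      have h1 := hW x y hx1 hy.1 (by linarith [hy.2])
      have h2 : ∫ s in x..y, 4 ^ (-|a - m|) * x ^ (a - m) * W s ^ p
          ≤ ∫ s in x..y, s ^ (a - m) * W s ^ p := by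
        refine intervalIntegral.integral_mono_on hy.1.le
          ((continuousOn_const.mul (hWp.mono hsubxy)).intervalIntegrable_of_Icc hy.1.le)
          ((((continuousOn_rpow_Icc (a - m) t).mul hWp).mono
            hsubxy).intervalIntegrable_of_Icc hy.1.le) fun s hs => ?_
        have hs' : s ∈ Icc x (x + 3 * x) := ⟨hs.1, hs.2.trans hy.2.le⟩
        have hWs : 0 ≤ W s := hw.le.trans (hWlow s hs')
        gcongr
        exact rpow_comparable _ (by norm_num) hx0 hs.1 (by linarith [hs'.2])
      rw [intervalIntegral.integral_const_mul] at h2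
      have h3 := rpow_comparable (N := 4) (-a) (by norm_num) hx0 hy.1.le (by linarith [hy.2])
      have hI : 0 ≤ ∫ s in x..y, W s ^ p := intervalIntegral.integral_nonneg hy.1.le
        fun s hs => Real.rpow_nonneg (hw.le.trans (hWlow s ⟨hs.1, hs.2.trans hy.2.le⟩)) _
      have hxm : x ^ (-m) = x ^ (-a) * x ^ (a - m) := by
        rw [← Real.rpow_add hx0]; congr 1; ring
      calc c' * x ^ (-m) * ∫ s in x..y, W s ^ p
          = (4 ^ (-|(-a)|) * x ^ (-a)) *
            (c * (4 ^ (-|a - m|) * x ^ (a - m) * ∫ s in x..y, W s ^ p)) := by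
            rw [hc', hxm]; ring
        _ ≤ y ^ (-a) * (c * (4 ^ (-|a - m|) * x ^ (a - m) * ∫ s in x..y, W s ^ p)) := by
            gcongr
        _ ≤ y ^ (-a) * (c * ∫ s in x..y, s ^ (a - m) * W s ^ p) := by gcongr
        _ ≤ y ^ (-a) * (y ^ a * W' y) := by gcongr
        _ = W' y := by
            rw [← mul_assoc, ← Real.rpow_add hy0, neg_add_cancel, Real.rpow_zero, one_mul]
  rw [le_div_iff₀ hc'0]
  refine le_trans (le_of_eq ?_) key
  rw [Real.mul_rpow hK.le (Real.rpow_nonneg hx0.le _), ← Real.rpow_mul hx0.le,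
    show β * (p - 1) + 2 - m = -m + β * (p - 1) + (2 : ℕ) by push_cast; ring,
    Real.rpow_add_natCast hx0.ne', Real.rpow_add hx0]
  ring

end Blowup

/-! ### Integrals of the eigenfunction over balls, and Hölder's inequality -/

section RadialIntegral

theorem one_add_rpow_le_exp (β : ℝ) {γ : ℝ} (hβ : 0 ≤ β) (hγ : 0 < γ) :
    ∃ K : ℝ, 0 < K ∧ ∀ σ : ℝ, 0 ≤ σ → (1 + σ) ^ β ≤ K * Real.exp (γ * σ) := by
  set δ : ℝ := γ / (β + 1) with hδ
  have hδ0 : 0 < δ := by positivity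
  refine ⟨(1 + δ⁻¹) ^ β, by positivity, fun σ hσ => ?_⟩
  have h1 : 1 + σ ≤ (1 + δ⁻¹) * Real.exp (δ * σ) := by
    have h2 := Real.add_one_le_exp (δ * σ)
    have h3 : 1 + σ ≤ (1 + δ⁻¹) * (δ * σ + 1) := by
      have h5 : (1 + δ⁻¹) * (δ * σ + 1) = 1 + σ + δ * σ + δ⁻¹ := by field_simp; ring
      have h4 : 0 ≤ δ * σ + δ⁻¹ := by positivity
      linarith
    exact h3.trans (by gcongr)
  calc (1 + σ) ^ β ≤ ((1 + δ⁻¹) * Real.exp (δ * σ)) ^ β := by gcongr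
    _ = (1 + δ⁻¹) ^ β * Real.exp (δ * σ * β) := by
        rw [Real.mul_rpow (by positivity) (Real.exp_pos _).le, ← Real.exp_mul]
    _ ≤ (1 + δ⁻¹) ^ β * Real.exp (γ * σ) := by
        have h6 : δ * σ * β = δ * β * σ := by ring
        rw [h6]
        gcongr
        rw [hδ, div_mul_eq_mul_div, div_le_iff₀ (by positivity)]
        nlinarith

theorem one_add_rpow_le_mul {x y : ℝ} (b : ℝ) (hx : 0 ≤ x) (hxy : x ≤ y) :
    (1 + x) ^ b ≤ (1 + y) ^ b * (1 + (y - x)) ^ |b| := by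
  have hσ : 0 ≤ y - x := by linarith
  rcases le_total 0 b with hb | hb
  · calc (1 + x) ^ b ≤ (1 + y) ^ b * 1 := by rw [mul_one]; gcongr
      _ ≤ (1 + y) ^ b * (1 + (y - x)) ^ |b| := by
        have : 0 ≤ 1 + y := by linarith
        gcongr
        exact Real.one_le_rpow (by linarith) (abs_nonneg b)
  · have h1 : ((1 + x) * (1 + (y - x))) ^ b ≤ (1 + y) ^ b :=
      Real.rpow_le_rpow_of_nonpos (by linarith) (by nlinarith) hb
    rw [Real.mul_rpow (by linarith) (by linarith)] at h1
    have h2 : (1 + (y - x)) ^ b * (1 + (y - x)) ^ |b| = 1 := by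
      rw [← Real.rpow_add (by linarith), abs_of_nonpos hb, add_neg_cancel, Real.rpow_zero]
    calc (1 + x) ^ b = (1 + x) ^ b * (1 + (y - x)) ^ b * (1 + (y - x)) ^ |b| := by
          rw [mul_assoc, h2, mul_one]
      _ ≤ _ := by gcongr

theorem integral_exp_le {c ρ : ℝ} (hc : 0 < c) :
    ∫ r in (0 : ℝ)..ρ, Real.exp (-(c * (ρ - r))) ≤ 1 / c := by
  have hd : ∀ r ∈ uIcc 0 ρ, HasDerivAt (fun r => Real.exp (-(c * (ρ - r))) / c)
      (Real.exp (-(c * (ρ - r)))) r := fun r _ => by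
    have h := ((((hasDerivAt_id r).const_sub ρ).const_mul c).neg.exp).div_const c
    refine h.congr_deriv ?_
    simp only [id, Pi.neg_apply]
    field_simp
  rw [intervalIntegral.integral_eq_sub_of_hasDerivAt hd
    (Continuous.intervalIntegrable (by fun_prop) _ _)]
  simp only [sub_self, mul_zero, neg_zero, Real.exp_zero]
  have : 0 ≤ Real.exp (-(c * (ρ - 0))) / c := by positivity
  linarith

variable {n : ℕ}

local notation "𝔼" => EuclideanSpace ℝ (Fin n)

theorem setIntegral_closedBall_fun_norm (hn : 1 ≤ n) (g : ℝ → ℝ) {ρ : ℝ} (hρ : 0 ≤ ρ) :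
    ∫ x in Metric.closedBall (0 : 𝔼) ρ, g ‖x‖ = n * (volume.real (Metric.ball (0 : 𝔼) 1) *
      ∫ r in (0 : ℝ)..ρ, r ^ (n - 1) * g r) := by
  have : Nonempty (Fin n) := ⟨⟨0, hn⟩⟩
  rw [← integral_indicator Metric.isClosed_closedBall.measurableSet]
  have e : (Metric.closedBall (0 : 𝔼) ρ).indicator (fun x => g ‖x‖)
      = fun x : 𝔼 => (Iic ρ).indicator g ‖x‖ := by
    funext x
    simp only [indicator, mem_closedBall_zero_iff, mem_Iic]
  rw [e, integral_fun_norm_addHaar volume ((Iic ρ).indicator g)]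
  simp only [finrank_euclideanSpace, Fintype.card_fin, nsmul_eq_mul, smul_eq_mul]
  congr 2
  have e2 : ∀ y : ℝ, y ^ (n - 1) * (Iic ρ).indicator g y
      = (Iic ρ).indicator (fun y => y ^ (n - 1) * g y) y := fun y => by
    by_cases hy : y ∈ Iic ρ <;> simp [hy]
  simp only [e2]
  rw [setIntegral_indicator measurableSet_Iic, Ioi_inter_Iic,
    intervalIntegral.integral_of_le hρ]

/-- The mass sits near `r = ρ`. Relative to the boundary value the integrand decays like `exp(-qL(ρ
- r))`; half of this rate absorbs the polynomial ratio of the weights at `r` and `ρ`, and the other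
half keeps the integral over `r` bounded. -/
theorem exists_radial_integral_bound (hn : 1 ≤ n) {F : ℝ → ℝ} (hF : Continuous F)
    (hF1 : ∀ z, 0 ≤ z → 1 ≤ F z) {C L q : ℝ} (hC : 0 < C) (hL : 0 < L) (hq : 0 < q)
    (hFC : ∀ r, 0 ≤ r → F (r ^ 2) ≤ C * ((1 + r) ^ (-((n : ℝ) - 1) / 2) * Real.exp r)) :
    ∃ C' : ℝ, 0 < C' ∧ ∀ ρ : ℝ, 0 ≤ ρ →
      ∫ x in Metric.closedBall (0 : 𝔼) ρ, F (L ^ 2 * ‖x‖ ^ 2) ^ q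
        ≤ C' * ((1 + L * ρ) ^ (((n : ℝ) - 1) * (1 - q / 2)) * Real.exp (q * L * ρ)) := by
  set b : ℝ := ((n : ℝ) - 1) * (1 - q / 2) with hb
  obtain ⟨K, hK, hKle⟩ := one_add_rpow_le_exp |b| (abs_nonneg b) (half_pos hq)
  set vol1 : ℝ := volume.real (Metric.ball (0 : 𝔼) 1) with hvol
  have hvol0 : 0 ≤ vol1 := measureReal_nonneg
  have hcast : ((n - 1 : ℕ) : ℝ) = (n : ℝ) - 1 := by push_cast [hn]; ring
  set D : ℝ := C ^ q * (L ^ (n - 1))⁻¹ * K with hD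
  have hD0 : 0 < D := by positivity
  have hqL : 0 < q / 2 * L := by positivity
  refine ⟨n * (vol1 * (D * (1 / (q / 2 * L)))) + 1, by positivity, fun ρ hρ => ?_⟩
  set P : ℝ := (1 + L * ρ) ^ b * Real.exp (q * L * ρ) with hP
  have hP0 : 0 ≤ P := by positivity
  have hpt : ∀ r ∈ Icc 0 ρ, r ^ (n - 1) * F (L ^ 2 * r ^ 2) ^ q
      ≤ D * P * Real.exp (-(q / 2 * L * (ρ - r))) := fun r hr => by
    have hr0 : 0 ≤ r := hr.1
    have hLr : 0 ≤ L * r := by positivity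
    have h1 : F (L ^ 2 * r ^ 2) ^ q
        ≤ C ^ q * ((1 + L * r) ^ (-((n : ℝ) - 1) / 2 * q) * Real.exp (L * r * q)) := by
      rw [← mul_pow, Real.rpow_mul (by positivity), Real.exp_mul,
        ← Real.mul_rpow (by positivity) (by positivity),
        ← Real.mul_rpow hC.le (by positivity)]
      have := hF1 ((L * r) ^ 2) (by positivity)
      exact Real.rpow_le_rpow (by linarith) (hFC _ hLr) hq.le
    have h2 : r ^ (n - 1) ≤ (L ^ (n - 1))⁻¹ * (1 + L * r) ^ ((n : ℝ) - 1) := by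
      rw [← hcast, Real.rpow_natCast, inv_mul_eq_div, le_div_iff₀ (by positivity), ← mul_pow]
      have : r * L ≤ 1 + L * r := by linarith
      gcongr
    have h3 : (1 + L * r) ^ b ≤ (1 + L * ρ) ^ b * (K * Real.exp (q / 2 * (L * ρ - L * r))) := by
      have hle : L * r ≤ L * ρ := by gcongr; exact hr.2
      refine (one_add_rpow_le_mul b hLr hle).trans ?_
      gcongr
      exact hKle _ (by linarith)
    have hbe : (1 + L * r) ^ ((n : ℝ) - 1) * (1 + L * r) ^ (-((n : ℝ) - 1) / 2 * q)
        = (1 + L * r) ^ b := by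
      rw [← Real.rpow_add (by positivity)]; congr 1; rw [hb]; ring
    have hF0 : 0 ≤ F (L ^ 2 * r ^ 2) ^ q := Real.rpow_nonneg
      (le_trans zero_le_one (hF1 _ (by positivity))) _
    calc r ^ (n - 1) * F (L ^ 2 * r ^ 2) ^ q
        ≤ ((L ^ (n - 1))⁻¹ * (1 + L * r) ^ ((n : ℝ) - 1)) *
          (C ^ q * ((1 + L * r) ^ (-((n : ℝ) - 1) / 2 * q) * Real.exp (L * r * q))) := by
          gcongr
      _ = C ^ q * (L ^ (n - 1))⁻¹ * (1 + L * r) ^ b * Real.exp (L * r * q) := by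
          rw [← hbe]; ring
      _ ≤ C ^ q * (L ^ (n - 1))⁻¹ * ((1 + L * ρ) ^ b *
          (K * Real.exp (q / 2 * (L * ρ - L * r)))) * Real.exp (L * r * q) := by gcongr
      _ = D * (1 + L * ρ) ^ b * (Real.exp (q / 2 * (L * ρ - L * r)) * Real.exp (L * r * q)) := by
          rw [hD]; ring
      _ = D * P * Real.exp (-(q / 2 * L * (ρ - r))) := by
          rw [hP, ← Real.exp_add, ← mul_assoc, mul_assoc _ (Real.exp _), ← Real.exp_add]
          congr 2
          ring
  have hcont : Continuous fun r => r ^ (n - 1) * F (L ^ 2 * r ^ 2) ^ q :=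
    (by fun_prop : Continuous fun r : ℝ => r ^ (n - 1)).mul
      ((hF.comp (by fun_prop : Continuous fun r : ℝ => L ^ 2 * r ^ 2)).rpow_const
        fun _ => Or.inr hq.le)
  have hI : ∫ r in (0 : ℝ)..ρ, r ^ (n - 1) * F (L ^ 2 * r ^ 2) ^ q
      ≤ D * P * (1 / (q / 2 * L)) := by
    refine (intervalIntegral.integral_mono_on hρ (hcont.intervalIntegrable _ _)
      (Continuous.intervalIntegrable (by fun_prop) _ _) hpt).trans ?_
    rw [intervalIntegral.integral_const_mul]
    gcongr
    exact integral_exp_le hqL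
  rw [setIntegral_closedBall_fun_norm hn (fun r => F (L ^ 2 * r ^ 2) ^ q) hρ]
  calc n * (vol1 * ∫ r in (0 : ℝ)..ρ, r ^ (n - 1) * F (L ^ 2 * r ^ 2) ^ q)
      ≤ n * (vol1 * (D * P * (1 / (q / 2 * L)))) := by gcongr
    _ = n * (vol1 * (D * (1 / (q / 2 * L)))) * P := by ring
    _ ≤ _ := by gcongr; linarith

/-- Hölder's inequality for a function supported in a ball. -/
theorem abs_integral_mul_rpow_le {p q ρ : ℝ} (hpq : p.HolderConjugate q) {v Φ : 𝔼 → ℝ}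
    (hv : AEStronglyMeasurable v volume) (hvp : Integrable fun x => |v x| ^ p)
    (hsupp : ∀ᵐ x, ρ < ‖x‖ → v x = 0) (hΦ : Continuous Φ) (hΦ0 : ∀ x, 0 ≤ Φ x) :
    |∫ x, v x * Φ x| ^ p ≤ (∫ x, |v x| ^ p) *
      (∫ x in Metric.closedBall (0 : 𝔼) ρ, Φ x ^ q) ^ (p - 1) := by
  set B := Metric.closedBall (0 : 𝔼) ρ
  have hB : MeasurableSet B := Metric.isClosed_closedBall.measurableSet
  have hBc : IsCompact B := isCompact_closedBall 0 ρ
  have h1 : ∫ x, v x * Φ x = ∫ x in B, v x * Φ x := by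
    refine (setIntegral_eq_integral_of_ae_compl_eq_zero ?_).symm
    filter_upwards [hsupp] with x hx hxB
    rw [hx (by simpa [B] using hxB), zero_mul]
  have hmem : MemLp (fun x => |v x|) (ENNReal.ofReal p) (volume.restrict B) := by
    refine (integrable_norm_rpow_iff (f := fun x => |v x|) hv.norm.restrict
      (by simpa using hpq.pos) ENNReal.ofReal_ne_top).1 ?_
    rw [ENNReal.toReal_ofReal hpq.nonneg]
    simpa using hvp.restrict
  have hmemΦ : MemLp Φ (ENNReal.ofReal q) (volume.restrict B) := by
    rw [← integrable_norm_rpow_iff hΦ.aestronglyMeasurable (by simpa using hpq.symm.pos)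
      ENNReal.ofReal_ne_top, ENNReal.toReal_ofReal hpq.symm.nonneg]
    exact ((hΦ.norm.rpow_const fun _ => Or.inr hpq.symm.nonneg).continuousOn).integrableOn_compact
      hBc
  have h2 := integral_mul_le_Lp_mul_Lq_of_nonneg hpq
    (Eventually.of_forall fun x => abs_nonneg (v x)) (Eventually.of_forall hΦ0) hmem hmemΦ
  have hIp : 0 ≤ ∫ x in B, |v x| ^ p :=
    integral_nonneg fun x => Real.rpow_nonneg (abs_nonneg _) _
  have hIq : 0 ≤ ∫ x in B, Φ x ^ q := integral_nonneg fun x => Real.rpow_nonneg (hΦ0 x) _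
  have h3 : |∫ x in B, v x * Φ x| ≤ ∫ x in B, |v x| * Φ x := by
    refine (abs_integral_le_integral_abs).trans (le_of_eq ?_)
    refine integral_congr_ae (Eventually.of_forall fun x => ?_)
    simp only [abs_mul, abs_of_nonneg (hΦ0 x)]
  rw [h1]
  calc |∫ x in B, v x * Φ x| ^ p
      ≤ ((∫ x in B, |v x| ^ p) ^ (1 / p) * (∫ x in B, Φ x ^ q) ^ (1 / q)) ^ p :=
        Real.rpow_le_rpow (abs_nonneg _) (h3.trans h2) hpq.nonneg
    _ = (∫ x in B, |v x| ^ p) * (∫ x in B, Φ x ^ q) ^ (p - 1) := by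
        rw [Real.mul_rpow (Real.rpow_nonneg hIp _) (Real.rpow_nonneg hIq _),
          ← Real.rpow_mul hIp, ← Real.rpow_mul hIq, one_div_mul_cancel hpq.ne_zero,
          Real.rpow_one]
        congr 2
        have h4 := hpq.inv_add_inv_eq_one
        have h5 := hpq.ne_zero
        have h6 : q⁻¹ = 1 - p⁻¹ := by linarith
        rw [one_div, h6, sub_mul, inv_mul_cancel₀ h5, one_mul]
    _ ≤ _ := by
        gcongr
        · exact Eventually.of_forall fun x => Real.rpow_nonneg (abs_nonneg _) _
        · exact Measure.restrict_le_self

end RadialIntegral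

/-! ### Weighted functionals of a weak solution -/

section Functional

variable {n : ℕ}

local notation "𝔼" => EuclideanSpace ℝ (Fin n)

/-- By finite speed of propagation only the values of `Φ` on a ball matter up to a given time, so a
noncompactly supported `Φ` can be tested through such a `ψ`. -/
theorem exists_spatial_cutoff {Φ : 𝔼 → ℝ} (hΦ : ContDiff ℝ ∞ Φ) {ρ : ℝ} (hρ : 0 < ρ) :
    ∃ ψ : 𝔼 → ℝ, ContDiff ℝ ∞ ψ ∧ HasCompactSupport ψ ∧
      ∀ x, ‖x‖ ≤ ρ → ψ x = Φ x ∧ lap ψ x = lap Φ x := by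
  let B : ContDiffBump (0 : 𝔼) :=
    { rIn := ρ + 1, rOut := ρ + 2, rIn_pos := by linarith, rIn_lt_rOut := by linarith }
  refine ⟨fun x => B x * Φ x, B.contDiff.mul hΦ, B.hasCompactSupport.mul_right, fun x hx => ?_⟩
  have heq : (fun x => B x * Φ x) =ᶠ[𝓝 x] Φ := by
    have : Metric.ball (0 : 𝔼) (ρ + 1) ∈ 𝓝 x :=
      Metric.isOpen_ball.mem_nhds (by simp; linarith)
    filter_upwards [this] with y hy
    rw [B.one_of_mem_closedBall (Metric.ball_subset_closedBall hy), one_mul]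
  refine ⟨heq.eq_of_nhds, Finset.sum_congr rfl fun i _ => ?_⟩
  have h2 : (fun y => fderiv ℝ (fun x => B x * Φ x) y (EuclideanSpace.single i 1))
      =ᶠ[𝓝 x] fun y => fderiv ℝ Φ y (EuclideanSpace.single i 1) := by
    filter_upwards [heq.fderiv (𝕜 := ℝ)] with y hy
    rw [hy]
  rw [h2.fderiv_eq]

theorem integral_mul_congr_of_ae_zero {v ψ Φ : 𝔼 → ℝ} {ρ : ℝ}
    (hv : ∀ᵐ x, ρ < ‖x‖ → v x = 0) (h : ∀ x, ‖x‖ ≤ ρ → ψ x = Φ x) :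
    (fun x => v x * ψ x) =ᵐ[volume] fun x => v x * Φ x := by
  filter_upwards [hv] with x hx
  rcases le_or_gt ‖x‖ ρ with hle | hlt
  · rw [h x hle]
  · rw [hx hlt, zero_mul, zero_mul]

theorem phiEll_nonneg {ℓ t : ℝ} (hℓ : -1 < ℓ) (ht : 0 ≤ t) : 0 ≤ phiEll ℓ t :=
  div_nonneg (Real.rpow_nonneg ht _) (by linarith)

theorem phiEll_mono {ℓ s t : ℝ} (hℓ : -1 < ℓ) (hs : 0 ≤ s) (hst : s ≤ t) :
    phiEll ℓ s ≤ phiEll ℓ t :=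
  div_le_div_of_nonneg_right (Real.rpow_le_rpow hs hst (by linarith)) (by linarith)

theorem IsWeakSolution.locallyIntegrable {ℓ μ ν p R ε : ℝ} {u₀ u₁ : 𝔼 → ℝ} {T : EReal}
    {u : ℝ → 𝔼 → ℝ} (h : IsWeakSolution ℓ μ ν p R ε u₀ u₁ T u) {s : ℝ} (hs : 1 ≤ s)
    (hsT : (s : EReal) < T) : LocallyIntegrable (u s) volume := by
  obtain ⟨ut, Du, hu, -⟩ := h
  exact hu.1 s ⟨hs, hsT⟩

theorem IsWeakSolution.ae_eq_zero {ℓ μ ν p R ε : ℝ} {u₀ u₁ : 𝔼 → ℝ} {T : EReal}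
    {u : ℝ → 𝔼 → ℝ} (h : IsWeakSolution ℓ μ ν p R ε u₀ u₁ T u) (hℓ : -1 < ℓ)
    (hu₀ : ∀ᵐ x, R < ‖x‖ → u₀ x = 0) {s : ℝ} (hs : 1 ≤ s) (hsT : (s : EReal) < T) :
    ∀ᵐ x, R + phiEll ℓ s < ‖x‖ → u s x = 0 := by
  obtain ⟨ut, Du, -, -, -, -, -, -, h0, hsupp, -⟩ := h
  rcases hs.eq_or_lt with rfl | hs1
  · filter_upwards [h0, hu₀] with x hx hx0 hlt
    rw [hx, hx0 (by linarith [phiEll_nonneg hℓ zero_le_one]), mul_zero]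
  · filter_upwards [hsupp s hs1 hsT] with x hx hlt
    exact hx (by linarith [phiEll_nonneg hℓ zero_le_one])

theorem ae_abs_rpow_eq_zero {v : 𝔼 → ℝ} {ρ p : ℝ} (hp : p ≠ 0) (hv : ∀ᵐ x, ρ < ‖x‖ → v x = 0) :
    ∀ᵐ x, ρ < ‖x‖ → |v x| ^ p = 0 := by
  filter_upwards [hv] with x hx hlt
  rw [hx hlt, abs_zero, Real.zero_rpow hp]

/-- The identity satisfied by `s ^ r₁ ∫ u(s) Φ` when `ΔΦ = c Φ`. -/
theorem IsWeakSolution.weighted_identity {ℓ μ ν p R ε r₁ r₂ c : ℝ} {u₀ u₁ : 𝔼 → ℝ} {T : EReal}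
    {u : ℝ → 𝔼 → ℝ} (h : IsWeakSolution ℓ μ ν p R ε u₀ u₁ T u) (hℓ : -1 < ℓ) (hp : p ≠ 0)
    (hR : 0 < R) (hu₀ : ∀ᵐ x, R < ‖x‖ → u₀ x = 0) (hu₁ : ∀ᵐ x, R < ‖x‖ → u₁ x = 0)
    (hsum : r₁ + r₂ = μ - 1) (hprod : r₁ * r₂ = ν ^ 2) {t : ℝ} (htT : (t : EReal) < T)
    {Φ : 𝔼 → ℝ} (hΦ : ContDiff ℝ ∞ Φ) (hlap : ∀ x, lap Φ x = c * Φ x) (ht : 1 < t) :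
    ∃ W' : ℝ → ℝ,
      (∀ s ∈ Icc 1 t,
        HasDerivWithinAt (fun s => s ^ r₁ * ∫ x, u s x * Φ x) (W' s) (Icc 1 t) s) ∧
      (∀ᵐ s ∂volume.restrict (Ioc 1 t), Integrable fun x => |u s x| ^ p * Φ x) ∧
      IntervalIntegrable (fun s => s ^ (r₂ + 1) * ∫ x, |u s x| ^ p * Φ x) volume 1 t ∧
      ∀ y ∈ Ioc 1 t, y ^ (1 + r₂ - r₁) * W' y
        = ε * ((∫ x, u₁ x * Φ x) + r₁ * ∫ x, u₀ x * Φ x)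
          + (∫ s in (1 : ℝ)..y, c * s ^ (1 + r₂ - r₁ + 2 * ℓ) * (s ^ r₁ * ∫ x, u s x * Φ x))
          + ∫ s in (1 : ℝ)..y, s ^ (r₂ + 1) * ∫ x, |u s x| ^ p * Φ x := by
  have hφt := phiEll_nonneg hℓ (by linarith : (0 : ℝ) ≤ t)
  obtain ⟨ψ, hψ, hψc, hψΦ⟩ := exists_spatial_cutoff hΦ (by linarith : 0 < R + phiEll ℓ t)
  have hsuppR : ∀ v : 𝔼 → ℝ, (∀ᵐ x, R < ‖x‖ → v x = 0) →
      ∀ᵐ x, R + phiEll ℓ t < ‖x‖ → v x = 0 := fun v hv => by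
    filter_upwards [hv] with x hx hlt
    exact hx (by linarith)
  have hsuppu : ∀ s ∈ Icc 1 t, ∀ᵐ x, R + phiEll ℓ t < ‖x‖ → u s x = 0 := fun s hs => by
    filter_upwards [h.ae_eq_zero hℓ hu₀ hs.1 (Icc_subset_timeInterval htT hs).2] with x hx hlt
    exact hx (by linarith [phiEll_mono hℓ (by linarith [hs.1]) hs.2])
  have hψ1 := fun x hx => (hψΦ x hx).1
  have eV : ∀ s ∈ Icc 1 t, ∫ x, u s x * Φ x = ∫ x, u s x * ψ x := fun s hs =>
    (integral_congr_ae (integral_mul_congr_of_ae_zero (hsuppu s hs) hψ1)).symm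
  have eL : ∀ s ∈ Icc 1 t, ∫ x, u s x * lap ψ x = c * ∫ x, u s x * Φ x := fun s hs => by
    rw [← integral_const_mul]
    refine integral_congr_ae ((integral_mul_congr_of_ae_zero (Φ := lap Φ) (hsuppu s hs)
      fun x hx => (hψΦ x hx).2).trans (Eventually.of_forall fun x => ?_))
    simp only [hlap]
    ring
  have eNae : ∀ s ∈ Icc 1 t, (fun x => |u s x| ^ p * ψ x) =ᵐ[volume] fun x => |u s x| ^ p * Φ x :=
    fun s hs => integral_mul_congr_of_ae_zero (ae_abs_rpow_eq_zero hp (hsuppu s hs)) hψ1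
  have e0 : ∫ x, u₀ x * ψ x = ∫ x, u₀ x * Φ x :=
    integral_congr_ae (integral_mul_congr_of_ae_zero (hsuppR _ hu₀) hψ1)
  have e1 : ∫ x, u₁ x * ψ x = ∫ x, u₁ x * Φ x :=
    integral_congr_ae (integral_mul_congr_of_ae_zero (hsuppR _ hu₁) hψ1)
  obtain ⟨ut, Du, hu, hDu, hgrad, hut, hd, -, h0, -, hid⟩ := h
  have hI := Icc_subset_timeInterval htT
  have hen := fun (y : ℝ) (hy : y ∈ Ioc 1 t) =>
    energy_identity (r₁ := r₁) (r₂ := r₂) hu hDu hgrad hut hd h0 hsum hprod hy.1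
      (hI (Ioc_subset_Icc_self hy)).2 (hid y hy.1 (hI (Ioc_subset_Icc_self hy)).2) hψ hψc
  have hpos : ∀ s ∈ Icc 1 t, (0 : ℝ) < s := fun s hs => by linarith [hs.1]
  -- The product rule; multiplied by `s ^ (1 + r₂ - r₁)` this derivative becomes the left side of
  -- `energy_identity`.
  refine ⟨fun s => r₁ * s ^ (r₁ - 1) * (∫ x, u s x * ψ x) + s ^ r₁ * ∫ x, ut s x * ψ x,
    fun s hs => ?_, ?_, ?_, fun y hy => ?_⟩
  · have h1 := (Real.hasDerivAt_rpow_const (x := s) (p := r₁)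
      (Or.inl (hpos s hs).ne')).hasDerivWithinAt (s := Icc 1 t)
    have h2 := (hd.hasDerivWithinAt_integral_mul hu.1 hut.1 hψ.continuous hψc (hI hs)).mono hI
    exact (h1.mul h2).congr (fun r hr => by rw [eV r hr]; rfl) (by rw [eV s hs]; rfl)
  · filter_upwards [(hen t ⟨ht, le_rfl⟩).1, ae_restrict_mem measurableSet_Ioc] with s hs hs'
    exact hs.congr (eNae s (Ioc_subset_Icc_self hs'))
  · refine (hen t ⟨ht, le_rfl⟩).2.1.congr fun s hs => ?_
    rw [uIoc_of_le ht.le] at hs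
    rw [integral_congr_ae (eNae s (Ioc_subset_Icc_self hs))]
  · have hyI := Ioc_subset_Icc_self hy
    have hy0 := hpos y hyI
    have hsub : uIcc 1 y ⊆ Icc 1 t := by
      rw [uIcc_of_le hy.1.le]; exact Icc_subset_Icc_right hy.2
    have hid := (hen y hy).2.2
    rw [e0, e1] at hid
    have hN : ∫ s in (1 : ℝ)..y, s ^ (r₂ + 1) * ∫ x, |u s x| ^ p * ψ x
        = ∫ s in (1 : ℝ)..y, s ^ (r₂ + 1) * ∫ x, |u s x| ^ p * Φ x :=
      intervalIntegral.integral_congr fun s hs => by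
        rw [integral_congr_ae (eNae s (hsub hs))]
    have hL : ∫ s in (1 : ℝ)..y, s ^ (r₂ + 1) * (s ^ (2 * ℓ) * ∫ x, u s x * lap ψ x)
        = ∫ s in (1 : ℝ)..y, c * s ^ (1 + r₂ - r₁ + 2 * ℓ) * (s ^ r₁ * ∫ x, u s x * Φ x) :=
      intervalIntegral.integral_congr fun s hs => by
        have hs0 := hpos s (hsub hs)
        rw [eL s (hsub hs)]
        have : s ^ (r₂ + 1) * s ^ (2 * ℓ) = s ^ (1 + r₂ - r₁ + 2 * ℓ) * s ^ r₁ := by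
          rw [← Real.rpow_add hs0, ← Real.rpow_add hs0]; congr 1; ring
        linear_combination c * (∫ x, u s x * Φ x) * this
    rw [hN, hL] at hid
    have f1 : y ^ (1 + r₂ - r₁) * y ^ (r₁ - 1) = y ^ r₂ := by
      rw [← Real.rpow_add hy0]; congr 1; ring
    have f2 : y ^ (1 + r₂ - r₁) * y ^ r₁ = y ^ (r₂ + 1) := by
      rw [← Real.rpow_add hy0]; congr 1; ring
    linear_combination hid + r₁ * (∫ x, u y x * ψ x) * f1 + (∫ x, ut y x * ψ x) * f2

end Functional

/-! ### Lower bounds for the nonlinear term -/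

section LowerBounds

variable {n : ℕ}

local notation "𝔼" => EuclideanSpace ℝ (Fin n)

theorem rpow_le_of_comparable {x y c₁ c₂ : ℝ} (b : ℝ) (hc₁ : 0 < c₁) (hy : 0 < y)
    (h1 : c₁ * y ≤ x) (h2 : x ≤ c₂ * y) : x ^ b ≤ (c₁ ^ b + c₂ ^ b) * y ^ b := by
  have hx : 0 < x := (mul_pos hc₁ hy).trans_le h1
  have hc₂ : 0 < c₂ := pos_of_mul_pos_left (hx.trans_le h2) hy.le
  rw [add_mul, ← Real.mul_rpow hc₁.le hy.le, ← Real.mul_rpow hc₂.le hy.le]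
  rcases le_total 0 b with hb | hb
  · have h3 : x ^ b ≤ (c₂ * y) ^ b := Real.rpow_le_rpow hx.le h2 hb
    have h4 : 0 ≤ (c₁ * y) ^ b := by positivity
    linarith
  · have h3 : x ^ b ≤ (c₁ * y) ^ b := Real.rpow_le_rpow_of_nonpos (by positivity) h1 hb
    have h4 : 0 ≤ (c₂ * y) ^ b := by positivity
    linarith

/-- Hölder's inequality against the constant `1`: the support has radius at most `M s ^ (ℓ + 1)`,
hence volume `O(s ^ (n (ℓ + 1)))`. -/
theorem exists_volume_lower_bound {ℓ p R : ℝ} (hℓ : -1 < ℓ) (hp : 1 < p) (hR : 0 < R) :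
    ∃ c : ℝ, 0 < c ∧ ∀ (s : ℝ) (v : 𝔼 → ℝ), 1 ≤ s → AEStronglyMeasurable v volume →
      (Integrable fun x => |v x| ^ p) → (∀ᵐ x, R + phiEll ℓ s < ‖x‖ → v x = 0) →
      c * s ^ (-(n * (ℓ + 1) * (p - 1))) * |∫ x, v x| ^ p ≤ ∫ x, |v x| ^ p := by
  have hℓ1 : 0 < ℓ + 1 := by linarith
  set vol1 : ℝ := volume.real (Metric.ball (0 : 𝔼) 1)
  have hvol : 0 < vol1 :=
    ENNReal.toReal_pos (Metric.measure_ball_pos _ _ one_pos).ne' measure_ball_lt_top.ne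
  set M : ℝ := R + 1 / (ℓ + 1) with hM
  have hM0 : 0 < M := by positivity
  refine ⟨((M ^ n * vol1) ^ (p - 1))⁻¹, by positivity, fun s v hs hv hvp hsupp => ?_⟩
  have hs0 : 0 < s := by linarith
  have hs1 : 1 ≤ s ^ (ℓ + 1) := Real.one_le_rpow hs hℓ1.le
  have hφ := phiEll_nonneg hℓ hs0.le
  have hρ : R + phiEll ℓ s ≤ M * s ^ (ℓ + 1) := by
    have h1 : R ≤ R * s ^ (ℓ + 1) := le_mul_of_one_le_right hR.le hs1
    have h2 : phiEll ℓ s = 1 / (ℓ + 1) * s ^ (ℓ + 1) := by rw [phiEll]; ring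
    rw [hM, add_mul]
    linarith
  have hH := abs_integral_mul_rpow_le (Real.HolderConjugate.conjExponent hp) hv hvp hsupp
    (continuous_const (y := (1 : ℝ))) fun _ => zero_le_one
  simp only [mul_one, Real.one_rpow] at hH
  have hv2 : ∫ _ in Metric.closedBall (0 : 𝔼) (R + phiEll ℓ s), (1 : ℝ)
      ≤ M ^ n * vol1 * s ^ (n * (ℓ + 1)) := by
    rw [setIntegral_const, smul_eq_mul, mul_one,
      Measure.addHaar_real_closedBall _ _ (by positivity), finrank_euclideanSpace,
      Fintype.card_fin]
    have h3 : s ^ (n * (ℓ + 1)) = (s ^ (ℓ + 1)) ^ n := by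
      rw [mul_comm, Real.rpow_mul_natCast hs0.le]
    calc (R + phiEll ℓ s) ^ n * vol1 ≤ (M * s ^ (ℓ + 1)) ^ n * vol1 := by gcongr
      _ = _ := by rw [h3, mul_pow]; ring
  have hN : 0 ≤ ∫ x, |v x| ^ p := integral_nonneg fun x => Real.rpow_nonneg (abs_nonneg _) _
  have h4 : (∫ _ in Metric.closedBall (0 : 𝔼) (R + phiEll ℓ s), (1 : ℝ)) ^ (p - 1)
      ≤ (M ^ n * vol1) ^ (p - 1) * s ^ (n * (ℓ + 1) * (p - 1)) := by
    rw [Real.rpow_mul hs0.le, ← Real.mul_rpow (by positivity) (by positivity)]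
    exact Real.rpow_le_rpow (integral_nonneg fun _ => zero_le_one) hv2 (by linarith)
  have h5 := hH.trans (mul_le_mul_of_nonneg_left h4 hN)
  rw [Real.rpow_neg hs0.le, ← mul_inv, inv_mul_le_iff₀ (by positivity)]
  linarith

/-- Hölder's inequality against `Φ`. Since `q (p - 1) = p` for the conjugate exponent, the growth of
`∫ Φ ^ q` over the support contributes exactly `exp(L φ_ℓ(s)) ^ p`, which the exponential factor on
the left removes; only a power of `s` survives. -/
theorem exists_eigenfunction_lower_bound (hn : 1 ≤ n) {ℓ p R L C : ℝ} (hℓ : -1 < ℓ) (hp : 1 < p)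
    (hR : 0 < R) (hL : 0 < L) (hC : 0 < C) {F : ℝ → ℝ} (hF : Continuous F)
    (hF1 : ∀ z, 0 ≤ z → 1 ≤ F z)
    (hFC : ∀ r, 0 ≤ r → F (r ^ 2) ≤ C * ((1 + r) ^ (-((n : ℝ) - 1) / 2) * Real.exp r)) :
    ∃ c : ℝ, 0 < c ∧ ∀ (s : ℝ) (v : 𝔼 → ℝ), 1 ≤ s → AEStronglyMeasurable v volume →
      (Integrable fun x => |v x| ^ p) → (∀ᵐ x, R + phiEll ℓ s < ‖x‖ → v x = 0) →
      c * s ^ (-((ℓ + 1) * ((n : ℝ) - 1) * (p / 2 - 1))) *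
        (|∫ x, v x * F (L ^ 2 * ‖x‖ ^ 2)| * Real.exp (-(L * phiEll ℓ s))) ^ p
        ≤ ∫ x, |v x| ^ p := by
  have hℓ1 : 0 < ℓ + 1 := by linarith
  have hpq := Real.HolderConjugate.conjExponent hp
  set q := p.conjExponent with hq
  have hq0 : 0 < q := hpq.symm.pos
  have hqp : q * (p - 1) = p := by
    have : p - 1 ≠ 0 := by linarith
    rw [hq, Real.conjExponent]; field_simp
  obtain ⟨C', hC', hint⟩ := exists_radial_integral_bound hn hF hF1 hC hL hq0 hFC
  set b : ℝ := ((n : ℝ) - 1) * (1 - q / 2) with hb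
  have hbp : (ℓ + 1) * b * (p - 1) = (ℓ + 1) * ((n : ℝ) - 1) * (p / 2 - 1) := by
    rw [hb]
    linear_combination (-(ℓ + 1) * ((n : ℝ) - 1) / 2) * hqp
  set c₁ : ℝ := L / (ℓ + 1) with hc₁
  set c₂ : ℝ := 1 + L * R + L / (ℓ + 1) with hc₂
  have hc₁0 : 0 < c₁ := by positivity
  have hc₂0 : 0 < c₂ := by positivity
  set D : ℝ := C' * (c₁ ^ b + c₂ ^ b) * Real.exp (q * L * R) with hD
  have hD0 : 0 < D := by positivity
  refine ⟨(D ^ (p - 1))⁻¹, by positivity, fun s v hs hv hvp hsupp => ?_⟩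
  have hs0 : 0 < s := by linarith
  have hs1 : 1 ≤ s ^ (ℓ + 1) := Real.one_le_rpow hs hℓ1.le
  have hφ := phiEll_nonneg hℓ hs0.le
  have hφe : L * phiEll ℓ s = L / (ℓ + 1) * s ^ (ℓ + 1) := by rw [phiEll]; ring
  set ρ := R + phiEll ℓ s with hρ
  have hH := abs_integral_mul_rpow_le (Φ := fun x => F (L ^ 2 * ‖x‖ ^ 2)) hpq hv hvp hsupp
    (hF.comp (by fun_prop)) fun x => zero_le_one.trans (hF1 _ (by positivity))
  have hcomp : (1 + L * ρ) ^ b ≤ (c₁ ^ b + c₂ ^ b) * s ^ ((ℓ + 1) * b) := by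
    rw [Real.rpow_mul hs0.le]
    refine rpow_le_of_comparable b hc₁0 (by positivity) ?_ ?_
    · rw [hρ, mul_add, hφe]
      have : 0 < L * R := by positivity
      linarith
    · rw [hρ, mul_add, hφe, hc₂, add_mul]
      have : 1 + L * R ≤ (1 + L * R) * s ^ (ℓ + 1) := le_mul_of_one_le_right (by positivity) hs1
      linarith
  have hQ : ∫ x in Metric.closedBall (0 : 𝔼) ρ, F (L ^ 2 * ‖x‖ ^ 2) ^ q
      ≤ D * s ^ ((ℓ + 1) * b) * Real.exp (L * phiEll ℓ s * q) := by
    refine (hint ρ (by positivity)).trans ?_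
    have he : Real.exp (q * L * ρ) = Real.exp (q * L * R) * Real.exp (L * phiEll ℓ s * q) := by
      rw [← Real.exp_add, hρ]; congr 1; ring
    rw [he]
    calc C' * ((1 + L * ρ) ^ b * (Real.exp (q * L * R) * Real.exp (L * phiEll ℓ s * q)))
        ≤ C' * (((c₁ ^ b + c₂ ^ b) * s ^ ((ℓ + 1) * b)) *
          (Real.exp (q * L * R) * Real.exp (L * phiEll ℓ s * q))) := by gcongr
      _ = _ := by rw [hD]; ring
  have hN : 0 ≤ ∫ x, |v x| ^ p := integral_nonneg fun x => Real.rpow_nonneg (abs_nonneg _) _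
  have h4 : (∫ x in Metric.closedBall (0 : 𝔼) ρ, F (L ^ 2 * ‖x‖ ^ 2) ^ q) ^ (p - 1)
      ≤ D ^ (p - 1) * s ^ ((ℓ + 1) * ((n : ℝ) - 1) * (p / 2 - 1)) *
        Real.exp (L * phiEll ℓ s) ^ p := by
    have h0 : 0 ≤ ∫ x in Metric.closedBall (0 : 𝔼) ρ, F (L ^ 2 * ‖x‖ ^ 2) ^ q :=
      integral_nonneg fun x =>
        Real.rpow_nonneg (zero_le_one.trans (hF1 _ (by positivity))) _
    refine (Real.rpow_le_rpow h0 hQ (by linarith)).trans (le_of_eq ?_)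
    rw [Real.mul_rpow (by positivity) (by positivity), Real.mul_rpow hD0.le (by positivity),
      ← Real.rpow_mul hs0.le, hbp, Real.exp_mul, ← Real.rpow_mul (by positivity), hqp]
  have h5 := hH.trans (mul_le_mul_of_nonneg_left h4 hN)
  rw [Real.mul_rpow (abs_nonneg _) (by positivity), Real.rpow_neg hs0.le, ← mul_inv,
    inv_mul_le_iff₀ (by positivity), Real.exp_neg, Real.inv_rpow (by positivity),
    mul_inv_le_iff₀ (by positivity)]
  linarith

theorem integrable_mul_of_ae_zero {v Φ : 𝔼 → ℝ} {ρ : ℝ} (hv : LocallyIntegrable v volume)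
    (hsupp : ∀ᵐ x, ρ < ‖x‖ → v x = 0) (hρ : 0 < ρ) (hΦ : ContDiff ℝ ∞ Φ) :
    Integrable fun x => v x * Φ x := by
  obtain ⟨ψ, hψ, hψc, hψΦ⟩ := exists_spatial_cutoff hΦ hρ
  exact (integrable_mul_of_hasCompactSupport hv hψ.continuous hψc).congr
    (integral_mul_congr_of_ae_zero hsupp fun x hx => (hψΦ x hx).1)

theorem integral_mul_pos {v Φ : 𝔼 → ℝ} (hint : Integrable fun x => v x * Φ x)
    (hv : ∀ᵐ x, 0 ≤ v x) (hne : ¬ ∀ᵐ x, v x = 0) (hΦ : ∀ x, 0 < Φ x) :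
    0 < ∫ x, v x * Φ x := by
  have h0 : 0 ≤ᵐ[volume] fun x => v x * Φ x := by
    filter_upwards [hv] with x hx
    exact mul_nonneg hx (hΦ x).le
  refine lt_of_le_of_ne (integral_nonneg_of_ae h0) fun heq => hne ?_
  filter_upwards [(integral_eq_zero_iff_of_nonneg_ae h0 hint).1 heq.symm] with x hx
  exact (mul_eq_zero.1 hx).resolve_right (hΦ x).ne'

theorem integral_data_nonneg {v w Φ : 𝔼 → ℝ} {r : ℝ} (hv : Integrable fun x => v x * Φ x)
    (hw : Integrable fun x => w x * Φ x) (h : ∀ᵐ x, 0 ≤ w x + r * v x) (hΦ : ∀ x, 0 ≤ Φ x) :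
    0 ≤ (∫ x, w x * Φ x) + r * ∫ x, v x * Φ x := by
  rw [← integral_const_mul, ← integral_add hw (hv.const_mul r)]
  refine integral_nonneg_of_ae ?_
  filter_upwards [h] with x hx
  have := mul_nonneg hx (hΦ x)
  simp only [Pi.zero_apply]
  linarith

/-- The lower bound for the nonlinear term that comes from the exponentially growing
eigenfunction of the Laplacian. -/
theorem exists_nonlinear_lower_bound (hn : 1 ≤ n) {ℓ μ ν p R r₁ r₂ : ℝ} (hℓ : -1 < ℓ)
    (hp : 1 < p) (hR : 0 < R) (hsum : r₁ + r₂ = μ - 1) (hprod : r₁ * r₂ = ν ^ 2)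
    (hr : r₁ ≤ r₂) {u₀ u₁ : 𝔼 → ℝ} (hu₀ : LocallyIntegrable u₀ volume)
    (hu₁ : LocallyIntegrable u₁ volume) (hu₀_nonneg : ∀ᵐ x, 0 ≤ u₀ x)
    (hu₀_nontriv : ¬ ∀ᵐ x, u₀ x = 0) (hu₀_supp : ∀ᵐ x, R < ‖x‖ → u₀ x = 0)
    (hu₁_supp : ∀ᵐ x, R < ‖x‖ → u₁ x = 0) (hdata : ∀ᵐ x, 0 ≤ u₁ x + r₁ * u₀ x) :
    ∃ c : ℝ, 0 < c ∧ ∀ (ε : ℝ) (T : EReal) (u : ℝ → 𝔼 → ℝ), 0 < ε →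
      IsWeakSolution ℓ μ ν p R ε u₀ u₁ T u → ∀ s : ℝ, 1 < s → (s : EReal) < T →
      (Integrable fun x => |u s x| ^ p) →
      c * ε ^ p * s ^ (-((ℓ + μ) / 2 * p) - (ℓ + 1) * ((n : ℝ) - 1) * (p / 2 - 1))
        ≤ ∫ x, |u s x| ^ p := by
  obtain ⟨F, hF, hF1, hode, C, hC, hFC⟩ := exists_radial_profile hn
  obtain ⟨L, hL, c₀, hc₀, hexp⟩ :=
    exists_exponential_lower_bound (a := 1 + r₂ - r₁) hℓ (by linarith)
  obtain ⟨c₁, hc₁, hlow⟩ := exists_eigenfunction_lower_bound (n := n) hn hℓ hp hR hL hC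
    hF.continuous hF1 hFC
  let Φ : 𝔼 → ℝ := fun x => F (L ^ 2 * ‖x‖ ^ 2)
  have hΦ : ContDiff ℝ ∞ Φ := hF.comp (contDiff_const.mul (contDiff_norm_sq ℝ))
  have hΦ0 : ∀ x, 0 < Φ x := fun x => lt_of_lt_of_le one_pos (hF1 _ (by positivity))
  have hlap : ∀ x, lap Φ x = L ^ 2 * Φ x := lap_comp_norm_sq hF hode
  have hi₀ := integrable_mul_of_ae_zero hu₀ hu₀_supp hR hΦ
  have hi₁ := integrable_mul_of_ae_zero hu₁ hu₁_supp hR hΦ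
  set I : ℝ := ∫ x, u₀ x * Φ x with hI
  have hI0 : 0 < I := integral_mul_pos hi₀ hu₀_nonneg hu₀_nontriv hΦ0
  have hdat := integral_data_nonneg hi₀ hi₁ hdata fun x => (hΦ0 x).le
  refine ⟨c₁ * (c₀ * I) ^ p, by positivity, fun ε T u hε hsol t ht htT hint => ?_⟩
  have ht0 : 0 < t := by linarith
  obtain ⟨W', hWd, -, -, hid⟩ := hsol.weighted_identity hℓ (by linarith) hR hu₀_supp hu₁_supp
    hsum hprod htT hΦ hlap ht
  have hW1 : (1 : ℝ) ^ r₁ * ∫ x, u 1 x * Φ x = ε * I := by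
    rw [Real.one_rpow, one_mul, hI, ← integral_const_mul]
    obtain ⟨ut, Du, -, -, -, -, -, -, h0, -⟩ := hsol
    refine integral_congr_ae ?_
    filter_upwards [h0] with x hx
    rw [hx, mul_assoc]
  have hWt := hexp t (fun s => s ^ r₁ * ∫ x, u s x * Φ x) W' ht
    (by simp only [hW1]; positivity) hWd (fun y hy => by
      rw [hid y hy]
      -- The nonlinear and data terms are nonnegative and are dropped, which leaves the linear
      -- inequality of the comparison lemma.
      have hN : 0 ≤ ∫ s in (1 : ℝ)..y, s ^ (r₂ + 1) * ∫ x, |u s x| ^ p * Φ x :=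
        intervalIntegral.integral_nonneg hy.1.le fun s hs => mul_nonneg
          (Real.rpow_nonneg (by linarith [hs.1]) _) (integral_nonneg fun x =>
            mul_nonneg (Real.rpow_nonneg (abs_nonneg _) _) (hΦ0 x).le)
      have := mul_nonneg hε.le hdat
      linarith) t ⟨ht.le, le_rfl⟩
  simp only [hW1] at hWt
  have hbase := hlow t (u t) ht.le (hsol.locallyIntegrable ht.le htT).aestronglyMeasurable hint
    (hsol.ae_eq_zero hℓ hu₀_supp ht.le htT)
  have hV : c₀ * (ε * I) * t ^ (-((ℓ + μ) / 2))
      ≤ |∫ x, u t x * F (L ^ 2 * ‖x‖ ^ 2)| * Real.exp (-(L * phiEll ℓ t)) := by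
    have h1 : t ^ (-r₁) * (c₀ * (ε * I) *
        (Real.exp (L * phiEll ℓ t) * t ^ (-(ℓ + (1 + r₂ - r₁)) / 2)))
        ≤ t ^ (-r₁) * (t ^ r₁ * ∫ x, u t x * Φ x) := by gcongr
    rw [← mul_assoc _ (t ^ r₁), ← Real.rpow_add ht0, neg_add_cancel, Real.rpow_zero,
      one_mul] at h1
    -- Removing the weight `t ^ r₁` turns the rate `(ℓ + a)/2` into `r₁ + (ℓ + 1 + r₂ - r₁)/2 = (ℓ +
    -- μ)/2`.
    have h2 : t ^ (-((ℓ + μ) / 2)) = t ^ (-r₁) * t ^ (-(ℓ + (1 + r₂ - r₁)) / 2) := by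
      rw [← Real.rpow_add ht0]
      congr 1
      linarith
    rw [Real.exp_neg, ← div_eq_mul_inv, le_div_iff₀ (Real.exp_pos _), h2]
    refine le_trans (le_of_eq ?_) (h1.trans (le_abs_self _))
    ring
  refine le_trans ?_ hbase
  have h3 : (c₀ * (ε * I) * t ^ (-((ℓ + μ) / 2))) ^ p
      = (c₀ * I) ^ p * ε ^ p * t ^ (-((ℓ + μ) / 2 * p)) := by
    rw [Real.mul_rpow (by positivity) (by positivity), ← Real.rpow_mul ht0.le,
      ← Real.mul_rpow (by positivity) hε.le]
    congr 2
    · ring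
    · ring
  calc c₁ * (c₀ * I) ^ p * ε ^ p *
        t ^ (-((ℓ + μ) / 2 * p) - (ℓ + 1) * ((n : ℝ) - 1) * (p / 2 - 1))
      = c₁ * t ^ (-((ℓ + 1) * ((n : ℝ) - 1) * (p / 2 - 1))) *
        (c₀ * (ε * I) * t ^ (-((ℓ + μ) / 2))) ^ p := by
        rw [h3, sub_eq_add_neg, Real.rpow_add ht0]
        ring
    _ ≤ _ := by gcongr

end LowerBounds

/-! ### From a lower bound on the mean to a lifespan estimate -/

section Lifespan

/-- Two integrations of a power, each carried out over intervals `[y/2, y]` and `[s/2, s]` only.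
This gives the expected exponent `g + 2 - a` whatever the signs of the exponents involved; `s ≥ 4`
keeps the points used at or above `1`. -/
theorem exists_dyadic_lower_bound (a g : ℝ) :
    ∃ c : ℝ, 0 < c ∧ ∀ (K t : ℝ) (W W' : ℝ → ℝ), 0 < K →
      (∀ s ∈ Icc 1 t, HasDerivWithinAt W (W' s) (Icc 1 t) s) → (∀ s ∈ Icc 1 t, 0 ≤ W s) →
      (∀ x y, 1 ≤ x → x < y → y ≤ t → ∫ s in x..y, K * s ^ g ≤ y ^ a * W' y) →
      ∀ s ∈ Icc 4 t, c * K * s ^ (g + 2 - a) ≤ W s := by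
  set c' : ℝ := 2 ^ (-|g|) * 2 ^ (-|g + 1|) * 4 ^ (-|(-a)|) with hc'
  have hc'0 : 0 < c' := by positivity
  refine ⟨2 * c' * 4 ^ (-(g + 2 - a)), by positivity, fun K t W W' hK hWd hW0 hW s hs => ?_⟩
  set x : ℝ := s / 4 with hx
  have hx1 : 1 ≤ x := by linarith [hs.1]
  have hx0 : 0 < x := by linarith
  have hsx : s = 4 * x := by linarith
  have hsub : Icc (2 * x) (4 * x) ⊆ Icc 1 t := fun y hy =>
    ⟨by linarith [hy.1], by linarith [hy.2, hs.2]⟩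
  set A : ℝ := c' * K * x ^ (g + 1 - a) with hA
  have hder : ∀ y ∈ Icc (2 * x) (4 * x), A ≤ W' y := fun y hy => by
    have hy0 : 0 < y := by linarith [hy.1]
    have h1 := hW (y / 2) y (by linarith [hy.1]) (by linarith) (hsub hy).2
    have h2 : ∫ _ in (y / 2)..y, K * (2 ^ (-|g|) * (y / 2) ^ g) ≤ ∫ s in (y / 2)..y, K * s ^ g := by
      refine intervalIntegral.integral_mono_on (by linarith) (by simp)
        (((continuousOn_const.mul (continuousOn_rpow_Icc g y)).mono
          (Icc_subset_Icc_left (by linarith [hy.1]))).intervalIntegrable_of_Icc (by linarith))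
        fun r hr => ?_
      gcongr
      exact rpow_comparable g (by norm_num) (by linarith) hr.1 (by linarith [hr.2])
    rw [intervalIntegral.integral_const, smul_eq_mul] at h2
    have h3 : (y - y / 2) * (K * (2 ^ (-|g|) * (y / 2) ^ g))
        = K * 2 ^ (-|g|) * (y / 2) ^ (g + 1) := by
      rw [Real.rpow_add_one (by positivity)]; ring
    rw [h3] at h2
    have h4 := rpow_comparable (N := 2) (g + 1) (by norm_num) hx0
      (by linarith [hy.1] : x ≤ y / 2) (by linarith [hy.2])
    have h5 := rpow_comparable (N := 4) (-a) (by norm_num) hx0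
      (by linarith [hy.1] : x ≤ y) hy.2
    have h6 : x ^ (g + 1 - a) = x ^ (-a) * x ^ (g + 1) := by
      rw [← Real.rpow_add hx0]; congr 1; ring
    calc A = (4 ^ (-|(-a)|) * x ^ (-a)) * (K * 2 ^ (-|g|) * (2 ^ (-|g + 1|) * x ^ (g + 1))) := by
          rw [hA, hc', h6]; ring
      _ ≤ y ^ (-a) * (K * 2 ^ (-|g|) * (y / 2) ^ (g + 1)) := by gcongr
      _ ≤ y ^ (-a) * (y ^ a * W' y) := by
          have := h2.trans h1
          gcongr
      _ = W' y := by
          rw [← mul_assoc, ← Real.rpow_add hy0, neg_add_cancel, Real.rpow_zero, one_mul]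
  have hm : MonotoneOn (fun y => W y - A * y) (Icc (2 * x) (4 * x)) := by
    refine monotoneOn_Icc_of_hasDerivAt (f' := fun y => W' y - A * 1)
      (ContinuousOn.sub (fun y hy => ((hWd y (hsub hy)).mono hsub).continuousWithinAt)
        (by fun_prop)) (fun y hy => ?_) fun y hy => ?_
    · have hyI := hsub (Ioo_subset_Icc_self hy)
      exact ((hWd y hyI).hasDerivAt (Icc_mem_nhds (by linarith [hy.1])
        (by linarith [hy.2, hs.2]))).sub ((hasDerivAt_id y).const_mul A)
    · linarith [hder y (Ioo_subset_Icc_self hy)]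
  have h7 := hm ⟨le_rfl, by linarith⟩ ⟨by linarith, le_rfl⟩ (by linarith : 2 * x ≤ 4 * x)
  simp only at h7
  have h8 := hW0 (2 * x) (hsub ⟨le_rfl, by linarith⟩)
  have h9 : (4 : ℝ) ^ (-(g + 2 - a)) * s ^ (g + 2 - a) = x ^ (g + 2 - a) := by
    rw [hsx, Real.mul_rpow (by norm_num) hx0.le, ← mul_assoc, ← Real.rpow_add (by norm_num),
      neg_add_cancel, Real.rpow_zero, one_mul]
  have h10 : x ^ (g + 2 - a) = x ^ (g + 1 - a) * x := by
    rw [← Real.rpow_add_one hx0.ne']; congr 1; ring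
  calc 2 * c' * 4 ^ (-(g + 2 - a)) * K * s ^ (g + 2 - a)
      = 2 * c' * K * (4 ^ (-(g + 2 - a)) * s ^ (g + 2 - a)) := by ring
    _ = A * (2 * x) := by rw [h9, h10, hA]; ring
    _ ≤ W s := by rw [hsx]; linarith

/-- For `ε ≤ 1` the power of `ε` on the right is at least `1`, so the alternative `t ≤ M` is covered
by the same estimate. -/
theorem exists_bound_of_rpow_le {M B k r κ p : ℝ} (hM : 0 < M) (hB : 0 < B) (hk : 0 < k)
    (hκ : 0 < κ) (hr : 0 ≤ r) (hp : 1 < p) :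
    ∃ C : ℝ, 0 < C ∧ ∀ ε t : ℝ, 0 < ε → ε ≤ 1 → 0 < t →
      (t ≤ M ∨ (k * ε ^ r) ^ (p - 1) * (t / 4) ^ κ ≤ B) →
      t ≤ C * ε ^ (-(r * (p - 1) / κ)) := by
  set D : ℝ := 4 * (B / k ^ (p - 1)) ^ (1 / κ) with hD
  have hD0 : 0 < D := by positivity
  refine ⟨M + D, by positivity, fun ε t hε hε1 ht h => ?_⟩
  have he : 1 ≤ ε ^ (-(r * (p - 1) / κ)) :=
    Real.one_le_rpow_of_pos_of_le_one_of_nonpos hε hε1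
      (neg_nonpos.2 (div_nonneg (mul_nonneg hr (by linarith)) hκ.le))
  rcases h with h | h
  · calc t ≤ M * 1 := by linarith
      _ ≤ (M + D) * ε ^ (-(r * (p - 1) / κ)) := by gcongr; linarith
  · rw [Real.mul_rpow hk.le (by positivity), ← Real.rpow_mul hε.le] at h
    have h1 : (t / 4) ^ κ ≤ B / k ^ (p - 1) * ε ^ (-(r * (p - 1))) := by
      rw [Real.rpow_neg hε.le, ← div_eq_mul_inv, div_div, le_div_iff₀ (by positivity)]
      linarith
    have h2 := Real.rpow_le_rpow (by positivity) h1 (by positivity : 0 ≤ 1 / κ)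
    rw [← Real.rpow_mul (by positivity), mul_one_div_cancel hκ.ne', Real.rpow_one,
      Real.mul_rpow (by positivity) (by positivity), ← Real.rpow_mul hε.le,
      show -(r * (p - 1)) * (1 / κ) = -(r * (p - 1) / κ) by ring] at h2
    calc t = 4 * (t / 4) := by ring
      _ ≤ 4 * ((B / k ^ (p - 1)) ^ (1 / κ) * ε ^ (-(r * (p - 1) / κ))) := by gcongr
      _ = D * ε ^ (-(r * (p - 1) / κ)) := by rw [hD]; ring
      _ ≤ _ := by gcongr; linarith

theorem le_coe_of_forall_lt {T : EReal} {X : ℝ} (hT : 1 < T)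
    (h : ∀ t : ℝ, 1 < t → (t : EReal) < T → t ≤ X) : T ≤ (X : EReal) := by
  by_contra hcon
  have hlt : ((max 1 X : ℝ) : EReal) < T := by
    rw [EReal.coe_strictMono.monotone.map_max]
    exact max_lt (by exact_mod_cast hT) (not_le.1 hcon)
  obtain ⟨t, h1, h2⟩ := EReal.lt_iff_exists_real_btwn.1 hlt
  have h1' : max 1 X < t := by exact_mod_cast h1
  exact absurd (h t ((le_max_left _ _).trans_lt h1') h2)
    (not_le.2 ((le_max_right _ _).trans_lt h1'))

variable {n : ℕ}

local notation "𝔼" => EuclideanSpace ℝ (Fin n)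

/-- The properties of the weighted mean `s ^ r₁ ∫ u(s)`. -/
theorem IsWeakSolution.mean_identity {ℓ μ ν p R ε r₁ r₂ : ℝ} {u₀ u₁ : 𝔼 → ℝ} {T : EReal}
    {u : ℝ → 𝔼 → ℝ} (h : IsWeakSolution ℓ μ ν p R ε u₀ u₁ T u) (hℓ : -1 < ℓ) (hp : p ≠ 0)
    (hR : 0 < R) (hu₀ : LocallyIntegrable u₀ volume) (hu₁ : LocallyIntegrable u₁ volume)
    (hu₀_supp : ∀ᵐ x, R < ‖x‖ → u₀ x = 0) (hu₁_supp : ∀ᵐ x, R < ‖x‖ → u₁ x = 0)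
    (hdata : ∀ᵐ x, 0 ≤ u₁ x + r₁ * u₀ x) (hε : 0 < ε)
    (hsum : r₁ + r₂ = μ - 1) (hprod : r₁ * r₂ = ν ^ 2) {t : ℝ} (ht : 1 < t)
    (htT : (t : EReal) < T) :
    ∃ W' : ℝ → ℝ,
      (∀ s ∈ Icc 1 t, HasDerivWithinAt (fun s => s ^ r₁ * ∫ x, u s x) (W' s) (Icc 1 t) s) ∧
      MonotoneOn (fun s => s ^ r₁ * ∫ x, u s x) (Icc 1 t) ∧
      (1 : ℝ) ^ r₁ * ∫ x, u 1 x = ε * ∫ x, u₀ x ∧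
      (∀ᵐ s ∂volume.restrict (Ioc 1 t), Integrable fun x => |u s x| ^ p) ∧
      IntervalIntegrable (fun s => s ^ (r₂ + 1) * ∫ x, |u s x| ^ p) volume 1 t ∧
      ∀ x y, 1 ≤ x → x < y → y ≤ t →
        ∫ s in x..y, s ^ (r₂ + 1) * ∫ x, |u s x| ^ p ≤ y ^ (1 + r₂ - r₁) * W' y := by
  have hΦ : ContDiff ℝ ∞ fun _ : 𝔼 => (1 : ℝ) := contDiff_const
  have hlap : ∀ x, lap (fun _ : 𝔼 => (1 : ℝ)) x = 0 * 1 := fun x => by simp [lap]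
  have hdat := integral_data_nonneg (integrable_mul_of_ae_zero hu₀ hu₀_supp hR hΦ)
    (integrable_mul_of_ae_zero hu₁ hu₁_supp hR hΦ) hdata fun _ => zero_le_one
  obtain ⟨W', hWd, hae, hNi, hid⟩ :=
    h.weighted_identity hℓ hp hR hu₀_supp hu₁_supp hsum hprod htT hΦ hlap ht
  simp only [mul_one, zero_mul, intervalIntegral.integral_zero, add_zero] at hWd hae hNi hid hdat
  have hN0 : ∀ s : ℝ, 1 ≤ s → 0 ≤ s ^ (r₂ + 1) * ∫ x, |u s x| ^ p := fun s hs =>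
    mul_nonneg (Real.rpow_nonneg (by linarith) _)
      (integral_nonneg fun x => Real.rpow_nonneg (abs_nonneg _) _)
  have hεd := mul_nonneg hε.le hdat
  have hWc : ContinuousOn (fun s => s ^ r₁ * ∫ x, u s x) (Icc 1 t) :=
    fun s hs => (hWd s hs).continuousWithinAt
  refine ⟨W', hWd, ?_, ?_, hae, hNi, fun x y hx hxy hyt => ?_⟩
  · refine monotoneOn_Icc_of_hasDerivAt (f' := W') hWc
      (fun s hs => (hWd s (Ioo_subset_Icc_self hs)).hasDerivAt (Icc_mem_nhds hs.1 hs.2))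
      fun s hs => ?_
    have h1 := hid s ⟨hs.1, hs.2.le⟩
    have h2 : 0 ≤ ∫ s in (1 : ℝ)..s, s ^ (r₂ + 1) * ∫ x, |u s x| ^ p :=
      intervalIntegral.integral_nonneg hs.1.le fun r hr => hN0 r hr.1
    have h3 : 0 ≤ s ^ (1 + r₂ - r₁) * W' s := by rw [h1]; linarith
    exact nonneg_of_mul_nonneg_right h3 (Real.rpow_pos_of_pos (by linarith [hs.1]) _)
  · obtain ⟨ut, Du, -, -, -, -, -, -, h0, -⟩ := h
    rw [Real.one_rpow, one_mul, ← integral_const_mul]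
    exact integral_congr_ae h0
  · rw [hid y ⟨by linarith, hyt⟩]
    have hi1 : IntervalIntegrable (fun s => s ^ (r₂ + 1) * ∫ x, |u s x| ^ p) volume 1 x :=
      hNi.mono_set (by rw [uIcc_of_le hx, uIcc_of_le ht.le]; exact Icc_subset_Icc_right (by linarith))
    have hi2 : IntervalIntegrable (fun s => s ^ (r₂ + 1) * ∫ x, |u s x| ^ p) volume x y :=
      hNi.mono_set (by rw [uIcc_of_le hxy.le, uIcc_of_le ht.le]; exact Icc_subset_Icc hx hyt)
    rw [← intervalIntegral.integral_add_adjacent_intervals hi1 hi2]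
    have h2 : 0 ≤ ∫ s in (1 : ℝ)..x, s ^ (r₂ + 1) * ∫ x, |u s x| ^ p :=
      intervalIntegral.integral_nonneg hx fun r hr => hN0 r hr.1
    linarith

/-- If the weighted mean of every solution is at least `k ε ^ r s ^ β` for `s ≥ t₁`, then the
lifespan is bounded. -/
theorem exists_lifespan_of_mean_lower_bound {ℓ μ ν p R r₁ r₂ k r β t₁ : ℝ} (hℓ : -1 < ℓ)
    (hp : 1 < p) (hR : 0 < R) {u₀ u₁ : 𝔼 → ℝ} (hu₀ : LocallyIntegrable u₀ volume)
    (hu₁ : LocallyIntegrable u₁ volume) (hu₀_nonneg : ∀ᵐ x, 0 ≤ u₀ x)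
    (hu₀_supp : ∀ᵐ x, R < ‖x‖ → u₀ x = 0) (hu₁_supp : ∀ᵐ x, R < ‖x‖ → u₁ x = 0)
    (hdata : ∀ᵐ x, 0 ≤ u₁ x + r₁ * u₀ x)
    (hsum : r₁ + r₂ = μ - 1) (hprod : r₁ * r₂ = ν ^ 2) (hk : 0 < k) (hr : 0 ≤ r) (ht₁ : 1 ≤ t₁)
    (hκ : 0 < β * (p - 1) + 2 - ((ℓ + 1) * n + r₁) * (p - 1))
    (hlow : ∀ (ε : ℝ) (T : EReal) (u : ℝ → 𝔼 → ℝ), 0 < ε →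
      IsWeakSolution ℓ μ ν p R ε u₀ u₁ T u → ∀ s : ℝ, t₁ ≤ s → 1 < s → (s : EReal) < T →
      k * ε ^ r * s ^ β ≤ s ^ r₁ * ∫ x, u s x) :
    ∃ C : ℝ, 0 < C ∧ ∀ (ε : ℝ) (T : EReal) (u : ℝ → 𝔼 → ℝ), 0 < ε → ε ≤ 1 → 1 < T →
      IsWeakSolution ℓ μ ν p R ε u₀ u₁ T u →
      T ≤ ((C * ε ^ (-(r * (p - 1) / (β * (p - 1) + 2 - ((ℓ + 1) * n + r₁) * (p - 1)))) : ℝ) :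
        EReal) := by
  set m : ℝ := ((ℓ + 1) * n + r₁) * (p - 1) with hm
  obtain ⟨c, hc, hvol⟩ := exists_volume_lower_bound (n := n) hℓ hp hR
  -- The shift to `t₁ + 1` ensures `s > 1`, as required by the lower bound even when `t₁ = 1`.
  have ht₂ : 1 ≤ t₁ + 1 := by linarith
  obtain ⟨B, hB, hlife⟩ := exists_lifespan_bound (a := 1 + r₂ - r₁) (m := m) (β := β) hp hc ht₂
  obtain ⟨C, hC, hbound⟩ := exists_bound_of_rpow_le (M := 4 * (t₁ + 1)) (by linarith) hB hk hκ hr hp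
  refine ⟨C, hC, fun ε T u hε hε1 hT hsol => le_coe_of_forall_lt hT fun t ht htT => ?_⟩
  refine hbound ε t hε hε1 (by linarith) ?_
  obtain ⟨W', hWd, hmono, hW1, hae, hNi, hW⟩ := hsol.mean_identity hℓ (by linarith) hR hu₀ hu₁
    hu₀_supp hu₁_supp hdata hε hsum hprod ht htT
  have hI := Icc_subset_timeInterval htT
  have hWnn : ∀ s ∈ Icc 1 t, 0 ≤ s ^ r₁ * ∫ x, u s x := fun s hs => by
    refine le_trans ?_ (hmono ⟨le_rfl, ht.le⟩ hs hs.1)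
    simp only [hW1]
    exact mul_nonneg hε.le (integral_nonneg_of_ae hu₀_nonneg)
  refine hlife _ t _ W' (by positivity) ht hWd hmono
    (fun s hs => hlow ε T u hε hsol s (by linarith [hs.1]) (by linarith [hs.1])
      (hI ⟨by linarith [hs.1], hs.2⟩).2) fun x y hx hxy hyt => ?_
  refine le_trans ?_ (hW x y hx hxy hyt)
  have hsub : Icc x y ⊆ Icc 1 t := Icc_subset_Icc hx hyt
  have hWc : ContinuousOn (fun s => s ^ r₁ * ∫ x, u s x) (Icc 1 t) :=
    fun s hs => (hWd s hs).continuousWithinAt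
  rw [← intervalIntegral.integral_const_mul]
  refine intervalIntegral.integral_mono_ae_restrict hxy.le
    ((continuousOn_const.mul ((continuousOn_rpow_Icc _ t).mul (hWc.rpow_const
      fun _ _ => Or.inr (by linarith)))).mono hsub |>.intervalIntegrable_of_Icc hxy.le)
    (hNi.mono_set (by rw [uIcc_of_le hxy.le, uIcc_of_le ht.le]; exact hsub)) ?_
  rw [restrict_Ioc_eq_restrict_Icc] at hae
  filter_upwards [ae_restrict_of_ae_restrict_of_subset hsub hae,
    ae_restrict_mem measurableSet_Icc] with s hs hsxy
  have hsI := hsub hsxy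
  have hs0 : 0 < s := by linarith [hsI.1]
  have h1 := hvol s (u s) hsI.1 (hsol.locallyIntegrable hsI.1 (hI hsI).2).aestronglyMeasurable hs
    (hsol.ae_eq_zero hℓ hu₀_supp hsI.1 (hI hsI).2)
  have hU : 0 ≤ ∫ x, u s x :=
    nonneg_of_mul_nonneg_right (hWnn s hsI) (Real.rpow_pos_of_pos hs0 _)
  rw [abs_of_nonneg hU] at h1
  -- Rewriting the `p`-th power of the mean in terms of `W = s ^ r₁ ∫ u` costs `s ^ (-r₁ p)`; this
  -- bookkeeping determines `m`.
  have e : s ^ (1 + r₂ - r₁ - m) * s ^ (r₁ * p) = s ^ (r₂ + 1) * s ^ (-(n * (ℓ + 1) * (p - 1))) := by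
    rw [← Real.rpow_add hs0, ← Real.rpow_add hs0]; congr 1; rw [hm]; ring
  calc c * (s ^ (1 + r₂ - r₁ - m) * (s ^ r₁ * ∫ x, u s x) ^ p)
      = s ^ (r₂ + 1) * (c * s ^ (-(n * (ℓ + 1) * (p - 1))) * (∫ x, u s x) ^ p) := by
        rw [Real.mul_rpow (Real.rpow_nonneg hs0.le _) hU, ← Real.rpow_mul hs0.le]
        linear_combination c * (∫ x, u s x) ^ p * e
    _ ≤ _ := by gcongr

end Lifespan

/-! ### Subcriticality in terms of exponents -/

section Exponents

/-- Here `θ = (ℓ + 1)(1 + B p - A p²)`. If `A > 0`, the roots have opposite signs, so a positive `p`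
below the larger one lies between them. If `A ≤ 0`, then `B = 1 + 2 (d - 1) - 3 A > 0`, because `μ ≥
0` gives `d ≥ 1`. -/
theorem theta_pos {n : ℕ} (hn : 1 ≤ n) {ℓ μ p : ℝ} (hℓ : -1 < ℓ) (hμ : 0 ≤ μ) (hp : 1 < p)
    (h : (p : EReal) < pStr (n + μ / (ℓ + 1)) ℓ) : 0 < theta n ℓ μ p := by
  have hℓ1 : 0 < ℓ + 1 := by linarith
  have hn' : (1 : ℝ) ≤ n := by exact_mod_cast hn
  set d : ℝ := n + μ / (ℓ + 1) with hd
  have hd1 : 1 ≤ d := by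
    have : 0 ≤ μ / (ℓ + 1) := by positivity
    linarith
  have e : theta n ℓ μ p = (ℓ + 1) * (1 + strB d ℓ * p - strA d ℓ * p ^ 2) := by
    rw [theta, strA, strB, hd]
    field_simp
    ring
  rw [e]
  refine mul_pos hℓ1 ?_
  by_cases hA : 0 < strA d ℓ
  · rw [pStr, if_pos hA, EReal.coe_lt_coe_iff, strRoot, lt_div_iff₀ (by positivity)] at h
    set A := strA d ℓ
    set B := strB d ℓ
    have hS : 0 ≤ B ^ 2 + 4 * A := by positivity
    have h1 : 2 * A * p - B < √(B ^ 2 + 4 * A) := by linarith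
    rcases le_total 0 (2 * A * p - B) with h0 | h0
    · have h2 : (2 * A * p - B) ^ 2 < B ^ 2 + 4 * A := by
        rw [← Real.sq_sqrt hS]
        gcongr
      have h3 : 0 < 4 * A * (1 + B * p - A * p ^ 2) := by linarith
      exact pos_of_mul_pos_right h3 (by positivity)
    · have h2 : 2 * A * p * p ≤ B * p := by
        have : 2 * A * p ≤ B := by linarith
        gcongr
      have h3 : 0 < A * p ^ 2 := by positivity
      linarith
  · rw [not_lt] at hA
    have hB : 0 < strB d ℓ := by
      have h1 : strB d ℓ = 1 + 2 * (d - 1) - 3 * strA d ℓ := by rw [strA, strB]; ring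
      linarith
    have h2 : strA d ℓ * p ^ 2 ≤ 0 := mul_nonpos_of_nonpos_of_nonneg hA (by positivity)
    have h3 : 0 < strB d ℓ * p := by positivity
    linarith

theorem two_sub_mul_pos {k p : ℝ} (hp : 1 < p) (h : (p : EReal) < pFuj k) :
    0 < 2 - k * (p - 1) := by
  by_cases hk : 0 < k
  · rw [pFuj, if_pos hk, EReal.coe_lt_coe_iff] at h
    have h1 : p - 1 < 2 / k := by linarith
    rw [lt_div_iff₀ hk] at h1
    linarith
  · have : k * (p - 1) ≤ 0 := mul_nonpos_of_nonpos_of_nonneg (not_lt.1 hk) (by linarith)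
    linarith

end Exponents

/-! ### Improved lower bound for the mean -/

section MeanLowerBounds

variable {n : ℕ}

local notation "𝔼" => EuclideanSpace ℝ (Fin n)

/-- The bound `∫ |u| ^ p ≥ c ε ^ p s ^ e` is inserted into the identity for the mean and integrated
twice, with `g = r₂ + 1 + e`, `a = 1 + r₂ - r₁` and hence `g + 2 - a = e + 2 + r₁`. -/
theorem exists_mean_lower_bound (hn : 1 ≤ n) {ℓ μ ν p R r₁ r₂ : ℝ} (hℓ : -1 < ℓ)
    (hp : 1 < p) (hR : 0 < R) (hsum : r₁ + r₂ = μ - 1) (hprod : r₁ * r₂ = ν ^ 2)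
    (hr : r₁ ≤ r₂) {u₀ u₁ : 𝔼 → ℝ} (hu₀ : LocallyIntegrable u₀ volume)
    (hu₁ : LocallyIntegrable u₁ volume) (hu₀_nonneg : ∀ᵐ x, 0 ≤ u₀ x)
    (hu₀_nontriv : ¬ ∀ᵐ x, u₀ x = 0) (hu₀_supp : ∀ᵐ x, R < ‖x‖ → u₀ x = 0)
    (hu₁_supp : ∀ᵐ x, R < ‖x‖ → u₁ x = 0) (hdata : ∀ᵐ x, 0 ≤ u₁ x + r₁ * u₀ x) :
    ∃ k : ℝ, 0 < k ∧ ∀ (ε : ℝ) (T : EReal) (u : ℝ → 𝔼 → ℝ), 0 < ε →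
      IsWeakSolution ℓ μ ν p R ε u₀ u₁ T u → ∀ s : ℝ, 4 ≤ s → 1 < s → (s : EReal) < T →
      k * ε ^ p * s ^ (-((ℓ + μ) / 2 * p) - (ℓ + 1) * ((n : ℝ) - 1) * (p / 2 - 1) + 2 + r₁)
        ≤ s ^ r₁ * ∫ x, u s x := by
  set e : ℝ := -((ℓ + μ) / 2 * p) - (ℓ + 1) * ((n : ℝ) - 1) * (p / 2 - 1) with he
  obtain ⟨c, hc, hN⟩ := exists_nonlinear_lower_bound hn hℓ hp hR hsum hprod hr hu₀ hu₁ hu₀_nonneg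
    hu₀_nontriv hu₀_supp hu₁_supp hdata
  obtain ⟨c', hc', hdy⟩ := exists_dyadic_lower_bound (1 + r₂ - r₁) (r₂ + 1 + e)
  refine ⟨c' * c, by positivity, fun ε T u hε hsol t ht4 ht htT => ?_⟩
  obtain ⟨W', hWd, hmono, hW1, hae, hNi, hW⟩ := hsol.mean_identity hℓ (by linarith) hR hu₀ hu₁
    hu₀_supp hu₁_supp hdata hε hsum hprod ht htT
  have hI := Icc_subset_timeInterval htT
  have hmain := hdy (c * ε ^ p) t _ W' (by positivity) hWd (fun s hs => by
      refine le_trans ?_ (hmono ⟨le_rfl, ht.le⟩ hs hs.1)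
      simp only [hW1]
      exact mul_nonneg hε.le (integral_nonneg_of_ae hu₀_nonneg)) (fun x y hx hxy hyt => by
      refine le_trans ?_ (hW x y hx hxy hyt)
      have hsub : Icc x y ⊆ Icc 1 t := Icc_subset_Icc hx hyt
      have hsub' : Ioc x y ⊆ Ioc 1 t := Ioc_subset_Ioc hx hyt
      rw [intervalIntegral.integral_of_le hxy.le, intervalIntegral.integral_of_le hxy.le]
      refine integral_mono_ae
        ((continuousOn_const.mul (continuousOn_rpow_Icc _ t)).mono
          hsub |>.integrableOn_Icc.mono_set Ioc_subset_Icc_self)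
        ((intervalIntegrable_iff_integrableOn_Ioc_of_le ht.le).1 hNi |>.mono_set hsub') ?_
      filter_upwards [ae_restrict_of_ae_restrict_of_subset hsub' hae,
        ae_restrict_mem measurableSet_Ioc] with s hs hsxy
      have hsI := hsub' hsxy
      have hs0 : 0 < s := by linarith [hsI.1]
      have h1 := hN ε T u hε hsol s hsI.1 (hI (Ioc_subset_Icc_self hsI)).2 hs
      calc c * ε ^ p * s ^ (r₂ + 1 + e) = s ^ (r₂ + 1) * (c * ε ^ p * s ^ e) := by
            rw [Real.rpow_add hs0]; ring
        _ ≤ _ := by gcongr) t ⟨ht4, le_rfl⟩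
  rw [show r₂ + 1 + e + 2 - (1 + r₂ - r₁) = e + 2 + r₁ by ring] at hmain
  linarith

end MeanLowerBounds

end EPDT

/-! ### The main theorem -/

theorem theorem1 (n : ℕ) (hn : 1 ≤ n) (ℓ μ ν p R : ℝ) (hℓ : -1 < ℓ) (hμ : 0 ≤ μ)
    (hδ : 0 ≤ EPDT.delta μ ν) (hp : 1 < p)
    (hpc : (p : EReal) <
      max (EPDT.pStr (n + μ / (ℓ + 1)) ℓ) (EPDT.pFuj (EPDT.fujDim n ℓ μ ν)))
    (hR : 0 < R)
    (u₀ u₁ : EuclideanSpace ℝ (Fin n) → ℝ)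
    (hu₀ : LocallyIntegrable u₀ volume) (hu₁ : LocallyIntegrable u₁ volume)
    (hu₀_nonneg : ∀ᵐ x, 0 ≤ u₀ x) (hu₁_nonneg : ∀ᵐ x, 0 ≤ u₁ x)
    (hu₀_nontriv : ¬ ∀ᵐ x, u₀ x = 0) (hu₁_nontriv : ¬ ∀ᵐ x, u₁ x = 0)
    (hu₀_supp : ∀ᵐ x, R < ‖x‖ → u₀ x = 0) (hu₁_supp : ∀ᵐ x, R < ‖x‖ → u₁ x = 0)
    (hdata : ∀ᵐ x, 0 ≤ u₁ x + (μ - 1 - √(EPDT.delta μ ν)) / 2 * u₀ x) :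
    ∃ ε₀ : ℝ, 0 < ε₀ ∧ ∃ C : ℝ, 0 < C ∧
      ∀ ε : ℝ, 0 < ε → ε ≤ ε₀ →
        ∀ (T : EReal) (u : ℝ → EuclideanSpace ℝ (Fin n) → ℝ), 1 < T →
          EPDT.IsWeakSolution ℓ μ ν p R ε u₀ u₁ T u →
          T < ⊤ ∧
          ((p : EReal) < EPDT.pStr (n + μ / (ℓ + 1)) ℓ →
            T ≤ ((C * ε ^ (-(p * (p - 1) / EPDT.theta n ℓ μ p)) : ℝ) : EReal)) ∧
          ((p : EReal) < EPDT.pFuj (EPDT.fujDim n ℓ μ ν) →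
            T ≤ ((C * ε ^ (-(2 / (p - 1) - EPDT.fujDim n ℓ μ ν)⁻¹) : ℝ) : EReal)) := by
  set r₁ : ℝ := (μ - 1 - √(EPDT.delta μ ν)) / 2 with hr₁
  set r₂ : ℝ := (μ - 1 + √(EPDT.delta μ ν)) / 2 with hr₂
  have hsum : r₁ + r₂ = μ - 1 := by rw [hr₁, hr₂]; ring
  have hprod : r₁ * r₂ = ν ^ 2 := by
    have h := Real.sq_sqrt hδ
    rw [EPDT.delta] at h
    rw [hr₁, hr₂, EPDT.delta]
    linear_combination (-1 / 4) * h
  have hr : r₁ ≤ r₂ := by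
    rw [hr₁, hr₂]; linarith [Real.sqrt_nonneg (EPDT.delta μ ν)]
  have hfuj : EPDT.fujDim n ℓ μ ν = (ℓ + 1) * n + r₁ := by rw [EPDT.fujDim, hr₁]; ring
  have hp1 : 0 < p - 1 := by linarith
  have hS : ∃ C : ℝ, 0 < C ∧ ∀ (ε : ℝ) (T : EReal) (u : ℝ → EuclideanSpace ℝ (Fin n) → ℝ),
      0 < ε → ε ≤ 1 → 1 < T → EPDT.IsWeakSolution ℓ μ ν p R ε u₀ u₁ T u →
      (p : EReal) < EPDT.pStr (n + μ / (ℓ + 1)) ℓ →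
      T ≤ ((C * ε ^ (-(p * (p - 1) / EPDT.theta n ℓ μ p)) : ℝ) : EReal) := by
    by_cases hcase : (p : EReal) < EPDT.pStr (n + μ / (ℓ + 1)) ℓ
    · obtain ⟨k, hk, hlow⟩ := EPDT.exists_mean_lower_bound hn hℓ hp hR hsum hprod hr hu₀ hu₁
        hu₀_nonneg hu₀_nontriv hu₀_supp hu₁_supp hdata
      -- With the exponent `β` of the improved lower bound, `κ` is exactly `θ`; the contributions of
      -- `r₁` cancel.
      have hθ : (-((ℓ + μ) / 2 * p) - (ℓ + 1) * ((n : ℝ) - 1) * (p / 2 - 1) + 2 + r₁) * (p - 1)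
          + 2 - ((ℓ + 1) * n + r₁) * (p - 1) = EPDT.theta n ℓ μ p := by
        rw [EPDT.theta]; ring
      obtain ⟨C, hC, h⟩ := EPDT.exists_lifespan_of_mean_lower_bound hℓ hp hR hu₀ hu₁ hu₀_nonneg
        hu₀_supp hu₁_supp hdata hsum hprod hk (by linarith : 0 ≤ p) (by norm_num)
        (by rw [hθ]; exact EPDT.theta_pos hn hℓ hμ hp hcase) hlow
      rw [hθ] at h
      exact ⟨C, hC, fun ε T u hε hε1 hT hsol _ => h ε T u hε hε1 hT hsol⟩
    · exact ⟨1, one_pos, fun _ _ _ _ _ _ _ h => absurd h hcase⟩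
  have hF : ∃ C : ℝ, 0 < C ∧ ∀ (ε : ℝ) (T : EReal) (u : ℝ → EuclideanSpace ℝ (Fin n) → ℝ),
      0 < ε → ε ≤ 1 → 1 < T → EPDT.IsWeakSolution ℓ μ ν p R ε u₀ u₁ T u →
      (p : EReal) < EPDT.pFuj (EPDT.fujDim n ℓ μ ν) →
      T ≤ ((C * ε ^ (-(2 / (p - 1) - EPDT.fujDim n ℓ μ ν)⁻¹) : ℝ) : EReal) := by
    by_cases hcase : (p : EReal) < EPDT.pFuj (EPDT.fujDim n ℓ μ ν)
    · have hκ := EPDT.two_sub_mul_pos hp hcase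
      rw [hfuj] at hκ ⊢
      have hI : 0 < ∫ x, u₀ x := by
        have hi := EPDT.integrable_mul_of_ae_zero hu₀ hu₀_supp hR
          (contDiff_const (c := (1 : ℝ)))
        simpa using EPDT.integral_mul_pos hi hu₀_nonneg hu₀_nontriv fun _ => one_pos
      -- The Fujita case uses only that the mean stays above its initial value `ε ∫ u₀`, so `β = 0`,
      -- `r = 1` and `k = ∫ u₀`.
      obtain ⟨C, hC, h⟩ := EPDT.exists_lifespan_of_mean_lower_bound (β := 0) (t₁ := 1) hℓ hp hR
        hu₀ hu₁ hu₀_nonneg hu₀_supp hu₁_supp hdata hsum hprod hI zero_le_one le_rfl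
        (by rw [zero_mul, zero_add]; exact hκ) fun ε T u hε hsol s _ hs hsT => by
          obtain ⟨W', -, hmono, hW1, -⟩ := hsol.mean_identity hℓ (by linarith) hR hu₀ hu₁
            hu₀_supp hu₁_supp hdata hε hsum hprod hs hsT
          have hle := hmono ⟨le_rfl, hs.le⟩ ⟨hs.le, le_rfl⟩ hs.le
          simp only [hW1] at hle
          rw [Real.rpow_one, Real.rpow_zero, mul_one, mul_comm]
          exact hle
      refine ⟨C, hC, fun ε T u hε hε1 hT hsol _ => ?_⟩
      have hexp : (2 / (p - 1) - ((ℓ + 1) * n + r₁))⁻¹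
          = 1 * (p - 1) / (0 * (p - 1) + 2 - ((ℓ + 1) * n + r₁) * (p - 1)) := by
        rw [div_sub' hp1.ne', inv_div, one_mul, zero_mul, zero_add, mul_comm (p - 1)]
      rw [hexp]
      exact h ε T u hε hε1 hT hsol
    · exact ⟨1, one_pos, fun _ _ _ _ _ _ _ h => absurd h hcase⟩
  obtain ⟨C₁, hC₁, h₁⟩ := hS
  obtain ⟨C₂, hC₂, h₂⟩ := hF
  -- Any `ε ≤ 1` is admissible, and the sum of the two constants serves both bounds at once.
  refine ⟨1, one_pos, C₁ + C₂, by positivity, fun ε hε hε1 T u hT hsol => ⟨?_, fun h => ?_,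
    fun h => ?_⟩⟩
  · rcases lt_max_iff.1 hpc with h | h
    · exact (h₁ ε T u hε hε1 hT hsol h).trans_lt (EReal.coe_lt_top _)
    · exact (h₂ ε T u hε hε1 hT hsol h).trans_lt (EReal.coe_lt_top _)
  · refine (h₁ ε T u hε hε1 hT hsol h).trans (EReal.coe_le_coe_iff.2 ?_)
    gcongr
    linarith
  · refine (h₂ ε T u hε hε1 hT hsol h).trans (EReal.coe_le_coe_iff.2 ?_)
    gcongr
    linarith
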